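/- Let $0<q<1$, $g>0$, $t=q^g$ and $\xi\in\mathbb C\setminus\{0\}$. Write $(a;q)_n=\prod_{k=0}^{n-1}(1-aq^k)$, $(a;q)_\infty=\prod_{k\ge0}(1-aq^k)$, $(a_1,\dots,a_m;q)_\infty=\prod_i(a_i;q)_\infty$, $L_q(\nu;x,y)=(\nu xy,\nu xy^{-1},\nu x^{-1}y,\nu x^{-1}y^{-1};q)_\infty$, $\Gamma_q(s)=\frac{(q;q)_\infty}{(q^s;q)_\infty}(1-q)^{1-s}$, $B_q(\alpha,\beta)=\frac{\Gamma_q(\alpha)\Gamma_q(\beta)}{\Gamma_q(\alpha+\beta)}$. For real $\alpha,\beta$ and $r,y\in\mathbb C\setminus\{0\}$ put $$\mathcal M_{\alpha\beta}(r,y|x)=\frac{(1-q)(q;q)_\infty^2\,(x^2,x^{-2};q)_\infty\,L_q(q^{(\alpha+\beta)/2};r,y)}{2B_q(\alpha,\beta)\,L_q(q^{\alpha/2};y,x)\,L_q(q^{\beta/2};r,x)},\qquad (M^r_{\alpha\beta}\varphi)(y)=\frac1{2\pi i}\int_{\Gamma^{r,y}_{\alpha\beta}}\frac{dx}{x}\,\mathcal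 M_{\alpha\beta}(r,y|x)\,\varphi(x).$$ Here, with $a=yq^{\alpha/2}$, $b=y^{-1}q^{\alpha/2}$, $c=rq^{\beta/2}$, $d=r^{-1}q^{\beta/2}$, and $C_{p,\rho}$ the counter-clockwise circle with centre $p$ and radius $\rho$, $$\Gamma^{r,y}_{\alpha\beta}=C_{0,1}+\sum_{z=a,b,c,d}\ \sum_{k\ge0,\ |z|q^k>1}\bigl(C_{zq^k,\varepsilon}-C_{z^{-1}q^{-k},\varepsilon}\bigr),$$ $\varepsilon>0$ being sufficiently small. The point $(r,y)$ is called generic for $(\alpha,\beta)$ if no point $zq^k$ ($z\in\{a,b,c,d\}$, $k\ge0$) lies on the unit circle, and a point $zq^k$ with $|z|q^k>1$ coincides neither with a point $z'q^l$ coming from another of the four parameters nor with any point $z'^{-1}q^{-l}$. Let $\mathrm{Sym}$ be the space of symmetric Laurent polynomials in two variables with complex coefficients. For $\lambda=(\lambda_1,\lambda_2)\in\mathbb Z^2$ with $\lambda_1\le\lambda_2$ put $|\lambda|=\lambda_1+\lambda_2$, $n=\lambda_2-\lambda_1$. Let $C_n(\cdot\,;t|q)$ be the continuous $q$-ultraspherical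 polynomial, $C_n(\cos\theta;t|q)=\sum_{k=0}^n\frac{(t;q)_k(t;q)_{n-k}}{(q;q)_k(q;q)_{n-k}}e^{i(n-2k)\theta}$, and $$P_\lambda(x_+x_-,x_+x_-^{-1})=x_+^{|\lambda|}\frac{(q;q)_n}{(t;q)_n}C_n\Bigl(\tfrac{x_-+x_-^{-1}}2;t\Big|q\Bigr),\qquad f_\lambda(y)=y^{\lambda_1}\,{}_2\phi_1\!\left[{t,\ q^{-n}\atop t^{-1}q^{1-n}};q,t^{-2}qy\right],$$ $$c_{\lambda,\xi}=t^{-2\lambda_1+\lambda_2}\,\xi^{|\lambda|}\,\frac{(t;q)_n}{(t^2;q)_n},$$ so that $P_\lambda$ is the $A_1$ Macdonald polynomial. **Theorem.** (1) There is one and only one linear operator $M_\xi:\mathrm{Sym}\to\mathrm{Sym}$ such that for all $f\in\mathrm{Sym}$ and $y_\pm\in\mathbb C\setminus\{0\}$ with $(t^{-1}y_+,y_-)$ generic for $(g,g)$ $$(M_\xi f)(y_+y_-,y_+y_-^{-1})=\frac1{2\pi i}\int_{\Gamma^{t^{-1}y_+,\,y_-}_{g,g}}\frac{dz}z\,\mathcal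 M_{gg}(t^{-1}y_+,y_-|z)\,f(t^{-1/2}\xi y_+z,\ t^{-1/2}\xi y_+z^{-1}),$$ and $M_\xi$ is bijective. (2) Its inverse is given, for all $f\in\mathrm{Sym}$ and $x_\pm\in\mathbb C\setminus\{0\}$, by $$(M_\xi^{-1}f)(x_+x_-,x_+x_-^{-1})=\frac1{2\pi i}\int_{\Gamma^{r,\,x_-}_{-g,2g}}\frac{dz}z\,\mathcal M_{-g,2g}(r,x_-|z)\,f(t^{1/2}\xi^{-1}x_+z,\ t^{1/2}\xi^{-1}x_+z^{-1}),\qquad r=t^{-1/2}\xi^{-1}x_+ .\qquad(*)$$ This holds literally whenever $(r,x_-)$ is generic for $(-g,2g)$ (which forces $g\notin\mathbb Z$). In addition, whenever $(r,x_-)$ is generic for $(\alpha,2g)$ for all real $\alpha\ne-g$ near $-g$, the left side is the limit for $\alpha\to-g$ of the right side with $\mathcal M_{\alpha,2g}$ and $\Gamma^{r,x_-}_{\alpha,2g}$ in place of $\mathcal M_{-g,2g}$ and $\Gamma^{r,x_-}_{-g,2g}$; this is the meaning of $(*)$ when $g$ is a positive integer, in which case $1/B_q(-g,2g)=0$ and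 the contour is pinched. (3) For all integers $\lambda_1\le\lambda_2$, $M_\xi^{-1}$ sends $c_{\lambda,\xi}f_\lambda(y_1)f_\lambda(y_2)\in\mathrm{Sym}$ to $P_\lambda(x_1,x_2)$. Consequently $P_\lambda(x_+x_-,x_+x_-^{-1})$ equals the right side of $(*)$, understood as in (2), with $f(y_1,y_2)=c_{\lambda,\xi}f_\lambda(y_1)f_\lambda(y_2)$; this is an integral representation of the $A_1$ Macdonald (and so of the $q$-ultraspherical) polynomials in terms of the one-variable polynomials $f_\lambda$. -/

import Mathlib

open Filter Topology Finset

noncomputable section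

namespace SeparationOfVariables

/-- The finite `q`-shifted factorial `(a;q)_n = ∏_{k<n} (1 - a q^k)`. -/
def qPoch (q : ℝ) (a : ℂ) (n : ℕ) : ℂ := ∏ k ∈ range n, (1 - a * (q : ℂ) ^ k)

/-- The infinite `q`-shifted factorial `(a;q)_∞ = ∏_{k≥0} (1 - a q^k)`, for `|q| < 1`. -/
def qPochInf (q : ℝ) (a : ℂ) : ℂ := ∏' k : ℕ, (1 - a * (q : ℂ) ^ k)

/-- `L_q(ν; x, y) = (ν x y, ν x y⁻¹, ν x⁻¹ y, ν x⁻¹ y⁻¹; q)_∞`. -/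
def qL (q : ℝ) (ν x y : ℂ) : ℂ :=
  qPochInf q (ν * x * y) * qPochInf q (ν * x * y⁻¹) *
    qPochInf q (ν * x⁻¹ * y) * qPochInf q (ν * x⁻¹ * y⁻¹)

/-- The `q`-Gamma function `Γ_q(x) = (q;q)_∞ / (q^x;q)_∞ · (1-q)^{1-x}`. -/
def qGamma (q x : ℝ) : ℂ :=
  qPochInf q (q : ℂ) / qPochInf q ((q ^ x : ℝ) : ℂ) * (((1 - q) ^ (1 - x) : ℝ) : ℂ)

/-- The `q`-Beta function `B_q(α, β) = Γ_q(α) Γ_q(β) / Γ_q(α + β)`. -/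
def qBeta (q α β : ℝ) : ℂ := qGamma q α * qGamma q β / qGamma q (α + β)

/-- The kernel `𝓜_{αβ}(r, y | x)`. -/
def kernelM (q α β : ℝ) (r y x : ℂ) : ℂ :=
  ((1 - q : ℂ) * qPochInf q (q : ℂ) ^ 2 * (qPochInf q (x ^ 2) * qPochInf q (x ^ (-2 : ℤ))) *
      qL q ((q ^ ((α + β) / 2) : ℝ) : ℂ) r y) /
    (2 * qBeta q α β * qL q ((q ^ (α / 2) : ℝ) : ℂ) y x * qL q ((q ^ (β / 2) : ℝ) : ℂ) r x)

/-- The Askey–Wilson parameters `a = y q^{α/2}`, `b = y⁻¹ q^{α/2}`, `c = r q^{β/2}`,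
`d = r⁻¹ q^{β/2}`. The denominator of `𝓜_{αβ}(r, y | x)` vanishes exactly at the points
`x = z q^k` and `x = z⁻¹ q^{-k}`, where `z` is one of `a, b, c, d` and `k ≥ 0`. -/
def awParams (q α β : ℝ) (r y : ℂ) : Fin 4 → ℂ :=
  ![y * ((q ^ (α / 2) : ℝ) : ℂ), y⁻¹ * ((q ^ (α / 2) : ℝ) : ℂ),
    r * ((q ^ (β / 2) : ℝ) : ℂ), r⁻¹ * ((q ^ (β / 2) : ℝ) : ℂ)]

/-- The condition on the parameters under which the cycle `Γ_{abcd}` is defined as it is written: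
no pole of the kernel lies on the unit circle, and a pole `z q^k` outside the unit circle (around
which a small circle is added) coincides with no other pole, neither one of the form `z' q^l` nor
one of the form `z'⁻¹ q^{-l}`. (The poles `z⁻¹ q^{-k}` are the mirror images under `x ↦ x⁻¹`.)
If `|a|, |b|, |c|, |d| < 1` the condition holds. -/
def AWGeneric (q : ℝ) (v : Fin 4 → ℂ) : Prop :=
  (∀ i, ∀ k : ℕ, ‖v i‖ * q ^ k ≠ 1) ∧
  (∀ i j, ∀ k l : ℕ, 1 < ‖v i‖ * q ^ k →
    v i * (q : ℂ) ^ k = v j * (q : ℂ) ^ l → i = j) ∧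
  (∀ i j, ∀ k l : ℕ, 1 < ‖v i‖ * q ^ k →
    v i * (q : ℂ) ^ k * (v j * (q : ℂ) ^ l) ≠ 1)

/-- The integral of `F` over the cycle
`C_{0,1} + ∑_{z = a,b,c,d} ∑_{k ≥ 0, |z| q^k > 1} (C_{z q^k, ε} - C_{z⁻¹ q^{-k}, ε})`,
all circles being oriented counter-clockwise. For `|q| < 1` the sums are finite. -/
def cycleIntegral (q : ℝ) (v : Fin 4 → ℂ) (ε : ℝ) (F : ℂ → ℂ) : ℂ :=
  (∮ x in C(0, 1), F x) +
    ∑ i, ∑ᶠ (k : ℕ) (_ : 1 < ‖v i‖ * q ^ k),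
      ((∮ x in C(v i * (q : ℂ) ^ k, ε), F x) -
        (∮ x in C((v i)⁻¹ * ((q : ℂ) ^ k)⁻¹, ε), F x))

/-- `I` is the value at `y` of `M_{αβ}^r φ`, that is, of
`(1 / 2πi) ∫_{Γ_{αβ}^{r,y}} (dx / x) 𝓜_{αβ}(r, y | x) φ(x)`,
the auxiliary circles in the cycle having any sufficiently small radius `ε > 0`. -/
def HasMValue (q α β : ℝ) (r : ℂ) (φ : ℂ → ℂ) (y I : ℂ) : Prop :=
  ∀ᶠ ε in 𝓝[>] (0 : ℝ),
    (2 * (Real.pi : ℂ) * Complex.I)⁻¹ *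
      cycleIntegral q (awParams q α β r y) ε (fun x => x⁻¹ * (kernelM q α β r y x * φ x)) = I

/-- The parameter `t = q^g`, raised to a real power `s`, as a complex number. -/
def tPow (q g s : ℝ) : ℂ := (((q ^ g) ^ s : ℝ) : ℂ)

/-- `I` is the value of `M_ξ f` at the point `y_1 = y_+ y_-`, `y_2 = y_+ / y_-`: the contour integral
`(1 / 2πi) ∫ (dz / z) 𝓜_{gg}(t⁻¹ y_+, y_- | z) f(t^{-1/2} ξ y_+ z, t^{-1/2} ξ y_+ z⁻¹)`. -/
def HasMxiValue (q g : ℝ) (ξ : ℂ) (f : ℂ → ℂ → ℂ) (yp ym I : ℂ) : Prop :=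
  HasMValue q g g (tPow q g (-1) * yp)
    (fun z => f (tPow q g (-1 / 2) * ξ * yp * z) (tPow q g (-1 / 2) * ξ * yp * z⁻¹)) ym I

/-- `I` is the value, at the point `x_1 = x_+ x_-`, `x_2 = x_+ / x_-`, of the contour integral
`(1 / 2πi) ∫ (dz / z) 𝓜_{α,2g}(r, x_- | z) f(t^{1/2} ξ⁻¹ x_+ z, t^{1/2} ξ⁻¹ x_+ z⁻¹)`,
`r = t^{-1/2} ξ⁻¹ x_+`. The kernel of the inversion formula is the one with `α = -g`. -/
def HasInvValue (q g : ℝ) (ξ : ℂ) (α : ℝ) (f : ℂ → ℂ → ℂ) (xp xm I : ℂ) : Prop :=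
  HasMValue q α (2 * g) (tPow q g (-1 / 2) * ξ⁻¹ * xp)
    (fun z => f (tPow q g (1 / 2) * ξ⁻¹ * xp * z) (tPow q g (1 / 2) * ξ⁻¹ * xp * z⁻¹)) xm I

/-- The genericity condition for the contour of `HasMxiValue`. -/
def MxiGeneric (q g : ℝ) (yp ym : ℂ) : Prop :=
  AWGeneric q (awParams q g g (tPow q g (-1) * yp) ym)

/-- The genericity condition for the contour of `HasInvValue`. -/
def InvGeneric (q g : ℝ) (ξ : ℂ) (α : ℝ) (xp xm : ℂ) : Prop :=
  AWGeneric q (awParams q α (2 * g) (tPow q g (-1 / 2) * ξ⁻¹ * xp) xm)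

/-- The inversion formula at the point `(x_+, x_-)`: `I` is the value there of the contour integral
with kernel `𝓜_{-g,2g}` applied to `f`. The first part is the literal statement, whenever the cycle
is defined. The second part says that the value is also obtained by continuity in the first index
`α → -g`; it gives the integral its meaning where the literal formula has none, in particular when
`g` is a positive integer (then `1 / B_q(-g, 2g) = 0` and the contour is pinched at `α = -g`). -/
def InversionFormula (q g : ℝ) (ξ : ℂ) (f : ℂ → ℂ → ℂ) (xp xm I : ℂ) : Prop :=
  (InvGeneric q g ξ (-g) xp xm → HasInvValue q g ξ (-g) f xp xm I) ∧
  ((∀ᶠ α in 𝓝[≠] (-g), InvGeneric q g ξ α xp xm) →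
    ∃ J : ℝ → ℂ, (∀ᶠ α in 𝓝[≠] (-g), HasInvValue q g ξ α f xp xm (J α)) ∧
      Tendsto J (𝓝[≠] (-g)) (𝓝 I))

/-- Laurent polynomials in two variables: the group algebra of `ℤ × ℤ`. -/
abbrev Laurent2 : Type := AddMonoidAlgebra ℂ (ℤ × ℤ)

/-- The value of a Laurent polynomial at a point with nonzero coordinates. -/
def Laurent2.eval (f : Laurent2) (x₁ x₂ : ℂ) : ℂ :=
  f.coeff.sum fun m c => c * x₁ ^ m.1 * x₂ ^ m.2

/-- The space of symmetric Laurent polynomials in two variables. -/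
def SymLaurent : Submodule ℂ Laurent2 where
  carrier := {f | ∀ a b : ℤ, f.coeff (a, b) = f.coeff (b, a)}
  zero_mem' := by intro a b; simp
  add_mem' := by
    intro f h hf hh a b
    simp [hf a b, hh a b]
  smul_mem' := by
    intro c f hf a b
    simp [hf a b]

/-- The continuous `q`-ultraspherical polynomial `C_n(·; β | q)`: for `ξ = cos θ` it is
`∑_{k=0}^n (β;q)_k (β;q)_{n-k} / ((q;q)_k (q;q)_{n-k}) e^{i(n-2k)θ}`, in which the coefficient is
invariant under `k ↦ n - k`, so that `e^{i(n-2k)θ}` may be replaced by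
`cos (n-2k)θ = T_{n-2k}(cos θ)`. -/
def qUltraspherical (q : ℝ) (β : ℂ) (n : ℕ) : Polynomial ℂ :=
  ∑ k ∈ range (n + 1),
    Polynomial.C (qPoch q β k * qPoch q β (n - k) /
        (qPoch q (q : ℂ) k * qPoch q (q : ℂ) (n - k))) *
      Polynomial.Chebyshev.T ℂ ((n : ℤ) - 2 * k)

/-- `λ_{21} = λ_2 - λ_1` for `λ_1 ≤ λ_2`. -/
def gap (l₁ l₂ : ℤ) : ℕ := (l₂ - l₁).toNat

/-- The `A_1` Macdonald polynomial `P_λ(x_1, x_2)` at `x_1 = x_+ x_-`, `x_2 = x_+ / x_-`: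
`x_+^{|λ|} (q;q)_{λ_{21}} / (t;q)_{λ_{21}} C_{λ_{21}}((x_- + x_-⁻¹) / 2; t | q)`. -/
def macdonaldA1 (q g : ℝ) (l₁ l₂ : ℤ) (xp xm : ℂ) : ℂ :=
  xp ^ (l₁ + l₂) *
    (qPoch q (q : ℂ) (gap l₁ l₂) / qPoch q (tPow q g 1) (gap l₁ l₂)) *
    (qUltraspherical q (tPow q g 1) (gap l₁ l₂)).eval ((xm + xm⁻¹) / 2)

/-- The separated polynomial
`f_λ(y) = y^{λ_1} ₂φ₁(t, q^{-λ_{21}}; t⁻¹ q^{1-λ_{21}}; q, t^{-2} q y)`, a terminating series. -/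
def sepPoly (q g : ℝ) (l₁ l₂ : ℤ) (y : ℂ) : ℂ :=
  y ^ l₁ * ∑ k ∈ range (gap l₁ l₂ + 1),
    qPoch q (tPow q g 1) k * qPoch q ((q : ℂ) ^ (-(gap l₁ l₂ : ℤ))) k /
      (qPoch q (q : ℂ) k * qPoch q (tPow q g (-1) * (q : ℂ) ^ (1 - (gap l₁ l₂ : ℤ))) k) *
      (tPow q g (-2) * (q : ℂ) * y) ^ k

/-- `c_{λ,ξ} = t^{-2λ_1+λ_2} ξ^{|λ|} (t;q)_{λ_{21}} / (t²;q)_{λ_{21}}`. -/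
def normCoeff (q g : ℝ) (ξ : ℂ) (l₁ l₂ : ℤ) : ℂ :=
  tPow q g 1 ^ (-2 * l₁ + l₂) * ξ ^ (l₁ + l₂) *
    (qPoch q (tPow q g 1) (gap l₁ l₂) / qPoch q (tPow q g 2) (gap l₁ l₂))

end SeparationOfVariables

end

/-!
As a function of the integration variable, the kernel `𝓜_{αβ}(r, y | z)` is a constant times the
Askey–Wilson weight with parameters `a, b, c, d` (`kernelM_eq`), and `Γ_{αβ}^{r,y}` is the cycle over
which the Askey–Wilson integral is evaluated by the classical product formula for all generic
parameters with `|abcd| < 1`. Multiplying the weight by `(cz, c z⁻¹; q)_k` replaces `c` by `c q^k`.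
Hence the product formula shows that the integral operator turns `(cz, c z⁻¹; q)_k`, `c = r q^{β/2}`,
into `(q^β;q)_k / (q^{α+β};q)_k` times `(c'y, c'y⁻¹; q)_k`, `c' = r q^{(α+β)/2}`
(`hasMValue_of_expansion`).

For every `c ≠ 0` the polynomials `(x₁ x₂)^m (c x₁, c x₂; q)_k` form a basis of the symmetric Laurent
polynomials (`symBasis`). The operator `M_ξ` maps the basis for `c = ξ⁻¹` to nonzero multiples of the
basis for `c = 1`. This defines a bijection `mxiEquiv`, which is given by the contour integral
(`hasMxiValue_mxiEquiv`) and is determined by it, since a Laurent polynomial is determined by its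
values on a torus (`eq_mxiEquiv_of_hasMxiValue`). For the kernel `𝓜_{α,2g}` the result is a rational
expression in `q^{α/2}` that is continuous at `α = -g`, where its factors are the inverses of
those of `M_ξ` (`inversionFormula_mxiEquiv_symm`).

The product formula `awFunctional_eq_awValue` is proved in two stages. When all parameters lie in the
unit disc, the cycle is the unit circle. The Askey–Wilson difference operator applied to `z + z⁻¹`
yields a function of integral zero (`circleIntegral_awHalf`). It follows that the integral and its
claimed value satisfy the same recurrence under the shift of a parameter by `q`, so that their
quotient is a constant, which is found at parameters for which the weight is a Laurent polynomial on
the circle. In the general case one argues by induction on the number of poles `v_i q^k` outside the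
circle. The relation between the shifts of two parameters (`awDefect_two_shifts`) settles the case of
two parameters outside the circle. If `a` is the only one outside, this relation determines the
dependence of the error term on another parameter `b`, and for `b = q / a` the weight is proportional
to one with fewer poles outside (`awDefect_inverse_pair`).

The Macdonald polynomial is the homogeneous Rogers polynomial up to normalisation. A divided
difference that lowers the degree gives its expansion in the products `(ξ⁻¹ x₁, ξ⁻¹ x₂; q)_k`, with
coefficients that depend on `x₁ x₂` only (`rogers_eq_rogersExp`). The image under `M_ξ` is therefore
explicit. It satisfies the second-order `q`-difference equation of the Rogers polynomials in the
variable `y₁ / t`, by a telescoping sum (`sepOp_sepExp`). A polynomial solution of this equation is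
determined by its value at `t⁻¹`, so that the image is a product of two Rogers polynomials
(`sepExp_eq_mul`), and these are the separated polynomials `f_λ`.
-/

open Filter Topology Finset

noncomputable section

namespace SeparationOfVariables

/-! ### Shifted factorials -/

section ShiftedFactorials

variable {q : ℝ}

lemma qPoch_zero (a : ℂ) : qPoch q a 0 = 1 := by simp [qPoch]

lemma qPoch_succ (a : ℂ) (n : ℕ) :
    qPoch q a (n + 1) = qPoch q a n * (1 - a * (q : ℂ) ^ n) := by
  simp [qPoch, prod_range_succ]

lemma qPoch_succ' (a : ℂ) (n : ℕ) :
    qPoch q a (n + 1) = (1 - a) * qPoch q (a * q) n := by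
  rw [qPoch, prod_range_succ', mul_comm]
  simp [qPoch, pow_succ', mul_assoc]

lemma qPoch_ne_zero {a : ℂ} {n : ℕ} (h : ∀ k < n, a * (q : ℂ) ^ k ≠ 1) : qPoch q a n ≠ 0 := by
  refine prod_ne_zero_iff.2 fun k hk => ?_
  exact sub_ne_zero.2 (h k (mem_range.1 hk)).symm

lemma differentiable_qPoch (n : ℕ) : Differentiable ℂ fun a => qPoch q a n := by
  unfold qPoch; fun_prop

lemma norm_qpow (hq0 : 0 < q) (k : ℕ) : ‖(q : ℂ) ^ k‖ = q ^ k := by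
  simp [abs_of_pos hq0]

lemma qC_ne_zero (hq0 : 0 < q) : (q : ℂ) ≠ 0 := by exact_mod_cast hq0.ne'

lemma mul_qpow_ne_one (hq0 : 0 < q) (hq1 : q < 1) {a : ℂ} (ha : ‖a‖ < 1) (k : ℕ) :
    a * (q : ℂ) ^ k ≠ 1 := by
  intro h
  have h1 := congrArg norm h
  rw [norm_mul, norm_qpow hq0, norm_one] at h1
  have : q ^ k ≤ 1 := pow_le_one₀ hq0.le hq1.le
  nlinarith [norm_nonneg a, pow_pos hq0 k]

lemma summable_qPochInf (hq0 : 0 < q) (hq1 : q < 1) (a : ℂ) :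
    Summable fun k : ℕ => ‖-(a * (q : ℂ) ^ k)‖ := by
  simp only [norm_neg, norm_mul, norm_qpow hq0]
  exact (summable_geometric_of_lt_one hq0.le hq1).mul_left _

lemma multipliable_qPochInf (hq0 : 0 < q) (hq1 : q < 1) (a : ℂ) :
    Multipliable fun k : ℕ => 1 - a * (q : ℂ) ^ k := by
  simpa [sub_eq_add_neg] using multipliable_one_add_of_summable (summable_qPochInf hq0 hq1 a)

lemma qPochInf_eq_qPoch_mul (hq0 : 0 < q) (hq1 : q < 1) (a : ℂ) (n : ℕ) :
    qPochInf q a = qPoch q a n * qPochInf q (a * (q : ℂ) ^ n) := by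
  have h := multipliable_qPochInf hq0 hq1 (a * (q : ℂ) ^ n)
  have h2 : (fun k : ℕ => 1 - a * (q : ℂ) ^ n * (q : ℂ) ^ k) =
      fun k : ℕ => 1 - a * (q : ℂ) ^ (k + n) := by
    funext k; rw [pow_add]; ring
  unfold qPochInf qPoch
  rw [h2] at h ⊢
  exact (Multipliable.prod_mul_tprod_nat_mul' (f := fun k : ℕ => 1 - a * (q : ℂ) ^ k) h).symm

lemma qPochInf_eq_mul (hq0 : 0 < q) (hq1 : q < 1) (a : ℂ) :
    qPochInf q a = (1 - a) * qPochInf q (a * q) := by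
  simpa [qPoch] using qPochInf_eq_qPoch_mul hq0 hq1 a 1

lemma qPochInf_ne_zero (hq0 : 0 < q) (hq1 : q < 1) {a : ℂ}
    (h : ∀ k : ℕ, a * (q : ℂ) ^ k ≠ 1) : qPochInf q a ≠ 0 := by
  have := tprod_one_add_ne_zero_of_summable (f := fun k : ℕ => -(a * (q : ℂ) ^ k))
    (fun k => by simpa [sub_eq_add_neg] using sub_ne_zero.2 (h k).symm)
    (summable_qPochInf hq0 hq1 a)
  simpa [qPochInf, sub_eq_add_neg] using this

lemma qPochInf_ne_zero_of_norm_lt (hq0 : 0 < q) (hq1 : q < 1) {a : ℂ} (ha : ‖a‖ < 1) :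
    qPochInf q a ≠ 0 :=
  qPochInf_ne_zero hq0 hq1 (mul_qpow_ne_one hq0 hq1 ha)

lemma differentiable_qPochInf (hq0 : 0 < q) (hq1 : q < 1) :
    Differentiable ℂ fun a => qPochInf q a := by
  have key : MultipliableLocallyUniformlyOn (fun (k : ℕ) (a : ℂ) => 1 - a * (q : ℂ) ^ k)
      Set.univ := by
    refine ⟨fun a => ∏' k : ℕ, (1 - a * (q : ℂ) ^ k), ?_⟩
    simp_rw [sub_eq_add_neg]
    apply hasProdLocallyUniformlyOn_of_forall_compact isOpen_univ
    intro K _ hK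
    obtain ⟨R, hR⟩ := hK.isBounded.exists_norm_le
    refine ((summable_geometric_of_lt_one hq0.le hq1).mul_left R).hasProdUniformlyOn_nat_one_add
      hK (.of_forall fun n x hx => ?_) (fun _ => by fun_prop)
    rw [norm_neg, norm_mul, norm_qpow hq0]
    exact mul_le_mul_of_nonneg_right (hR x hx) (pow_pos hq0 n).le
  have h2 := key.hasProdLocallyUniformlyOn.differentiableOn
    (.of_forall fun _ => by simpa [Finset.prod_fn] using
      DifferentiableOn.finsetProd (fun _ _ => by fun_prop)) isOpen_univ
  exact differentiableOn_univ.1 h2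

lemma continuous_qPochInf (hq0 : 0 < q) (hq1 : q < 1) : Continuous fun a => qPochInf q a :=
  (differentiable_qPochInf hq0 hq1).continuous

lemma tendsto_qpow (hq0 : 0 < q) (hq1 : q < 1) :
    Tendsto (fun n : ℕ => (q : ℂ) ^ n) atTop (𝓝 0) := by
  apply tendsto_pow_atTop_nhds_zero_of_norm_lt_one
  simpa [abs_of_pos hq0] using hq1

lemma tendsto_qPoch (hq0 : 0 < q) (hq1 : q < 1) (a : ℂ) :
    Tendsto (fun n => qPoch q a n) atTop (𝓝 (qPochInf q a)) :=
  (multipliable_qPochInf hq0 hq1 a).hasProd.tendsto_prod_nat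

/-- The splitting `(a;q)_∞ = (a;q²)_∞ (aq;q²)_∞`. -/
lemma qPochInf_sq_mul (hq0 : 0 < q) (hq1 : q < 1) (a : ℂ) :
    qPochInf (q ^ 2) a * qPochInf (q ^ 2) (a * q) = qPochInf q a := by
  have h0 : 0 < q ^ 2 := by positivity
  have h1 : q ^ 2 < 1 := by nlinarith
  have e1 : (fun k : ℕ => 1 - a * ((q ^ 2 : ℝ) : ℂ) ^ k) =
      fun k : ℕ => 1 - a * (q : ℂ) ^ (2 * k) := by
    funext k; push_cast; rw [pow_mul]
  have e2 : (fun k : ℕ => 1 - a * q * ((q ^ 2 : ℝ) : ℂ) ^ k) =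
      fun k : ℕ => 1 - a * (q : ℂ) ^ (2 * k + 1) := by
    funext k; push_cast; rw [pow_succ _ (2 * k), pow_mul]; ring
  have m1 := multipliable_qPochInf h0 h1 a
  have m2 := multipliable_qPochInf h0 h1 (a * q)
  unfold qPochInf
  rw [e1] at m1 ⊢
  rw [e2] at m2 ⊢
  exact tprod_even_mul_odd (f := fun k : ℕ => 1 - a * (q : ℂ) ^ k) m1 m2

/-- The splitting `(a;q)_∞ (-a;q)_∞ = (a²;q²)_∞`. -/
lemma qPochInf_mul_neg (hq0 : 0 < q) (hq1 : q < 1) (a : ℂ) :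
    qPochInf q a * qPochInf q (-a) = qPochInf (q ^ 2) (a ^ 2) := by
  unfold qPochInf
  rw [← (multipliable_qPochInf hq0 hq1 a).tprod_mul (multipliable_qPochInf hq0 hq1 (-a))]
  congr 1; funext k; push_cast; ring

end ShiftedFactorials

/-! ### The Askey–Wilson functional -/

section Functional

variable {q : ℝ}

/-- The numerator `(z², z⁻²; q)_∞` of the Askey–Wilson weight. -/
def awNum (q : ℝ) (z : ℂ) : ℂ := qPochInf q (z ^ 2) * qPochInf q (z ^ (-2 : ℤ))

/-- The product `(az, a z⁻¹; q)_∞`. -/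
def pairPoch (q : ℝ) (a z : ℂ) : ℂ := qPochInf q (a * z) * qPochInf q (a * z⁻¹)

/-- The Askey–Wilson weight `(z², z⁻²; q)_∞ / ∏_i (v_i z, v_i z⁻¹; q)_∞`. -/
def awWeight (q : ℝ) (v : Fin 4 → ℂ) (z : ℂ) : ℂ := awNum q z / ∏ i, pairPoch q (v i) z

/-- The Askey–Wilson weight without the factor `1 / (1 - v_i q^k z⁻¹)`. Its value at the pole
`v_i q^k` is the residue of `awWeight q v z / z` there. -/
def awCofactor (q : ℝ) (v : Fin 4 → ℂ) (i : Fin 4) (k : ℕ) (z : ℂ) : ℂ :=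
  awNum q z / (qPochInf q (v i * z) * qPoch q (v i * z⁻¹) k *
    qPochInf q (v i * z⁻¹ * (q : ℂ) ^ (k + 1)) * ∏ j ∈ univ.erase i, pairPoch q (v j) z)

/-- The number of `k` for which `a q^k` lies outside the closed unit disc. -/
def outCount (q : ℝ) (a : ℂ) : ℕ := sInf {k : ℕ | ‖a‖ * q ^ k ≤ 1}

/-- The integral of `awWeight q v z * φ z / z` over the cycle of `cycleIntegral`, divided by
`2πi`, for a function `φ` analytic off the origin. The small circles are replaced by
the residues at the points `p = v_i q^k` outside the unit circle and at their inverses, at which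
the weight has opposite residues. -/
def awFunctional (q : ℝ) (v : Fin 4 → ℂ) (φ : ℂ → ℂ) : ℂ :=
  (2 * (Real.pi : ℂ) * Complex.I)⁻¹ * (∮ z in C(0, 1), z⁻¹ * (awWeight q v z * φ z)) +
    ∑ i, ∑ k ∈ range (outCount q (v i)),
      awCofactor q v i k (v i * (q : ℂ) ^ k) *
        (φ (v i * (q : ℂ) ^ k) + φ (v i * (q : ℂ) ^ k)⁻¹)

lemma lt_outCount_iff (hq0 : 0 < q) (hq1 : q < 1) (a : ℂ) (k : ℕ) :
    k < outCount q a ↔ 1 < ‖a‖ * q ^ k := by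
  have hne : {k : ℕ | ‖a‖ * q ^ k ≤ 1}.Nonempty := by
    have h : Tendsto (fun n : ℕ => ‖a‖ * q ^ n) atTop (𝓝 (‖a‖ * 0)) :=
      (tendsto_pow_atTop_nhds_zero_of_lt_one hq0.le hq1).const_mul _
    rw [mul_zero] at h
    obtain ⟨n, hn⟩ := (h.eventually_le_const zero_lt_one).exists
    exact ⟨n, hn⟩
  constructor
  · intro h
    by_contra hc
    exact Nat.notMem_of_lt_sInf h (not_lt.1 hc)
  · intro h
    by_contra hc
    have h1 : ‖a‖ * q ^ (outCount q a) ≤ 1 := Nat.sInf_mem hne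
    have h2 : q ^ k ≤ q ^ (outCount q a) := pow_le_pow_of_le_one hq0.le hq1.le (not_lt.1 hc)
    have := mul_le_mul_of_nonneg_left h2 (norm_nonneg a)
    linarith

lemma outCount_eq_zero (hq0 : 0 < q) (hq1 : q < 1) {a : ℂ} (h : ‖a‖ ≤ 1) : outCount q a = 0 := by
  by_contra hc
  have := (lt_outCount_iff hq0 hq1 a 0).1 (Nat.pos_of_ne_zero hc)
  simp at this; linarith

lemma outCount_pos (hq0 : 0 < q) (hq1 : q < 1) {a : ℂ} (h : 1 < ‖a‖) : 0 < outCount q a :=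
  (lt_outCount_iff hq0 hq1 a 0).2 (by simpa using h)

lemma outCount_mul (hq0 : 0 < q) (hq1 : q < 1) (a : ℂ) :
    outCount q (a * q) = outCount q a - 1 := by
  refine eq_of_forall_lt_iff fun k => ?_
  rw [lt_outCount_iff hq0 hq1, Nat.lt_sub_iff_add_lt, lt_outCount_iff hq0 hq1, norm_mul,
    Complex.norm_of_nonneg hq0.le, pow_succ', mul_assoc]

/-! ### Consequences of genericity -/

lemma AWGeneric.mul_ne_one {v : Fin 4 → ℂ} (h : AWGeneric q v) (hq0 : 0 < q) (i j : Fin 4)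
    (k l : ℕ) : v i * (q : ℂ) ^ k * (v j * (q : ℂ) ^ l) ≠ 1 := by
  intro he
  rcases lt_trichotomy 1 (‖v i‖ * q ^ k) with h1 | h1 | h1
  · exact h.2.2 i j k l h1 he
  · exact h.1 i k h1.symm
  · have hn := congrArg norm he
    rw [norm_mul, norm_mul, norm_mul, norm_qpow hq0, norm_qpow hq0, norm_one] at hn
    refine h.2.2 j i l k ?_ (by rw [mul_comm]; exact he)
    by_contra hc
    have h0 : 0 ≤ ‖v i‖ * q ^ k := by positivity
    nlinarith

lemma AWGeneric.mul_mul_pow_ne_one {v : Fin 4 → ℂ} (h : AWGeneric q v) (hq0 : 0 < q)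
    (i j : Fin 4) (k : ℕ) : v i * v j * (q : ℂ) ^ k ≠ 1 := by
  have := h.mul_ne_one hq0 i j k 0
  intro he; apply this; rw [pow_zero, mul_one, ← he]; ring

lemma AWGeneric.of_shift {v w : Fin 4 → ℂ} (h : AWGeneric q v) (hq0 : 0 < q)
    (hw : ∀ i, ∃ m : ℕ, w i = v i * (q : ℂ) ^ m) : AWGeneric q w := by
  choose m hm using hw
  have hn : ∀ i k, ‖w i‖ * q ^ k = ‖v i‖ * q ^ (m i + k) := fun i k => by
    rw [hm, norm_mul, norm_qpow hq0, pow_add, mul_assoc]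
  have hc : ∀ i k, w i * (q : ℂ) ^ k = v i * (q : ℂ) ^ (m i + k) := fun i k => by
    rw [hm, pow_add, mul_assoc]
  refine ⟨fun i k => ?_, fun i j k l => ?_, fun i j k l => ?_⟩
  · rw [hn]; exact h.1 _ _
  · rw [hn, hc, hc]; exact h.2.1 _ _ _ _
  · rw [hn, hc, hc]; exact h.2.2 _ _ _ _

lemma exists_shift_update (v : Fin 4 → ℂ) (l i : Fin 4) :
    ∃ m : ℕ, Function.update v l (v l * q) i = v i * (q : ℂ) ^ m := by
  by_cases hi : i = l
  · subst hi; exact ⟨1, by simp⟩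
  · exact ⟨0, by simp [hi]⟩

lemma AWGeneric.update {v : Fin 4 → ℂ} (h : AWGeneric q v) (hq0 : 0 < q) (l : Fin 4) :
    AWGeneric q (Function.update v l (v l * q)) :=
  h.of_shift hq0 (exists_shift_update v l)

lemma AWGeneric.norm_ne_one {v : Fin 4 → ℂ} (h : AWGeneric q v) (i : Fin 4) : ‖v i‖ ≠ 1 := by
  simpa using h.1 i 0

lemma ne_zero_of_lt_outCount (hq0 : 0 < q) (hq1 : q < 1) {a : ℂ} {k : ℕ}
    (hk : k < outCount q a) : a ≠ 0 := by
  rintro rfl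
  have := (lt_outCount_iff hq0 hq1 0 k).1 hk
  simp at this; linarith

/-- No pole outside the unit circle is a pole of the factor belonging to another parameter. -/
lemma AWGeneric.pairPoch_ne_zero {v : Fin 4 → ℂ} (h : AWGeneric q v) (hq0 : 0 < q) (hq1 : q < 1)
    {i j : Fin 4} (hij : i ≠ j) {k : ℕ} (hk : k < outCount q (v i)) :
    pairPoch q (v j) (v i * (q : ℂ) ^ k) ≠ 0 := by
  have h1 := (lt_outCount_iff hq0 hq1 _ _).1 hk
  have hv := ne_zero_of_lt_outCount hq0 hq1 hk
  have hp : v i * (q : ℂ) ^ k ≠ 0 := mul_ne_zero hv (pow_ne_zero _ (qC_ne_zero hq0))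
  refine mul_ne_zero (qPochInf_ne_zero hq0 hq1 fun l hl => ?_)
    (qPochInf_ne_zero hq0 hq1 fun l hl => ?_)
  · refine h.mul_ne_one hq0 i j k l ?_
    rw [← hl]; ring
  · refine hij (h.2.1 i j k l h1 ?_)
    have : v j * (q : ℂ) ^ l * (v i * (q : ℂ) ^ k)⁻¹ = 1 := by rw [← hl]; ring
    exact (mul_inv_eq_one₀ hp).1 this |>.symm

lemma pairPoch_ne_zero_of_norm (hq0 : 0 < q) (hq1 : q < 1) {a z : ℂ}
    (ha : ∀ k : ℕ, ‖a‖ * q ^ k ≠ 1) (hz : ‖z‖ = 1) : pairPoch q a z ≠ 0 := by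
  refine mul_ne_zero (qPochInf_ne_zero hq0 hq1 fun l hl => ?_)
    (qPochInf_ne_zero hq0 hq1 fun l hl => ?_) <;>
  · have hn := congrArg norm hl
    simp only [norm_mul, norm_inv, hz, norm_qpow hq0, inv_one, mul_one, norm_one] at hn
    exact ha l hn

/-! ### Algebra of the weight -/

lemma pairPoch_eq (hq0 : 0 < q) (hq1 : q < 1) (a z : ℂ) :
    pairPoch q a z = (1 - a * z) * (1 - a * z⁻¹) * pairPoch q (a * q) z := by
  unfold pairPoch
  rw [qPochInf_eq_mul hq0 hq1 (a * z), qPochInf_eq_mul hq0 hq1 (a * z⁻¹)]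
  rw [show a * q * z = a * z * q by ring, show a * q * z⁻¹ = a * z⁻¹ * q by ring]
  ring

lemma pairPoch_inv (a z : ℂ) : pairPoch q a z⁻¹ = pairPoch q a z := by
  simp [pairPoch, mul_comm]

lemma awNum_inv (z : ℂ) : awNum q z⁻¹ = awNum q z := by
  have h2 : z⁻¹ ^ (-2 : ℤ) = z ^ 2 := by simp [zpow_neg, zpow_ofNat]
  have h1 : z⁻¹ ^ 2 = z ^ (-2 : ℤ) := by simp [zpow_neg, zpow_ofNat]
  rw [awNum, awNum, h1, h2, mul_comm]

lemma awWeight_inv (v : Fin 4 → ℂ) (z : ℂ) : awWeight q v z⁻¹ = awWeight q v z := by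
  simp [awWeight, awNum_inv, pairPoch_inv]

lemma awWeight_eq_cofactor (hq0 : 0 < q) (hq1 : q < 1) (v : Fin 4 → ℂ) (i : Fin 4) (k : ℕ)
    (z : ℂ) : awWeight q v z = awCofactor q v i k z / (1 - v i * (q : ℂ) ^ k * z⁻¹) := by
  rw [awWeight, awCofactor, div_div, ← mul_prod_erase univ _ (mem_univ i)]
  congr 1
  rw [pairPoch, qPochInf_eq_qPoch_mul hq0 hq1 (v i * z⁻¹) (k + 1), qPoch_succ]
  ring

lemma prod_pairPoch_update (v : Fin 4 → ℂ) (l : Fin 4) (a z : ℂ) :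
    ∏ i, pairPoch q (Function.update v l a i) z =
      pairPoch q a z * ∏ i ∈ univ.erase l, pairPoch q (v i) z := by
  rw [← mul_prod_erase univ _ (mem_univ l)]
  congr 1
  · simp
  · refine prod_congr rfl fun i hi => ?_
    rw [Function.update_of_ne (ne_of_mem_erase hi)]

lemma awWeight_update (hq0 : 0 < q) (hq1 : q < 1) (v : Fin 4 → ℂ) (l : Fin 4) {z : ℂ}
    (h1 : v l * z ≠ 1) (h2 : v l * z⁻¹ ≠ 1) :
    awWeight q (Function.update v l (v l * q)) z =
      awWeight q v z * ((1 - v l * z) * (1 - v l * z⁻¹)) := by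
  have h1' : 1 - v l * z ≠ 0 := sub_ne_zero.2 h1.symm
  have h2' : 1 - v l * z⁻¹ ≠ 0 := sub_ne_zero.2 h2.symm
  rw [awWeight, awWeight, prod_pairPoch_update, ← mul_prod_erase univ _ (mem_univ l),
    pairPoch_eq hq0 hq1 (v l) z, mul_assoc, ← div_div _ ((1 - v l * z) * (1 - v l * z⁻¹)),
    div_right_comm, div_mul_cancel₀ _ (mul_ne_zero h1' h2')]

lemma awCofactor_update_self (hq0 : 0 < q) (hq1 : q < 1) (v : Fin 4 → ℂ) (l : Fin 4) (k : ℕ)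
    {z : ℂ} (h1 : v l * z ≠ 1) (h2 : v l * z⁻¹ ≠ 1) :
    awCofactor q (Function.update v l (v l * q)) l k z =
      awCofactor q v l (k + 1) z * ((1 - v l * z) * (1 - v l * z⁻¹)) := by
  have h1' : 1 - v l * z ≠ 0 := sub_ne_zero.2 h1.symm
  have h2' : 1 - v l * z⁻¹ ≠ 0 := sub_ne_zero.2 h2.symm
  have hp : ∏ j ∈ univ.erase l, pairPoch q (Function.update v l (v l * q) j) z =
      ∏ j ∈ univ.erase l, pairPoch q (v j) z := by
    refine prod_congr rfl fun i hi => ?_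
    rw [Function.update_of_ne (ne_of_mem_erase hi)]
  rw [awCofactor, awCofactor, hp, Function.update_self, qPochInf_eq_mul hq0 hq1 (v l * z),
    qPoch_succ' (v l * z⁻¹), show v l * q * z = v l * z * q by ring,
    show v l * q * z⁻¹ = v l * z⁻¹ * q by ring,
    show v l * z⁻¹ * q * (q : ℂ) ^ (k + 1) = v l * z⁻¹ * (q : ℂ) ^ (k + 1 + 1) by ring]
  rw [div_mul_eq_mul_div, show ∀ A B C D : ℂ, (1 - v l * z) * A * ((1 - v l * z⁻¹) * B) * C * D =
    (A * B * C * D) * ((1 - v l * z) * (1 - v l * z⁻¹)) by intros; ring,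
    mul_div_mul_right _ _ (mul_ne_zero h1' h2')]

lemma awCofactor_update_of_ne (hq0 : 0 < q) (hq1 : q < 1) (v : Fin 4 → ℂ) {i l : Fin 4}
    (hil : i ≠ l) (k : ℕ) {z : ℂ} (h1 : v l * z ≠ 1) (h2 : v l * z⁻¹ ≠ 1) :
    awCofactor q (Function.update v l (v l * q)) i k z =
      awCofactor q v i k z * ((1 - v l * z) * (1 - v l * z⁻¹)) := by
  have h1' : 1 - v l * z ≠ 0 := sub_ne_zero.2 h1.symm
  have h2' : 1 - v l * z⁻¹ ≠ 0 := sub_ne_zero.2 h2.symm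
  have hl : l ∈ univ.erase i := mem_erase.2 ⟨hil.symm, mem_univ _⟩
  have hp : ∏ j ∈ (univ.erase i).erase l, pairPoch q (Function.update v l (v l * q) j) z =
      ∏ j ∈ (univ.erase i).erase l, pairPoch q (v j) z := by
    refine prod_congr rfl fun i hi => ?_
    rw [Function.update_of_ne (ne_of_mem_erase hi)]
  rw [awCofactor, awCofactor, ← mul_prod_erase _ _ hl, ← mul_prod_erase _ _ hl, hp,
    Function.update_self, Function.update_of_ne hil, pairPoch_eq hq0 hq1 (v l) z,
    div_mul_eq_mul_div]
  rw [show ∀ A B C : ℂ, A * ((1 - v l * z) * (1 - v l * z⁻¹) * B * C) =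
    (A * (B * C)) * ((1 - v l * z) * (1 - v l * z⁻¹)) by intros; ring,
    mul_div_mul_right _ _ (mul_ne_zero h1' h2')]

/-! ### The shift relation and linearity -/

lemma continuousOn_awNum (hq0 : 0 < q) (hq1 : q < 1) {s : Set ℂ} (hs : ∀ z ∈ s, z ≠ 0) :
    ContinuousOn (awNum q) s := by
  have hc := continuous_qPochInf hq0 hq1
  refine (hc.comp_continuousOn (by fun_prop)).mul (hc.comp_continuousOn ?_)
  exact continuousOn_id.zpow₀ _ fun z hz => Or.inl (hs z hz)

lemma continuousOn_pairPoch (hq0 : 0 < q) (hq1 : q < 1) (a : ℂ) {s : Set ℂ}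
    (hs : ∀ z ∈ s, z ≠ 0) : ContinuousOn (pairPoch q a) s := by
  have hc := continuous_qPochInf hq0 hq1
  refine (hc.comp_continuousOn (by fun_prop)).mul (hc.comp_continuousOn ?_)
  exact continuousOn_const.mul (continuousOn_id.inv₀ hs)

lemma ne_zero_of_mem_unitSphere {z : ℂ} (hz : z ∈ Metric.sphere (0 : ℂ) 1) : z ≠ 0 := by
  rintro rfl; simp at hz

lemma continuousOn_awWeight (hq0 : 0 < q) (hq1 : q < 1) {v : Fin 4 → ℂ}
    (hv : ∀ i, ∀ k : ℕ, ‖v i‖ * q ^ k ≠ 1) :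
    ContinuousOn (awWeight q v) (Metric.sphere 0 1) := by
  refine (continuousOn_awNum hq0 hq1 fun z => ne_zero_of_mem_unitSphere).div
    (continuousOn_finsetProd _ fun i _ => continuousOn_pairPoch hq0 hq1 _ fun z =>
      ne_zero_of_mem_unitSphere) fun z hz => prod_ne_zero_iff.2 fun i _ =>
      pairPoch_ne_zero_of_norm hq0 hq1 (hv i) (by simpa using hz)

lemma circleIntegrable_awWeight_mul (hq0 : 0 < q) (hq1 : q < 1) {v : Fin 4 → ℂ}
    (hv : ∀ i, ∀ k : ℕ, ‖v i‖ * q ^ k ≠ 1) {φ : ℂ → ℂ}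
    (hφ : ContinuousOn φ (Metric.sphere 0 1)) :
    CircleIntegrable (fun z => z⁻¹ * (awWeight q v z * φ z)) 0 1 := by
  refine ContinuousOn.circleIntegrable zero_le_one ?_
  exact (continuousOn_id.inv₀ fun z => ne_zero_of_mem_unitSphere).mul
    ((continuousOn_awWeight hq0 hq1 hv).mul hφ)

lemma awFunctional_sum (hq0 : 0 < q) (hq1 : q < 1) {v : Fin 4 → ℂ}
    (hv : ∀ i, ∀ k : ℕ, ‖v i‖ * q ^ k ≠ 1) {ι : Type*} (s : Finset ι) (c : ι → ℂ)
    (φ : ι → ℂ → ℂ) (hφ : ∀ i ∈ s, ContinuousOn (φ i) (Metric.sphere 0 1)) :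
    awFunctional q v (fun z => ∑ i ∈ s, c i * φ i z) = ∑ i ∈ s, c i * awFunctional q v (φ i) := by
  have h1 : (∮ z in C(0, 1), z⁻¹ * (awWeight q v z * ∑ i ∈ s, c i * φ i z)) =
      ∑ i ∈ s, c i * ∮ z in C(0, 1), z⁻¹ * (awWeight q v z * φ i z) := by
    have : (fun z => z⁻¹ * (awWeight q v z * ∑ i ∈ s, c i * φ i z)) =
        fun z => ∑ i ∈ s, c i * (z⁻¹ * (awWeight q v z * φ i z)) := by
      funext z; rw [mul_sum, mul_sum]; refine sum_congr rfl fun i _ => by ring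
    rw [this, circleIntegral.integral_fun_sum]
    · refine sum_congr rfl fun i _ => ?_
      exact circleIntegral.integral_const_mul _ _ _ _
    · intro i hi
      exact ((circleIntegrable_awWeight_mul hq0 hq1 hv (hφ i hi)).const_smul (a := c i))
  unfold awFunctional
  rw [h1, mul_sum]
  simp only [mul_add, sum_add_distrib, mul_sum]
  congr 1
  · refine sum_congr rfl fun i _ => by ring
  · simp only [← sum_add_distrib]
    rw [sum_comm' (t' := univ) (s' := fun _ => s) (by simp)]
    refine sum_congr rfl fun i _ => ?_
    rw [sum_comm]
    refine sum_congr rfl fun k _ => ?_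
    refine sum_congr rfl fun j _ => by ring

/-- Multiplication of the test function by `(1 - v_l z)(1 - v_l z⁻¹)` amounts to the shift
`v_l ↦ v_l q` of a parameter. -/
lemma awFunctional_update (hq0 : 0 < q) (hq1 : q < 1) {v : Fin 4 → ℂ} (hv : AWGeneric q v)
    (l : Fin 4) (φ : ℂ → ℂ) :
    awFunctional q (Function.update v l (v l * q)) φ =
      awFunctional q v fun z => (1 - v l * z) * (1 - v l * z⁻¹) * φ z := by
  have hcirc : (∮ z in C(0, 1), z⁻¹ * (awWeight q (Function.update v l (v l * q)) z * φ z)) =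
      ∮ z in C(0, 1), z⁻¹ * (awWeight q v z * ((1 - v l * z) * (1 - v l * z⁻¹) * φ z)) := by
    refine circleIntegral.integral_congr zero_le_one fun z hz => ?_
    have hz1 : ‖z‖ = 1 := by simpa using hz
    have h1 : v l * z ≠ 1 := fun h => hv.norm_ne_one l (by
      simpa [hz1] using congrArg norm h)
    have h2 : v l * z⁻¹ ≠ 1 := fun h => hv.norm_ne_one l (by
      simpa [hz1] using congrArg norm h)
    simp only [awWeight_update hq0 hq1 v l h1 h2]
    ring
  unfold awFunctional
  rw [hcirc]
  congr 1
  refine sum_congr rfl fun i _ => ?_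
  by_cases hil : i = l
  · subst hil
    rw [Function.update_self, outCount_mul hq0 hq1]
    rcases Nat.eq_zero_or_pos (outCount q (v i)) with h0 | hpos
    · simp [h0]
    · obtain ⟨m, hm⟩ : ∃ m, outCount q (v i) = m + 1 := ⟨_, (Nat.succ_pred_eq_of_pos hpos).symm⟩
      have hvi : v i ≠ 0 := ne_zero_of_lt_outCount hq0 hq1 hpos
      rw [hm, sum_range_succ', Nat.add_sub_cancel]
      rw [show v i * (q : ℂ) ^ 0 = v i by simp]
      simp only [mul_inv_cancel₀ hvi, inv_inv, sub_self, mul_zero, zero_mul, add_zero]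
      refine sum_congr rfl fun k hk => ?_
      have hp : v i * q * (q : ℂ) ^ k = v i * (q : ℂ) ^ (k + 1) := by rw [pow_succ']; ring
      rw [hp]
      have h1 : v i * (v i * (q : ℂ) ^ (k + 1)) ≠ 1 := by
        have := hv.mul_mul_pow_ne_one hq0 i i (k + 1)
        rwa [mul_assoc] at this
      have h2 : v i * (v i * (q : ℂ) ^ (k + 1))⁻¹ ≠ 1 := by
        intro h
        have hne := mul_ne_zero hvi (pow_ne_zero (k + 1) (qC_ne_zero hq0))
        have h3 := (mul_inv_eq_one₀ hne).1 h
        have h4 := congrArg norm h3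
        rw [norm_mul, norm_qpow hq0] at h4
        have : q ^ (k + 1) < 1 := pow_lt_one₀ hq0.le hq1 (by omega)
        have := norm_pos_iff.2 hvi
        nlinarith
      rw [awCofactor_update_self hq0 hq1 v i k h1 h2]
      ring
  · rw [Function.update_of_ne hil]
    refine sum_congr rfl fun k hk => ?_
    have hk' := mem_range.1 hk
    have hvi : v i ≠ 0 := ne_zero_of_lt_outCount hq0 hq1 hk'
    have h1 : v l * (v i * (q : ℂ) ^ k) ≠ 1 := by
      have := hv.mul_mul_pow_ne_one hq0 l i k
      rwa [mul_assoc] at this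
    have h2 : v l * (v i * (q : ℂ) ^ k)⁻¹ ≠ 1 := by
      intro h
      have hne := mul_ne_zero hvi (pow_ne_zero k (qC_ne_zero hq0))
      have h3 := (mul_inv_eq_one₀ hne).1 h
      exact hil (hv.2.1 i l k 0 ((lt_outCount_iff hq0 hq1 _ _).1 hk') (by simpa using h3.symm))
    rw [awCofactor_update_of_ne hq0 hq1 v hil k h1 h2]
    simp only [inv_inv]
    ring

end Functional

/-! ### The Askey–Wilson integral over the unit circle -/

section UnitCircle

variable {q : ℝ}

/-- The value `2 (v₀v₁v₂v₃;q)_∞ / ((q;q)_∞ ∏_{i<j} (v_i v_j;q)_∞)` of the Askey–Wilson integral. -/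
def awValue (q : ℝ) (v : Fin 4 → ℂ) : ℂ :=
  2 * qPochInf q (v 0 * v 1 * v 2 * v 3) /
    (qPochInf q q * (qPochInf q (v 0 * v 1) * qPochInf q (v 0 * v 2) * qPochInf q (v 0 * v 3) *
      qPochInf q (v 1 * v 2) * qPochInf q (v 1 * v 3) * qPochInf q (v 2 * v 3)))

lemma erase_zero_four : (univ.erase (0 : Fin 4)) = {1, 2, 3} := by decide
lemma erase_one_four : (univ.erase (1 : Fin 4)) = {0, 2, 3} := by decide
lemma erase_two_four : (univ.erase (2 : Fin 4)) = {0, 1, 3} := by decide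
lemma erase_three_four : (univ.erase (3 : Fin 4)) = {0, 1, 2} := by decide

/-- The recurrence of `awValue` under the shift of a parameter. The integral satisfies the same one,
see `awFunctional_update_of_norm_lt`. -/
lemma awValue_update (hq0 : 0 < q) (hq1 : q < 1) (v : Fin 4 → ℂ) (l : Fin 4)
    (h : ∀ j, j ≠ l → v l * v j ≠ 1) :
    awValue q (Function.update v l (v l * q)) * (1 - v 0 * v 1 * v 2 * v 3) =
      awValue q v * ∏ j ∈ univ.erase l, (1 - v l * v j) := by
  have key : ∀ A B C D X Y Z U V W : ℂ, 1 - X ≠ 0 → 1 - Y ≠ 0 → 1 - Z ≠ 0 →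
      2 * A / (qPochInf q q * (U * V * W * B * C * D)) * (1 - v 0 * v 1 * v 2 * v 3) =
      2 * ((1 - v 0 * v 1 * v 2 * v 3) * A) /
        (qPochInf q q * (((1 - X) * U) * ((1 - Y) * V) * ((1 - Z) * W) * B * C * D)) *
        ((1 - X) * (1 - Y) * (1 - Z)) := by
    intro A B C D X Y Z U V W hX hY hZ
    rw [show (qPochInf q q * (((1 - X) * U) * ((1 - Y) * V) * ((1 - Z) * W) * B * C * D)) =
      (qPochInf q q * (U * V * W * B * C * D)) * ((1 - X) * (1 - Y) * (1 - Z)) by ring,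
      div_mul_eq_mul_div, div_mul_eq_mul_div,
      mul_div_mul_right _ _ (mul_ne_zero (mul_ne_zero hX hY) hZ)]
    ring
  have hs : ∀ j, j ≠ l → 1 - v l * v j ≠ 0 := fun j hj => sub_ne_zero.2 (h j hj).symm
  unfold awValue
  rw [qPochInf_eq_mul hq0 hq1 (v 0 * v 1 * v 2 * v 3)]
  fin_cases l
  · simp only [Fin.zero_eta, Fin.isValue, Function.update_self, ne_eq, Fin.reduceEq,
      not_false_eq_true, Function.update_of_ne, erase_zero_four]
    rw [qPochInf_eq_mul hq0 hq1 (v 0 * v 1), qPochInf_eq_mul hq0 hq1 (v 0 * v 2),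
      qPochInf_eq_mul hq0 hq1 (v 0 * v 3)]
    have := key (qPochInf q (v 0 * v 1 * v 2 * v 3 * q)) (qPochInf q (v 1 * v 2))
      (qPochInf q (v 1 * v 3)) (qPochInf q (v 2 * v 3)) _ _ _ (qPochInf q (v 0 * v 1 * q))
      (qPochInf q (v 0 * v 2 * q)) (qPochInf q (v 0 * v 3 * q))
      (hs 1 (by decide)) (hs 2 (by decide)) (hs 3 (by decide))
    simp only [Fin.zero_eta, Fin.isValue] at this
    rw [prod_insert (by decide), prod_insert (by decide), prod_singleton]
    convert this using 1 <;> ring_nf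
  · simp only [Fin.mk_one, Fin.isValue, Function.update_self, ne_eq, Fin.reduceEq,
      not_false_eq_true, Function.update_of_ne, erase_one_four]
    rw [qPochInf_eq_mul hq0 hq1 (v 0 * v 1), qPochInf_eq_mul hq0 hq1 (v 1 * v 2),
      qPochInf_eq_mul hq0 hq1 (v 1 * v 3)]
    have := key (qPochInf q (v 0 * v 1 * v 2 * v 3 * q)) (qPochInf q (v 0 * v 2))
      (qPochInf q (v 0 * v 3)) (qPochInf q (v 2 * v 3)) _ _ _ (qPochInf q (v 0 * v 1 * q))
      (qPochInf q (v 1 * v 2 * q)) (qPochInf q (v 1 * v 3 * q))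
      (hs 0 (by decide)) (hs 2 (by decide)) (hs 3 (by decide))
    simp only [Fin.mk_one, Fin.isValue] at this
    rw [prod_insert (by decide), prod_insert (by decide), prod_singleton]
    convert this using 1 <;> ring_nf
  · simp only [Fin.reduceFinMk, Fin.isValue, Function.update_self, ne_eq, Fin.reduceEq,
      not_false_eq_true, Function.update_of_ne, erase_two_four]
    rw [qPochInf_eq_mul hq0 hq1 (v 0 * v 2), qPochInf_eq_mul hq0 hq1 (v 1 * v 2),
      qPochInf_eq_mul hq0 hq1 (v 2 * v 3)]
    have := key (qPochInf q (v 0 * v 1 * v 2 * v 3 * q)) (qPochInf q (v 0 * v 1))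
      (qPochInf q (v 0 * v 3)) (qPochInf q (v 1 * v 3)) _ _ _ (qPochInf q (v 0 * v 2 * q))
      (qPochInf q (v 1 * v 2 * q)) (qPochInf q (v 2 * v 3 * q))
      (hs 0 (by decide)) (hs 1 (by decide)) (hs 3 (by decide))
    simp only [Fin.reduceFinMk, Fin.isValue] at this
    rw [prod_insert (by decide), prod_insert (by decide), prod_singleton]
    convert this using 1 <;> ring_nf
  · simp only [Fin.reduceFinMk, Fin.isValue, Function.update_self, ne_eq, Fin.reduceEq,
      not_false_eq_true, Function.update_of_ne, erase_three_four]
    rw [qPochInf_eq_mul hq0 hq1 (v 0 * v 3), qPochInf_eq_mul hq0 hq1 (v 1 * v 3),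
      qPochInf_eq_mul hq0 hq1 (v 2 * v 3)]
    have := key (qPochInf q (v 0 * v 1 * v 2 * v 3 * q)) (qPochInf q (v 0 * v 1))
      (qPochInf q (v 0 * v 2)) (qPochInf q (v 1 * v 2)) _ _ _ (qPochInf q (v 0 * v 3 * q))
      (qPochInf q (v 1 * v 3 * q)) (qPochInf q (v 2 * v 3 * q))
      (hs 0 (by decide)) (hs 1 (by decide)) (hs 2 (by decide))
    simp only [Fin.reduceFinMk, Fin.isValue] at this
    rw [prod_insert (by decide), prod_insert (by decide), prod_singleton]
    convert this using 1 <;> ring_nf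

lemma circleIntegral_inv_mul (f : ℂ → ℂ) {R : ℝ} (hR : R ≠ 0) :
    (∮ z in C(0, R), z⁻¹ * f z) = ∫ θ in (0 : ℝ)..2 * Real.pi, Complex.I * f (circleMap 0 R θ) := by
  rw [circleIntegral]
  refine intervalIntegral.integral_congr fun θ _ => ?_
  have : circleMap 0 R θ ≠ 0 := circleMap_ne_center hR
  simp only [deriv_circleMap, smul_eq_mul]
  field_simp

/-- Invariance of `dz / z` under the reflection `z ↦ R² / z` of the circle of radius `R`. -/
lemma circleIntegral_reflect (f : ℂ → ℂ) {R : ℝ} (hR : R ≠ 0) :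
    (∮ z in C(0, R), z⁻¹ * f ((R : ℂ) ^ 2 * z⁻¹)) = ∮ z in C(0, R), z⁻¹ * f z := by
  have hRc : (R : ℂ) ≠ 0 := by exact_mod_cast hR
  rw [circleIntegral_inv_mul (fun z => f ((R : ℂ) ^ 2 * z⁻¹)) hR, circleIntegral_inv_mul f hR]
  have h := intervalIntegral.integral_comp_sub_left (a := 0) (b := 2 * Real.pi)
    (fun θ => Complex.I * f (circleMap 0 R θ)) (2 * Real.pi)
  rw [sub_self, sub_zero] at h
  rw [← h]
  refine intervalIntegral.integral_congr fun θ _ => ?_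
  have : circleMap 0 R (2 * Real.pi - θ) = (R : ℂ) ^ 2 * (circleMap 0 R θ)⁻¹ := by
    simp only [circleMap, zero_add, mul_inv, ← Complex.exp_neg]
    have h2 : Complex.exp (((2 * Real.pi - θ : ℝ) : ℂ) * Complex.I) =
        Complex.exp (-((θ : ℂ) * Complex.I)) := by
      push_cast
      rw [sub_mul, sub_eq_neg_add, Complex.exp_add, Complex.exp_two_pi_mul_I, mul_one]
    rw [h2]
    field_simp
  simp only [this]

/-- One half of the image of `z + z⁻¹` under the Askey–Wilson difference operator, times the
weight; the other half is its reflection under `z ↦ z⁻¹`. -/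
def awHalf (q : ℝ) (v : Fin 4 → ℂ) (z : ℂ) : ℂ :=
  qPochInf q (q * z ^ 2) * qPochInf q (z⁻¹ ^ 2) /
    (z * ∏ i, (qPochInf q (v i * q * z) * qPochInf q (v i * z⁻¹)))

/-- `awHalf` is odd under the reflection in the circle of radius `q^{-1/2}`. -/
lemma awHalf_reflect (hq0 : 0 < q) (hq1 : q < 1) (v : Fin 4 → ℂ) {z : ℂ} (hz : z ≠ 0) :
    awHalf q v ((q : ℂ)⁻¹ * z⁻¹) = -awHalf q v z := by
  have hq : (q : ℂ) ≠ 0 := qC_ne_zero hq0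
  have hp : ∏ i, (qPochInf q (v i * q * ((q : ℂ)⁻¹ * z⁻¹)) *
      qPochInf q (v i * ((q : ℂ)⁻¹ * z⁻¹)⁻¹)) =
      ∏ i, (qPochInf q (v i * q * z) * qPochInf q (v i * z⁻¹)) := by
    refine prod_congr rfl fun i _ => ?_
    rw [mul_comm, show v i * ((q : ℂ)⁻¹ * z⁻¹)⁻¹ = v i * q * z by field_simp,
      show v i * q * ((q : ℂ)⁻¹ * z⁻¹) = v i * z⁻¹ by field_simp]
  unfold awHalf
  rw [hp, show (q : ℂ) * ((q : ℂ)⁻¹ * z⁻¹) ^ 2 = (q : ℂ)⁻¹ * z⁻¹ ^ 2 by field_simp,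
    show ((q : ℂ)⁻¹ * z⁻¹)⁻¹ ^ 2 = q * z ^ 2 * q by field_simp,
    qPochInf_eq_mul hq0 hq1 ((q : ℂ)⁻¹ * z⁻¹ ^ 2), qPochInf_eq_mul hq0 hq1 (q * z ^ 2),
    show (q : ℂ)⁻¹ * z⁻¹ ^ 2 * q = z⁻¹ ^ 2 by field_simp]
  generalize ∏ i, (qPochInf q (v i * q * z) * qPochInf q (v i * z⁻¹)) = P
  rw [← div_div _ _ P, ← div_div _ z P, ← neg_div]
  congr 1
  field_simp
  ring

/-- The image of `z + z⁻¹` under the Askey–Wilson difference operator, as a multiple of the weight. The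
coefficients are the elementary symmetric polynomials in the parameters. -/
lemma awHalf_add_inv (hq0 : 0 < q) (hq1 : q < 1) {v : Fin 4 → ℂ} (hv : ∀ i, ‖v i‖ < 1) {z : ℂ}
    (hz : ‖z‖ = 1) :
    awHalf q v z + awHalf q v z⁻¹ = awWeight q v z *
      ((1 - v 0 * v 1 * v 2 * v 3) * (z + z⁻¹) - (v 0 + v 1 + v 2 + v 3 -
        (v 0 * v 1 * v 2 + v 0 * v 1 * v 3 + v 0 * v 2 * v 3 + v 1 * v 2 * v 3))) := by
  have hz0 : z ≠ 0 := by rintro rfl; simp at hz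
  have h1 : ∀ i, 1 - v i * z ≠ 0 := fun i => by
    refine sub_ne_zero.2 fun h => ?_
    have := congrArg norm h
    simp [hz] at this
    exact absurd this.symm (hv i).ne
  have h2 : ∀ i, 1 - v i * z⁻¹ ≠ 0 := fun i => by
    refine sub_ne_zero.2 fun h => ?_
    have := congrArg norm h
    simp [hz] at this
    exact absurd this.symm (hv i).ne
  have hz2 : z ^ (-2 : ℤ) = z⁻¹ ^ 2 := by simp [zpow_neg, zpow_ofNat]
  have hw : awWeight q v z = (1 - z ^ 2) * (1 - z⁻¹ ^ 2) *
      (qPochInf q (q * z ^ 2) * qPochInf q (q * z⁻¹ ^ 2)) /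
      ((∏ i, (1 - v i * z) * (1 - v i * z⁻¹)) *
        ∏ i, (qPochInf q (v i * q * z) * qPochInf q (v i * q * z⁻¹))) := by
    rw [awWeight, awNum, hz2, qPochInf_eq_mul hq0 hq1 (z ^ 2), qPochInf_eq_mul hq0 hq1 (z⁻¹ ^ 2),
      ← prod_mul_distrib]
    simp only [pairPoch_eq hq0 hq1 (v _) z]
    rw [mul_comm (z ^ 2) (q : ℂ), mul_comm (z⁻¹ ^ 2) (q : ℂ)]
    unfold pairPoch
    congr 1
    ring
  have hg : ∀ w : ℂ, awHalf q v w = (1 - w⁻¹ ^ 2) *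
      (qPochInf q (q * w ^ 2) * qPochInf q (q * w⁻¹ ^ 2)) /
      (w * (∏ i, (1 - v i * w⁻¹)) *
        ∏ i, (qPochInf q (v i * q * w) * qPochInf q (v i * q * w⁻¹))) := by
    intro w
    rw [awHalf, qPochInf_eq_mul hq0 hq1 (w⁻¹ ^ 2), mul_assoc w, ← prod_mul_distrib]
    rw [mul_comm (w⁻¹ ^ 2) (q : ℂ)]
    congr 1
    · ring
    · congr 1
      refine prod_congr rfl fun i _ => ?_
      rw [qPochInf_eq_mul hq0 hq1 (v i * w⁻¹), show v i * w⁻¹ * q = v i * q * w⁻¹ by ring]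
      ring
  have hD : ∏ i, (qPochInf q (v i * q * z⁻¹) * qPochInf q (v i * q * z)) =
      ∏ i, (qPochInf q (v i * q * z) * qPochInf q (v i * q * z⁻¹)) :=
    prod_congr rfl fun i _ => mul_comm _ _
  rw [hw, hg z, hg z⁻¹, inv_inv, hD, mul_comm (qPochInf q (q * z⁻¹ ^ 2))]
  generalize ∏ i, (qPochInf q (v i * q * z) * qPochInf q (v i * q * z⁻¹)) = P
  generalize qPochInf q (q * z ^ 2) * qPochInf q (q * z⁻¹ ^ 2) = c
  simp only [Fin.prod_univ_four]
  have dd : ∀ A B : ℂ, A / (B * P) = A / B / P := fun A B => (div_div A B P).symm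
  simp only [dd]
  rw [← add_div, div_mul_eq_mul_div]
  congr 1
  have a0 := h1 0
  have a1 := h1 1
  have a2 := h1 2
  have a3 := h1 3
  have b : ∀ i, z - v i ≠ 0 := fun i h => h2 i (by
    have : 1 - v i * z⁻¹ = (z - v i) * z⁻¹ := by field_simp
    rw [this, h, zero_mul])
  have b0 := b 0
  have b1 := b 1
  have b2 := b 2
  have b3 := b 3
  have e : ∀ i, 1 - v i * z⁻¹ = (z - v i) / z := fun i => by field_simp
  simp only [e]
  clear hw hg hD e h1 h2 hv hz2 b
  generalize v 0 = x0 at *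
  generalize v 1 = x1 at *
  generalize v 2 = x2 at *
  generalize v 3 = x3 at *
  generalize hA0 : 1 - x0 * z = A0 at *
  generalize hA1 : 1 - x1 * z = A1 at *
  generalize hA2 : 1 - x2 * z = A2 at *
  generalize hA3 : 1 - x3 * z = A3 at *
  generalize hB0 : z - x0 = B0 at *
  generalize hB1 : z - x1 = B1 at *
  generalize hB2 : z - x2 = B2 at *
  generalize hB3 : z - x3 = B3 at *
  field_simp
  rw [← hA0, ← hA1, ← hA2, ← hA3, ← hB0, ← hB1, ← hB2, ← hB3]
  ring

lemma norm_mul_lt_one {a b : ℂ} (ha : ‖a‖ < 1) (hb : ‖b‖ ≤ 1) : ‖a * b‖ < 1 := by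
  rw [norm_mul]
  nlinarith [norm_nonneg a, norm_nonneg b]

/-- The integral of `awHalf` vanishes: `awHalf` is analytic for `1 ≤ |z| ≤ q^{-1/2}`, so the circle can
be enlarged to radius `q^{-1/2}`, and there `awHalf` is odd under reflection. -/
lemma circleIntegral_awHalf (hq0 : 0 < q) (hq1 : q < 1) {v : Fin 4 → ℂ} (hv : ∀ i, ‖v i‖ < 1) :
    (∮ z in C(0, 1), z⁻¹ * awHalf q v z) = 0 := by
  set R : ℝ := (√q)⁻¹ with hR
  have hs0 : 0 < √q := Real.sqrt_pos.2 hq0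
  have hs1 : √q < 1 := by rw [Real.sqrt_lt' one_pos]; simpa using hq1
  have hR1 : 1 ≤ R := (one_le_inv₀ hs0).2 hs1.le
  have hqs : q = √q * √q := (Real.mul_self_sqrt hq0.le).symm
  have hR2 : (R : ℂ) ^ 2 = (q : ℂ)⁻¹ := by
    have : R ^ 2 = q⁻¹ := by rw [hR, inv_pow, Real.sq_sqrt hq0.le]
    exact_mod_cast this
  have hdiff : ∀ z ∈ Metric.closedBall (0 : ℂ) R \ Metric.ball 0 1,
      DifferentiableAt ℂ (awHalf q v) z := by
    intro z hz
    have hzR : ‖z‖ ≤ R := by simpa using hz.1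
    have hz1 : 1 ≤ ‖z‖ := by simpa using hz.2
    have hz0 : z ≠ 0 := by rintro rfl; simp at hz1; linarith
    have hd := differentiable_qPochInf hq0 hq1
    have hd' : ∀ {f : ℂ → ℂ}, DifferentiableAt ℂ f z →
        DifferentiableAt ℂ (fun w => qPochInf q (f w)) z := fun hf => (hd _).comp z hf
    refine DifferentiableAt.div ?_ ?_ ?_
    · exact (hd' (by fun_prop)).mul (hd' (by fun_prop (disch := assumption)))
    · refine differentiableAt_id.mul (DifferentiableAt.fun_finsetProd fun i _ => ?_)
      exact (hd' (by fun_prop)).mul (hd' (by fun_prop (disch := assumption)))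
    · refine mul_ne_zero hz0 (prod_ne_zero_iff.2 fun i _ => mul_ne_zero ?_ ?_)
      · refine qPochInf_ne_zero_of_norm_lt hq0 hq1 ?_
        rw [mul_assoc]
        refine norm_mul_lt_one (hv i) ?_
        rw [norm_mul, Complex.norm_of_nonneg hq0.le]
        calc q * ‖z‖ ≤ q * R := mul_le_mul_of_nonneg_left hzR hq0.le
          _ = √q := by rw [hR]; nth_rw 1 [hqs]; field_simp
          _ ≤ 1 := hs1.le
      · refine qPochInf_ne_zero_of_norm_lt hq0 hq1 (norm_mul_lt_one (hv i) ?_)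
        rw [norm_inv]; exact inv_le_one_of_one_le₀ hz1
  have hann := Complex.circleIntegral_sub_center_inv_smul_eq_of_differentiable_on_annulus_off_countable
    one_pos hR1 (f := awHalf q v) Set.countable_empty
    (fun z hz => (hdiff z hz).continuousAt.continuousWithinAt)
    (fun z hz => hdiff z ⟨Metric.ball_subset_closedBall hz.1.1,
      fun h => hz.1.2 (Metric.ball_subset_closedBall h)⟩)
  simp only [sub_zero, smul_eq_mul] at hann
  rw [← hann]
  have hrefl := circleIntegral_reflect (awHalf q v) (R := R) (by positivity)
  have hneg : (∮ z in C(0, R), z⁻¹ * awHalf q v ((R : ℂ) ^ 2 * z⁻¹)) =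
      -∮ z in C(0, R), z⁻¹ * awHalf q v z := by
    rw [← neg_one_mul, ← circleIntegral.integral_const_mul]
    refine circleIntegral.integral_congr (by positivity) fun z hz => ?_
    have hz0 : z ≠ 0 := by
      rintro rfl
      have : (0 : ℝ) = R := by simpa using hz
      linarith
    simp only [hR2, awHalf_reflect hq0 hq1 v hz0, mul_neg, neg_mul, one_mul]
  rw [hrefl] at hneg
  exact self_eq_neg.1 hneg

lemma awGeneric_of_norm_lt (hq0 : 0 < q) (hq1 : q < 1) {v : Fin 4 → ℂ} (hv : ∀ i, ‖v i‖ < 1) :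
    AWGeneric q v := by
  have h : ∀ i, ∀ k : ℕ, ‖v i‖ * q ^ k < 1 := fun i k => by
    have : q ^ k ≤ 1 := pow_le_one₀ hq0.le hq1.le
    nlinarith [hv i, norm_nonneg (v i), pow_pos hq0 k]
  exact ⟨fun i k => (h i k).ne, fun i j k l h1 => absurd h1 (h i k).not_gt,
    fun i j k l h1 => absurd h1 (h i k).not_gt⟩

lemma awFunctional_of_norm_lt (hq0 : 0 < q) (hq1 : q < 1) {v : Fin 4 → ℂ} (hv : ∀ i, ‖v i‖ < 1)
    (φ : ℂ → ℂ) : awFunctional q v φ =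
      (2 * (Real.pi : ℂ) * Complex.I)⁻¹ * ∮ z in C(0, 1), z⁻¹ * (awWeight q v z * φ z) := by
  simp [awFunctional, outCount_eq_zero hq0 hq1 (hv _).le]

lemma awFunctional_one_add_inv (hq0 : 0 < q) (hq1 : q < 1) {v : Fin 4 → ℂ}
    (hv : ∀ i, ∀ k : ℕ, ‖v i‖ * q ^ k ≠ 1) (a b : ℂ) :
    awFunctional q v (fun z => a + b * (z + z⁻¹)) =
      a * awFunctional q v (fun _ => 1) + b * awFunctional q v (fun z => z + z⁻¹) := by
  have h := awFunctional_sum hq0 hq1 hv (univ : Finset (Fin 2)) ![a, b]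
    ![fun _ => 1, fun z => z + z⁻¹] (by
      intro i _
      fin_cases i
      · exact continuousOn_const
      · exact continuousOn_id.add (continuousOn_id.inv₀ fun z => ne_zero_of_mem_unitSphere))
  simpa [Fin.sum_univ_two] using h

/-- A shift of a parameter expresses the new integral of `1` through those of `1` and of `z + z⁻¹`. -/
lemma awFunctional_update_one (hq0 : 0 < q) (hq1 : q < 1) {v : Fin 4 → ℂ} (hv : AWGeneric q v)
    (l : Fin 4) :
    awFunctional q (Function.update v l (v l * q)) (fun _ => 1) =
      (1 + v l ^ 2) * awFunctional q v (fun _ => 1) -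
        v l * awFunctional q v (fun z => z + z⁻¹) := by
  rw [awFunctional_update hq0 hq1 hv, sub_eq_add_neg, ← neg_mul,
    ← awFunctional_one_add_inv hq0 hq1 hv.1]
  have h : ∀ z : ℂ, z ≠ 0 → (1 - v l * z) * (1 - v l * z⁻¹) * 1 =
      1 + v l ^ 2 + -v l * (z + z⁻¹) := fun z hz => by field_simp; ring
  unfold awFunctional
  congr 1
  · congr 1
    refine circleIntegral.integral_congr zero_le_one fun z hz => ?_
    simp only [h z (ne_zero_of_mem_unitSphere hz)]
  · refine sum_congr rfl fun i _ => sum_congr rfl fun k hk => ?_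
    have hp := mul_ne_zero (ne_zero_of_lt_outCount hq0 hq1 (mem_range.1 hk))
      (pow_ne_zero k (qC_ne_zero hq0))
    simp only [h _ hp, h _ (inv_ne_zero hp)]

/-- The recurrence of the Askey–Wilson integral under the shift of a parameter. The integral of
`z + z⁻¹` is eliminated by means of `circleIntegral_awHalf`. -/
lemma awFunctional_update_of_norm_lt (hq0 : 0 < q) (hq1 : q < 1) {v : Fin 4 → ℂ}
    (hv : ∀ i, ‖v i‖ < 1) (l : Fin 4) :
    awFunctional q (Function.update v l (v l * q)) (fun _ => 1) * (1 - v 0 * v 1 * v 2 * v 3) =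
      awFunctional q v (fun _ => 1) * ∏ j ∈ univ.erase l, (1 - v l * v j) := by
  have hg := awGeneric_of_norm_lt hq0 hq1 hv
  have key : (1 - v 0 * v 1 * v 2 * v 3) * awFunctional q v (fun z => z + z⁻¹) =
      (v 0 + v 1 + v 2 + v 3 -
        (v 0 * v 1 * v 2 + v 0 * v 1 * v 3 + v 0 * v 2 * v 3 + v 1 * v 2 * v 3)) *
        awFunctional q v (fun _ => 1) := by
    rw [← sub_eq_zero, sub_eq_neg_add, ← neg_mul, ← awFunctional_one_add_inv hq0 hq1 hg.1,
      awFunctional_of_norm_lt hq0 hq1 hv]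
    have e : (∮ z in C(0, 1), z⁻¹ * (awWeight q v z * (-(v 0 + v 1 + v 2 + v 3 -
        (v 0 * v 1 * v 2 + v 0 * v 1 * v 3 + v 0 * v 2 * v 3 + v 1 * v 2 * v 3)) +
        (1 - v 0 * v 1 * v 2 * v 3) * (z + z⁻¹)))) =
        ∮ z in C(0, 1), (z⁻¹ * awHalf q v z + z⁻¹ * awHalf q v z⁻¹) := by
      refine circleIntegral.integral_congr zero_le_one fun z hz => ?_
      have h := awHalf_add_inv hq0 hq1 hv (z := z) (by simpa using hz)
      linear_combination -z⁻¹ * h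
    have hcont : ContinuousOn (awHalf q v) (Metric.sphere 0 1) := by
      have hc := continuous_qPochInf hq0 hq1
      have hi : ContinuousOn (fun z : ℂ => z⁻¹) (Metric.sphere 0 1) :=
        continuousOn_id.inv₀ fun z => ne_zero_of_mem_unitSphere
      refine ContinuousOn.div ?_ ?_ ?_
      · exact (hc.comp_continuousOn (by fun_prop)).mul (hc.comp_continuousOn (hi.pow 2))
      · refine continuousOn_id.mul (continuousOn_finsetProd _ fun i _ => ?_)
        exact (hc.comp_continuousOn (by fun_prop)).mul
          (hc.comp_continuousOn (continuousOn_const.mul hi))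
      · intro z hz
        have hz1 : ‖z‖ = 1 := by simpa using hz
        refine mul_ne_zero (ne_zero_of_mem_unitSphere hz)
          (prod_ne_zero_iff.2 fun i _ => mul_ne_zero ?_ ?_)
        · refine qPochInf_ne_zero_of_norm_lt hq0 hq1 ?_
          rw [mul_assoc]
          refine norm_mul_lt_one (hv i) ?_
          rw [norm_mul, Complex.norm_of_nonneg hq0.le, hz1]; linarith
        · refine qPochInf_ne_zero_of_norm_lt hq0 hq1 (norm_mul_lt_one (hv i) ?_)
          rw [norm_inv, hz1, inv_one]
    have hi : ContinuousOn (fun z : ℂ => z⁻¹) (Metric.sphere 0 1) :=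
      continuousOn_id.inv₀ fun z => ne_zero_of_mem_unitSphere
    have i1 : CircleIntegrable (fun z => z⁻¹ * awHalf q v z) 0 1 :=
      (hi.mul hcont).circleIntegrable zero_le_one
    have i2 : CircleIntegrable (fun z => z⁻¹ * awHalf q v z⁻¹) 0 1 :=
      (hi.mul (hcont.comp hi fun z hz => by simpa using hz)).circleIntegrable zero_le_one
    rw [e, circleIntegral.integral_add i1 i2]
    have hr := circleIntegral_reflect (awHalf q v) one_ne_zero
    simp only [Complex.ofReal_one, one_pow, one_mul] at hr
    rw [hr, circleIntegral_awHalf hq0 hq1 hv]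
    simp
  rw [awFunctional_update_one hq0 hq1 hg, sub_mul]
  generalize awFunctional q v (fun z => z + z⁻¹) = X at *
  generalize awFunctional q v (fun _ => 1) = Y at *
  fin_cases l
  · simp only [Fin.zero_eta, Fin.isValue, erase_zero_four]
    rw [prod_insert (by decide), prod_insert (by decide), prod_singleton]
    linear_combination -v 0 * key
  · simp only [Fin.mk_one, Fin.isValue, erase_one_four]
    rw [prod_insert (by decide), prod_insert (by decide), prod_singleton]
    linear_combination -v 1 * key
  · simp only [Fin.reduceFinMk, Fin.isValue, erase_two_four]
    rw [prod_insert (by decide), prod_insert (by decide), prod_singleton]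
    linear_combination -v 2 * key
  · simp only [Fin.reduceFinMk, Fin.isValue, erase_three_four]
    rw [prod_insert (by decide), prod_insert (by decide), prod_singleton]
    linear_combination -v 3 * key

end UnitCircle

section UnitCircleValue

variable {q : ℝ}

lemma awValue_ne_zero (hq0 : 0 < q) (hq1 : q < 1) {v : Fin 4 → ℂ} (hv : ∀ i, ‖v i‖ < 1) :
    awValue q v ≠ 0 := by
  have h2 : ∀ i j, qPochInf q (v i * v j) ≠ 0 := fun i j =>
    qPochInf_ne_zero_of_norm_lt hq0 hq1 (norm_mul_lt_one (hv i) (hv j).le)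
  have hq : qPochInf q (q : ℂ) ≠ 0 := qPochInf_ne_zero_of_norm_lt hq0 hq1 (by
    rwa [Complex.norm_of_nonneg hq0.le])
  have h4 : qPochInf q (v 0 * v 1 * v 2 * v 3) ≠ 0 :=
    qPochInf_ne_zero_of_norm_lt hq0 hq1 (norm_mul_lt_one (norm_mul_lt_one
      (norm_mul_lt_one (hv 0) (hv 1).le) (hv 2).le) (hv 3).le)
  unfold awValue
  simp only [ne_eq, div_eq_zero_iff, mul_eq_zero, OfNat.ofNat_ne_zero, h4, hq, h2, or_self,
    not_false_eq_true]

lemma norm_update_lt (hq0 : 0 < q) (hq1 : q < 1) {v : Fin 4 → ℂ} (hv : ∀ i, ‖v i‖ < 1)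
    (l i : Fin 4) : ‖Function.update v l (v l * q) i‖ < 1 := by
  by_cases h : i = l
  · subst h
    rw [Function.update_self]
    exact norm_mul_lt_one (hv i) (by rw [Complex.norm_of_nonneg hq0.le]; exact hq1.le)
  · rw [Function.update_of_ne h]; exact hv i

/-- The quotient of the Askey–Wilson integral by `awValue` is invariant under the shift of a
parameter. -/
lemma awFunctional_div_update (hq0 : 0 < q) (hq1 : q < 1) {v : Fin 4 → ℂ} (hv : ∀ i, ‖v i‖ < 1)
    (l : Fin 4) :
    awFunctional q (Function.update v l (v l * q)) (fun _ => 1) /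
        awValue q (Function.update v l (v l * q)) =
      awFunctional q v (fun _ => 1) / awValue q v := by
  have h2 : ∀ i j, v i * v j ≠ 1 := fun i j h => by
    have := norm_mul_lt_one (hv i) (hv j).le
    rw [h, norm_one] at this
    exact lt_irrefl _ this
  have h4 : 1 - v 0 * v 1 * v 2 * v 3 ≠ 0 := by
    refine sub_ne_zero.2 fun h => ?_
    have := norm_mul_lt_one (norm_mul_lt_one
      (norm_mul_lt_one (hv 0) (hv 1).le) (hv 2).le) (hv 3).le
    rw [← h, norm_one] at this
    exact lt_irrefl _ this
  have e1 := awFunctional_update_of_norm_lt hq0 hq1 hv l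
  have e2 := awValue_update hq0 hq1 v l fun j _ => h2 l j
  have hp : ∏ j ∈ univ.erase l, (1 - v l * v j) ≠ 0 :=
    prod_ne_zero_iff.2 fun j _ => sub_ne_zero.2 (h2 l j).symm
  rw [← mul_div_mul_right _ _ h4, e1, e2, mul_div_mul_right _ _ hp]

lemma awFunctional_div_shift (hq0 : 0 < q) (hq1 : q < 1) {v : Fin 4 → ℂ} (hv : ∀ i, ‖v i‖ < 1)
    (n : ℕ) :
    awFunctional q (fun i => v i * (q : ℂ) ^ n) (fun _ => 1) /
        awValue q (fun i => v i * (q : ℂ) ^ n) =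
      awFunctional q v (fun _ => 1) / awValue q v := by
  induction n with
  | zero => simp
  | succ n ih =>
    rw [← ih]
    set w : Fin 4 → ℂ := fun i => v i * (q : ℂ) ^ n with hw
    have hw1 : ∀ i, ‖w i‖ < 1 := fun i => norm_mul_lt_one (hv i) (by
      rw [norm_qpow hq0]; exact pow_le_one₀ hq0.le hq1.le)
    have h0 := norm_update_lt hq0 hq1 hw1 0
    have h1 := norm_update_lt hq0 hq1 h0 1
    have h2 := norm_update_lt hq0 hq1 h1 2
    have e : (fun i => v i * (q : ℂ) ^ (n + 1)) = Function.update (Function.update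
        (Function.update (Function.update w 0 (w 0 * q)) 1 (w 1 * q)) 2 (w 2 * q)) 3 (w 3 * q) := by
      funext i
      fin_cases i <;> simp [hw, pow_succ, mul_assoc]
    rw [e]
    have s0 := awFunctional_div_update hq0 hq1 hw1 0
    have s1 := awFunctional_div_update hq0 hq1 h0 1
    have s2 := awFunctional_div_update hq0 hq1 h1 2
    have s3 := awFunctional_div_update hq0 hq1 h2 3
    simp only [ne_eq, Fin.reduceEq, not_false_eq_true, Function.update_of_ne] at s1 s2 s3
    rw [s3, s2, s1, s0]

lemma continuous_awValue_comp {X : Type*} [TopologicalSpace X] (hq0 : 0 < q) (hq1 : q < 1)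
    {v : X → Fin 4 → ℂ} (hv : Continuous v) (x : X)
    (h : ∀ i j, i ≠ j → qPochInf q (v x i * v x j) ≠ 0) :
    ContinuousAt (fun s => awValue q (v s)) x := by
  have hc := continuous_qPochInf hq0 hq1
  have hvi : ∀ i, Continuous fun s => v s i := fun i => (continuous_apply i).comp hv
  have hq : qPochInf q (q : ℂ) ≠ 0 := qPochInf_ne_zero_of_norm_lt hq0 hq1 (by
    rwa [Complex.norm_of_nonneg hq0.le])
  have h2 : ∀ i j, Continuous fun s => qPochInf q (v s i * v s j) := fun i j =>
    hc.comp ((hvi i).mul (hvi j))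
  unfold awValue
  refine ContinuousAt.div ?_ ?_ ?_
  · exact (continuous_const.mul (hc.comp ((((hvi 0).mul (hvi 1)).mul (hvi 2)).mul
      (hvi 3)))).continuousAt
  · exact (continuous_const.mul ((((((h2 0 1).mul (h2 0 2)).mul (h2 0 3)).mul (h2 1 2)).mul
      (h2 1 3)).mul (h2 2 3))).continuousAt
  · have a := h 0 1 (by decide)
    have b := h 0 2 (by decide)
    have c := h 0 3 (by decide)
    have d := h 1 2 (by decide)
    have e := h 1 3 (by decide)
    have f := h 2 3 (by decide)
    simp only [ne_eq, mul_eq_zero, hq, a, b, c, d, e, f, or_self, not_false_eq_true]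

/-- The unit circle integral depends continuously on parameters that avoid the circle. -/
lemma continuous_circleIntegral_awWeight {X : Type*} [TopologicalSpace X] (hq0 : 0 < q)
    (hq1 : q < 1) {v : X → Fin 4 → ℂ} (hv : Continuous v)
    (hne : ∀ s i, ∀ k : ℕ, ‖v s i‖ * q ^ k ≠ 1) :
    Continuous fun s => ∮ z in C(0, 1), z⁻¹ * (awWeight q (v s) z * 1) := by
  have hc := continuous_qPochInf hq0 hq1
  have hvi : ∀ i, Continuous fun p : X × ℝ => v p.1 i := fun i =>
    (continuous_apply i).comp (hv.comp continuous_fst)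
  have hz : Continuous fun p : X × ℝ => circleMap 0 1 p.2 :=
    (continuous_circleMap 0 1).comp continuous_snd
  have hz0 : ∀ p : X × ℝ, circleMap 0 1 p.2 ≠ 0 := fun p => circleMap_ne_center one_ne_zero
  have hzi : Continuous fun p : X × ℝ => (circleMap 0 1 p.2)⁻¹ := hz.inv₀ hz0
  simp_rw [circleIntegral_inv_mul _ one_ne_zero, mul_one]
  refine intervalIntegral.continuous_parametric_intervalIntegral_of_continuous' ?_ _ _
  refine continuous_const.mul (Continuous.div ?_ ?_ ?_)
  · exact (hc.comp (hz.pow 2)).mul (hc.comp (hz.zpow₀ _ fun p => Or.inl (hz0 p)))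
  · refine continuous_finsetProd _ fun i _ => ?_
    exact (hc.comp ((hvi i).mul hz)).mul (hc.comp ((hvi i).mul hzi))
  · intro p
    exact prod_ne_zero_iff.2 fun i _ => pairPoch_ne_zero_of_norm hq0 hq1 (hne p.1 i) (by simp)

/-- The quotient of the Askey–Wilson integral by `awValue` does not depend on the parameters: by
repeated shifts all of them are sent to zero, and the quotient is continuous there. -/
lemma awFunctional_div_eq (hq0 : 0 < q) (hq1 : q < 1) {v : Fin 4 → ℂ} (hv : ∀ i, ‖v i‖ < 1) :
    awFunctional q v (fun _ => 1) / awValue q v =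
      awFunctional q 0 (fun _ => 1) / awValue q 0 := by
  let X := {s : ℂ // ‖s‖ ≤ 1}
  let w : X → Fin 4 → ℂ := fun s i => v i * s.1
  have hw : Continuous w := by fun_prop
  have hw1 : ∀ s i, ‖w s i‖ < 1 := fun s i => norm_mul_lt_one (hv i) s.2
  have hcI : Continuous fun s => awFunctional q (w s) (fun _ => 1) := by
    have : (fun s => awFunctional q (w s) (fun _ => 1)) = fun s =>
        (2 * (Real.pi : ℂ) * Complex.I)⁻¹ * ∮ z in C(0, 1), z⁻¹ * (awWeight q (w s) z * 1) := by
      funext s; exact awFunctional_of_norm_lt hq0 hq1 (hw1 s) _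
    rw [this]
    exact continuous_const.mul (continuous_circleIntegral_awWeight hq0 hq1 hw fun s =>
      (awGeneric_of_norm_lt hq0 hq1 (hw1 s)).1)
  let s : ℕ → X := fun n => ⟨(q : ℂ) ^ n, by
    rw [norm_qpow hq0]; exact pow_le_one₀ hq0.le hq1.le⟩
  let s0 : X := ⟨0, by simp⟩
  have hs : Tendsto s atTop (𝓝 s0) := tendsto_subtype_rng.2 (tendsto_qpow hq0 hq1)
  have hcV : ContinuousAt (fun s => awValue q (w s)) s0 :=
    continuous_awValue_comp hq0 hq1 hw s0 fun i j _ => qPochInf_ne_zero_of_norm_lt hq0 hq1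
      (norm_mul_lt_one (hw1 s0 i) (hw1 s0 j).le)
  have hlim := (hcI.continuousAt.div hcV (awValue_ne_zero hq0 hq1 (hw1 s0))).tendsto.comp hs
  have hw0 : w s0 = 0 := by funext i; simp [w, s0]
  have hconst : ((fun x => awFunctional q (w x) (fun _ => 1) / awValue q (w x)) ∘ s) =
      fun _ => awFunctional q v (fun _ => 1) / awValue q v := by
    funext n
    exact awFunctional_div_shift hq0 hq1 hv n
  have hlim' : Tendsto (fun _ : ℕ => awFunctional q v (fun _ => 1) / awValue q v) atTop
      (𝓝 (awFunctional q (w s0) (fun _ => 1) / awValue q (w s0))) := by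
    rw [← hconst]; exact hlim
  rw [hw0] at hlim'
  exact tendsto_nhds_unique tendsto_const_nhds hlim'

/-- Parameters for which the weight is `(1 - z²)(1 - z⁻²)` on the unit circle, so that its constant
term can be read off. -/
def awSpecial (q : ℝ) : Fin 4 → ℂ := ![(q : ℂ), -(q : ℂ), (√q : ℂ), -(√q : ℂ)]

lemma norm_awSpecial_lt (hq0 : 0 < q) (hq1 : q < 1) (i : Fin 4) : ‖awSpecial q i‖ < 1 := by
  have hs1 : √q < 1 := by rw [Real.sqrt_lt' one_pos]; simpa using hq1
  fin_cases i <;> simp [awSpecial, abs_of_pos hq0, abs_of_nonneg (Real.sqrt_nonneg q), hq1, hs1]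

lemma awWeight_awSpecial (hq0 : 0 < q) (hq1 : q < 1) {z : ℂ} (hz : ‖z‖ = 1) :
    awWeight q (awSpecial q) z = (1 - z ^ 2) * (1 - z⁻¹ ^ 2) := by
  have hs : (√q : ℂ) ^ 2 = (q : ℂ) := by exact_mod_cast Real.sq_sqrt hq0.le
  have key : ∀ x : ℂ, qPochInf q (x ^ 2) = (1 - x ^ 2) * (qPochInf q (q * x) *
      qPochInf q (-q * x) * qPochInf q (√q * x) * qPochInf q (-√q * x)) := by
    intro x
    rw [qPochInf_eq_mul hq0 hq1 (x ^ 2)]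
    congr 1
    have h1 := qPochInf_mul_neg hq0 hq1 (q * x)
    have h2 := qPochInf_mul_neg hq0 hq1 (√q * x)
    have h3 := qPochInf_sq_mul hq0 hq1 (x ^ 2 * q)
    rw [mul_pow, hs] at h2
    rw [show (-q : ℂ) * x = -(q * x) by ring, show (-√q : ℂ) * x = -(√q * x) by ring, h1,
      mul_assoc, h2, ← h3, mul_comm]
    congr 2 <;> ring
  have hne : ∀ i, pairPoch q (awSpecial q i) z ≠ 0 := fun i =>
    pairPoch_ne_zero_of_norm hq0 hq1
      ((awGeneric_of_norm_lt hq0 hq1 (norm_awSpecial_lt hq0 hq1)).1 i) hz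
  have hP : ∏ i, pairPoch q (awSpecial q i) z ≠ 0 := prod_ne_zero_iff.2 fun i _ => hne i
  rw [awWeight, awNum, show z ^ (-2 : ℤ) = z⁻¹ ^ 2 by simp [zpow_neg, zpow_ofNat], key z,
    key z⁻¹, div_eq_iff hP, Fin.prod_univ_four]
  simp [awSpecial, pairPoch]
  ring

lemma awFunctional_awSpecial (hq0 : 0 < q) (hq1 : q < 1) :
    awFunctional q (awSpecial q) (fun _ => 1) = 2 := by
  rw [awFunctional_of_norm_lt hq0 hq1 (norm_awSpecial_lt hq0 hq1)]
  have e : (∮ z in C(0, 1), z⁻¹ * (awWeight q (awSpecial q) z * 1)) =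
      ∮ z in C(0, 1), (2 * (z - 0)⁻¹ - ((z - 0) ^ (1 : ℤ) + (z - 0) ^ (-3 : ℤ))) := by
    refine circleIntegral.integral_congr zero_le_one fun z hz => ?_
    have hz0 := ne_zero_of_mem_unitSphere hz
    simp only [awWeight_awSpecial hq0 hq1 (show ‖z‖ = 1 by simpa using hz), sub_zero, zpow_one]
    rw [show z ^ (-3 : ℤ) = (z ^ 3)⁻¹ by rw [zpow_neg]; norm_cast]
    field_simp
    ring
  have c1 : ContinuousOn (fun z : ℂ => 2 * (z - 0)⁻¹) (Metric.sphere 0 1) := by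
    refine continuousOn_const.mul (ContinuousOn.inv₀ (by fun_prop) fun z hz => ?_)
    simpa using ne_zero_of_mem_unitSphere hz
  have c2 : ContinuousOn (fun z : ℂ => (z - 0) ^ (1 : ℤ)) (Metric.sphere 0 1) := by
    simp only [zpow_one]; fun_prop
  have c3 : ContinuousOn (fun z : ℂ => (z - 0) ^ (-3 : ℤ)) (Metric.sphere 0 1) := by
    refine ContinuousOn.zpow₀ (by fun_prop) _ fun z hz => Or.inl ?_
    simpa using ne_zero_of_mem_unitSphere hz
  have i23 : CircleIntegrable (fun z : ℂ => (z - 0) ^ (1 : ℤ) + (z - 0) ^ (-3 : ℤ)) 0 1 :=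
    (c2.add c3).circleIntegrable zero_le_one
  rw [e, circleIntegral.integral_sub (c1.circleIntegrable zero_le_one) i23,
    circleIntegral.integral_add (c2.circleIntegrable zero_le_one)
    (c3.circleIntegrable zero_le_one), circleIntegral.integral_const_mul,
    circleIntegral.integral_sub_center_inv 0 one_ne_zero,
    circleIntegral.integral_sub_zpow_of_ne (by decide),
    circleIntegral.integral_sub_zpow_of_ne (by decide)]
  have := Complex.two_pi_I_ne_zero
  field_simp
  ring

lemma awValue_awSpecial (hq0 : 0 < q) (hq1 : q < 1) : awValue q (awSpecial q) = 2 := by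
  have hs : (√q : ℂ) * √q = (q : ℂ) := by exact_mod_cast Real.mul_self_sqrt hq0.le
  have hqn : ‖(q : ℂ)‖ < 1 := by rwa [Complex.norm_of_nonneg hq0.le]
  have hh0 : 0 < q ^ 2 := by positivity
  have hh1 : q ^ 2 < 1 := by nlinarith
  have hqc : ((q ^ 2 : ℝ) : ℂ) = (q : ℂ) ^ 2 := by push_cast; ring
  -- `O` and `E` are the products over the odd and even powers of `q`.
  set O := qPochInf (q ^ 2) (q : ℂ) with hO
  set E := qPochInf (q ^ 2) ((q : ℂ) ^ 2) with hE
  have nO : O ≠ 0 := qPochInf_ne_zero_of_norm_lt hh0 hh1 hqn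
  have nE : E ≠ 0 := qPochInf_ne_zero_of_norm_lt hh0 hh1 (by
    rw [norm_qpow hq0]; exact hh1)
  have n1 : (1 : ℂ) - q ≠ 0 := sub_ne_zero.2 fun h => by rw [← h] at hqn; simp at hqn
  have n2 : (1 : ℂ) + q ≠ 0 := by
    have : (1 : ℝ) + q ≠ 0 := by positivity
    exact_mod_cast this
  have a1 : qPochInf q (q : ℂ) = O * E := by
    rw [← qPochInf_sq_mul hq0 hq1 q, ← pow_two]
  have a2 : qPochInf q (q : ℂ) * qPochInf q (-q : ℂ) = E := qPochInf_mul_neg hq0 hq1 q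
  have a3 : qPochInf q (-q : ℂ) = (1 + q) * qPochInf q (-q ^ 2 : ℂ) := by
    rw [qPochInf_eq_mul hq0 hq1 (-q : ℂ)]; ring_nf
  have a4 : O = (1 - q) * qPochInf (q ^ 2) ((q : ℂ) ^ 3) := by
    rw [hO, qPochInf_eq_mul hh0 hh1 (q : ℂ), hqc]; ring_nf
  have a5 : qPochInf q (q : ℂ) = (1 - q) * ((1 - q ^ 2) * qPochInf q ((q : ℂ) ^ 3)) := by
    rw [qPochInf_eq_mul hq0 hq1 (q : ℂ), qPochInf_eq_mul hq0 hq1 ((q : ℂ) * q)]; ring_nf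
  have a6 : qPochInf q ((q : ℂ) * √q) * qPochInf q (-((q : ℂ) * √q)) =
      qPochInf (q ^ 2) ((q : ℂ) ^ 3) := by
    rw [qPochInf_mul_neg hq0 hq1, mul_pow, pow_two (√q : ℂ), hs]; ring_nf
  have nn : qPochInf q (-q ^ 2 : ℂ) ≠ 0 := qPochInf_ne_zero_of_norm_lt hq0 hq1 (by
    rw [norm_neg, norm_qpow hq0]; exact hh1)
  have n3 : qPochInf (q ^ 2) ((q : ℂ) ^ 3) ≠ 0 := fun h => nO (by rw [a4, h, mul_zero])
  have n6 : qPochInf q ((q : ℂ) * √q) * qPochInf q (-((q : ℂ) * √q)) ≠ 0 := by rwa [a6]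
  have nq : qPochInf q (q : ℂ) ≠ 0 := by rw [a1]; exact mul_ne_zero nO nE
  have nq' : qPochInf q (-q : ℂ) ≠ 0 := by rw [a3]; exact mul_ne_zero n2 nn
  have f1 : (q : ℂ) * -q = -q ^ 2 := by ring
  have f2 : (q : ℂ) * -q * √q * -√q = q ^ 3 := by
    linear_combination (q : ℂ) ^ 2 * hs
  have f3 : (-q : ℂ) * √q = -(q * √q) := by ring
  have f4 : (-q : ℂ) * -√q = q * √q := by ring
  have f5 : (q : ℂ) * -√q = -(q * √q) := by ring
  have f6 : (√q : ℂ) * -√q = -q := by linear_combination -hs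
  have hden : qPochInf q (q : ℂ) * (qPochInf q (-q ^ 2 : ℂ) * qPochInf q ((q : ℂ) * √q) *
      qPochInf q (-((q : ℂ) * √q)) * qPochInf q (-((q : ℂ) * √q)) * qPochInf q ((q : ℂ) * √q) *
      qPochInf q (-q : ℂ)) ≠ 0 := by
    have := left_ne_zero_of_mul n6
    have := right_ne_zero_of_mul n6
    simp only [ne_eq, mul_eq_zero, not_or]
    tauto
  simp only [awValue, awSpecial, Matrix.cons_val_zero, Matrix.cons_val_one, Matrix.cons_val]
  rw [f2, f1, f3, f4, f5, f6, div_eq_iff hden]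
  -- Both sides are expressed through `O` and `E`.
  have g1 : qPochInf q (-q : ℂ) * O = 1 := by
    have : E * (qPochInf q (-q : ℂ) * O) = E * 1 := by
      linear_combination a2 - qPochInf q (-q : ℂ) * a1
    exact mul_left_cancel₀ nE this
  have g2 : (1 + q) * (1 - q) * (qPochInf q (-q ^ 2 : ℂ) * qPochInf (q ^ 2) ((q : ℂ) ^ 3)) = 1 := by
    have g1' := g1
    rw [a3, a4] at g1'
    linear_combination g1'
  have g3 : (1 - q) ^ 2 * (1 + q) * qPochInf q ((q : ℂ) ^ 3) =
      (1 - q) * qPochInf (q ^ 2) ((q : ℂ) ^ 3) * E := by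
    rw [← a4, ← a1, a5]; ring
  have n4 : (1 - (q : ℂ)) ^ 2 * (1 + q) ≠ 0 := mul_ne_zero (pow_ne_zero 2 n1) n2
  refine mul_left_cancel₀ n4 ?_
  rw [show ∀ A B C D F : ℂ, 2 * (A * (B * C * D * D * C * F)) = 2 * (A * F) * B * (C * D) ^ 2 by
    intros; ring, a2, a6]
  linear_combination 2 * g3 - 2 * (1 - q) * E * qPochInf (q ^ 2) ((q : ℂ) ^ 3) * g2

/-- The Askey–Wilson integral over the unit circle. -/
theorem awFunctional_eq_awValue_of_norm_lt (hq0 : 0 < q) (hq1 : q < 1) {v : Fin 4 → ℂ}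
    (hv : ∀ i, ‖v i‖ < 1) : awFunctional q v (fun _ => 1) = awValue q v := by
  have h1 := awFunctional_div_eq hq0 hq1 hv
  rw [← awFunctional_div_eq hq0 hq1 (norm_awSpecial_lt hq0 hq1), awFunctional_awSpecial hq0 hq1,
    awValue_awSpecial hq0 hq1, div_self two_ne_zero,
    div_eq_one_iff_eq (awValue_ne_zero hq0 hq1 hv)] at h1
  exact h1

end UnitCircleValue

/-! ### The Askey–Wilson integral over a deformed cycle -/

section DeformedCycle

variable {q : ℝ}

/-- The defect of the Askey–Wilson evaluation. It vanishes for generic parameters whose product has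
modulus less than one (`awDefect_eq_zero`). -/
def awDefect (q : ℝ) (v : Fin 4 → ℂ) : ℂ := awFunctional q v (fun _ => 1) - awValue q v

/-- The relation between the shifts of two parameters, which follows from
`v_j (1 - v_i z)(1 - v_i z⁻¹) - v_i (1 - v_j z)(1 - v_j z⁻¹) = (v_j - v_i)(1 - v_i v_j)`. -/
lemma awDefect_two_shifts (hq0 : 0 < q) (hq1 : q < 1) {v : Fin 4 → ℂ} (hv : AWGeneric q v)
    (h4 : v 0 * v 1 * v 2 * v 3 ≠ 1) {i j : Fin 4} (hij : i ≠ j) :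
    (v j - v i) * (1 - v i * v j) * awDefect q v =
      v j * awDefect q (Function.update v i (v i * q)) -
        v i * awDefect q (Function.update v j (v j * q)) := by
  have h2 : ∀ i j, v i * v j ≠ 1 := fun i j => by
    simpa using hv.mul_mul_pow_ne_one hq0 i j 0
  have h4' : 1 - v 0 * v 1 * v 2 * v 3 ≠ 0 := sub_ne_zero.2 h4.symm
  have a1 := awValue_update hq0 hq1 v i fun l _ => h2 i l
  have a2 := awValue_update hq0 hq1 v j fun l _ => h2 j l
  have key : v j * ∏ l ∈ univ.erase i, (1 - v i * v l) -
      v i * ∏ l ∈ univ.erase j, (1 - v j * v l) =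
      (v j - v i) * (1 - v i * v j) * (1 - v 0 * v 1 * v 2 * v 3) := by
    fin_cases i <;> fin_cases j <;>
      first
        | exact absurd rfl hij
        | (simp [erase_zero_four, erase_one_four, erase_two_four, erase_three_four]
           ring)
  have hA : v j * awValue q (Function.update v i (v i * q)) -
      v i * awValue q (Function.update v j (v j * q)) =
      (v j - v i) * (1 - v i * v j) * awValue q v := by
    refine mul_right_cancel₀ h4' ?_
    linear_combination v j * a1 - v i * a2 + awValue q v * key
  simp only [awDefect, awFunctional_update_one hq0 hq1 hv]
  linear_combination hA

/-- If only `v_i` may lie outside the unit circle, another parameter `v_j` can be replaced by any `b` in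
the disc, as long as `v_i b` is not an inverse power of `q`. -/
lemma AWGeneric.update_of_norm_lt {v : Fin 4 → ℂ} (hv : AWGeneric q v) (hq0 : 0 < q)
    (hq1 : q < 1) {i j : Fin 4} (hij : i ≠ j) (hlt : ∀ l, l ≠ i → ‖v l‖ < 1) {b : ℂ}
    (hb : ‖b‖ < 1) (hab : ∀ k : ℕ, v i * b * (q : ℂ) ^ k ≠ 1) :
    AWGeneric q (Function.update v j b) := by
  have hsmall : ∀ x : ℂ, ‖x‖ < 1 → ∀ k : ℕ, ‖x‖ * q ^ k < 1 := fun x hx k => by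
    have : q ^ k ≤ 1 := pow_le_one₀ hq0.le hq1.le
    nlinarith [norm_nonneg x, pow_pos hq0 k]
  set w := Function.update v j b with hw
  have hwj : w j = b := Function.update_self ..
  have hwn : ∀ l, l ≠ j → w l = v l := fun l hl => Function.update_of_ne hl ..
  have hwl : ∀ l, l ≠ i → ‖w l‖ < 1 := fun l hl => by
    by_cases h : l = j
    · rw [h, hwj]; exact hb
    · rw [hwn l h]; exact hlt l hl
  have hout : ∀ l k, 1 < ‖w l‖ * q ^ k → l = i := fun l k h => by
    by_contra hl
    exact lt_asymm h (hsmall _ (hwl l hl) k)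
  refine ⟨fun l k => ?_, fun l m k n h1 h => ?_, fun l m k n h1 => ?_⟩
  · by_cases h : l = j
    · rw [h, hwj]; exact (hsmall b hb k).ne
    · rw [hwn l h]; exact hv.1 l k
  · obtain rfl := hout l k h1
    by_cases hm : m = j
    · have := congrArg norm h
      rw [norm_mul, norm_mul, norm_qpow hq0, norm_qpow hq0] at this
      rw [this, hm, hwj] at h1
      exact absurd h1 (hsmall b hb n).not_gt
    · rw [hwn l hij] at h1 h
      rw [hwn m hm] at h
      exact hv.2.1 l m k n h1 h
  · obtain rfl := hout l k h1
    rw [hwn l hij] at h1 ⊢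
    by_cases hm : m = j
    · rw [hm, hwj]
      have := hab (k + n)
      intro h
      apply this
      rw [← h, pow_add]; ring
    · rw [hwn m hm]
      exact hv.2.2 l m k n h1

lemma awFunctional_of_single (hq0 : 0 < q) (hq1 : q < 1) {v : Fin 4 → ℂ} {i : Fin 4}
    (hlt : ∀ l, l ≠ i → ‖v l‖ < 1) :
    awFunctional q v (fun _ => 1) =
      (2 * (Real.pi : ℂ) * Complex.I)⁻¹ * (∮ z in C(0, 1), z⁻¹ * (awWeight q v z * 1)) +
        ∑ k ∈ range (outCount q (v i)), awCofactor q v i k (v i * (q : ℂ) ^ k) * (1 + 1) := by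
  unfold awFunctional
  congr 1
  refine sum_eq_single i (fun l _ hl => ?_) (by simp)
  rw [outCount_eq_zero hq0 hq1 (hlt l hl).le, range_zero, sum_empty]

/-- At a pole outside the unit circle, the remaining factors of the weight do not vanish. -/
lemma AWGeneric.cofactor_denom_ne_zero {v : Fin 4 → ℂ} (hv : AWGeneric q v) (hq0 : 0 < q)
    (hq1 : q < 1) {i : Fin 4} {k : ℕ} (hk : k < outCount q (v i)) :
    qPochInf q (v i * (v i * (q : ℂ) ^ k)) * qPoch q (v i * (v i * (q : ℂ) ^ k)⁻¹) k *
      qPochInf q (v i * (v i * (q : ℂ) ^ k)⁻¹ * (q : ℂ) ^ (k + 1)) *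
      ∏ j ∈ univ.erase i, pairPoch q (v j) (v i * (q : ℂ) ^ k) ≠ 0 := by
  have hvi := ne_zero_of_lt_outCount hq0 hq1 hk
  have hq := qC_ne_zero hq0
  have e : v i * (v i * (q : ℂ) ^ k)⁻¹ = ((q : ℂ) ^ k)⁻¹ := by field_simp
  rw [e]
  refine mul_ne_zero (mul_ne_zero (mul_ne_zero ?_ ?_) ?_) ?_
  · refine qPochInf_ne_zero hq0 hq1 fun l => ?_
    have := hv.mul_mul_pow_ne_one hq0 i i (k + l)
    intro h; apply this; rw [← h, pow_add]; ring
  · refine qPoch_ne_zero fun l hl h => ?_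
    have h1 : (q : ℂ) ^ l = (q : ℂ) ^ k := by field_simp at h; exact h
    have h2 := congrArg norm h1
    rw [norm_qpow hq0, norm_qpow hq0] at h2
    exact absurd h2 (pow_lt_pow_right_of_lt_one₀ hq0 hq1 hl).ne'
  · refine qPochInf_ne_zero_of_norm_lt hq0 hq1 ?_
    rw [show ((q : ℂ) ^ k)⁻¹ * (q : ℂ) ^ (k + 1) = q by rw [pow_succ]; field_simp,
      Complex.norm_of_nonneg hq0.le]
    exact hq1
  · exact prod_ne_zero_iff.2 fun j hj => hv.pairPoch_ne_zero hq0 hq1 (ne_of_mem_erase hj).symm hk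

/-- Continuity of the defect in a parameter `b` at `b = 0`, along the sequence `b q^n`. -/
lemma tendsto_awDefect_update (hq0 : 0 < q) (hq1 : q < 1) {v : Fin 4 → ℂ} (hv : AWGeneric q v)
    {i j : Fin 4} (hij : i ≠ j) (hlt : ∀ l, l ≠ i → ‖v l‖ < 1) {b : ℂ} (hb : ‖b‖ < 1) :
    Tendsto (fun n : ℕ => awDefect q (Function.update v j (b * (q : ℂ) ^ n))) atTop
      (𝓝 (awDefect q (Function.update v j 0))) := by
  let X := {s : ℂ // ‖s‖ ≤ 1}
  let w : X → Fin 4 → ℂ := fun s => Function.update v j (b * s.1)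
  have hw : Continuous w := continuous_const.update j (by fun_prop)
  have hwi : ∀ s, w s i = v i := fun s => Function.update_of_ne hij _ _
  have hwl : ∀ s l, l ≠ i → ‖w s l‖ < 1 := fun s l hl => by
    by_cases h : l = j
    · subst h
      simp only [w, Function.update_self]
      exact norm_mul_lt_one hb s.2
    · simp only [w, Function.update_of_ne h]; exact hlt l hl
  let s0 : X := ⟨0, by simp⟩
  have hw0 : w s0 = Function.update v j 0 := by simp [w, s0]
  have hg0 : AWGeneric q (w s0) := by
    rw [hw0]
    exact hv.update_of_norm_lt hq0 hq1 hij hlt (by simp) (by simp)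
  have hc := continuous_qPochInf hq0 hq1
  have hcont : ContinuousAt (fun s => awDefect q (w s)) s0 := by
    refine ContinuousAt.sub ?_ ?_
    · have e : (fun s => awFunctional q (w s) (fun _ => 1)) = fun s =>
          (2 * (Real.pi : ℂ) * Complex.I)⁻¹ * (∮ z in C(0, 1), z⁻¹ * (awWeight q (w s) z * 1)) +
          ∑ k ∈ range (outCount q (v i)),
            awCofactor q (w s) i k (v i * (q : ℂ) ^ k) * (1 + 1) := by
        funext s
        rw [awFunctional_of_single hq0 hq1 (hwl s), hwi]
      rw [e]
      refine ContinuousAt.add ?_ ?_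
      · refine (continuous_const.mul (continuous_circleIntegral_awWeight hq0 hq1 hw
          fun s l k => ?_)).continuousAt
        by_cases h : l = i
        · subst h; rw [hwi]; exact hv.1 l k
        · have : q ^ k ≤ 1 := pow_le_one₀ hq0.le hq1.le
          have h1 := hwl s l h
          have h2 := norm_nonneg (w s l)
          have h3 := pow_pos hq0 k
          exact ne_of_lt (by nlinarith)
      · refine tendsto_finsetSum _ fun k hk => ?_
        have hk' := mem_range.1 hk
        refine ContinuousAt.mul (ContinuousAt.div continuousAt_const ?_ ?_) continuousAt_const
        · simp only [hwi]
          refine (continuous_const.mul (continuous_finsetProd _ fun l _ => ?_)).continuousAt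
          have hl : Continuous fun s => w s l := (continuous_apply l).comp hw
          exact (hc.comp (hl.mul continuous_const)).mul (hc.comp (hl.mul continuous_const))
        · have := hg0.cofactor_denom_ne_zero hq0 hq1 (i := i) (k := k) (by rwa [hwi])
          rwa [hwi] at this ⊢
    · refine continuous_awValue_comp hq0 hq1 hw s0 fun l m _ => qPochInf_ne_zero hq0 hq1 fun k => ?_
      exact hg0.mul_mul_pow_ne_one hq0 l m k
  let s : ℕ → X := fun n => ⟨(q : ℂ) ^ n, by
    rw [norm_qpow hq0]; exact pow_le_one₀ hq0.le hq1.le⟩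
  have hs : Tendsto s atTop (𝓝 s0) := tendsto_subtype_rng.2 (tendsto_qpow hq0 hq1)
  have := hcont.tendsto.comp hs
  rw [hw0] at this
  exact this

/-- Given an index `i`, the other three indices together with the form that `awValue` takes when
the four parameters are listed in this order. -/
lemma exists_frame (i : Fin 4) : ∃ j c d : Fin 4, j ≠ i ∧ c ≠ i ∧ d ≠ i ∧ c ≠ j ∧ d ≠ j ∧
    univ.erase i = {j, c, d} ∧ j ∉ ({c, d} : Finset (Fin 4)) ∧ c ≠ d ∧
    ∀ v : Fin 4 → ℂ, awValue q v = 2 * qPochInf q (v i * v j * (v c * v d)) /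
      (qPochInf q q * (qPochInf q (v i * v j) * qPochInf q (v i * v c) * qPochInf q (v i * v d) *
        qPochInf q (v j * v c) * qPochInf q (v j * v d) * qPochInf q (v c * v d))) := by
  fin_cases i
  · refine ⟨1, 2, 3, by decide, by decide, by decide, by decide, by decide, by decide, by decide,
      by decide, fun v => ?_⟩
    simp only [awValue, Fin.zero_eta, Fin.isValue, ← mul_assoc]
  · refine ⟨0, 2, 3, by decide, by decide, by decide, by decide, by decide, by decide, by decide,
      by decide, fun v => ?_⟩
    simp only [awValue, Fin.mk_one, Fin.isValue]
    rw [mul_comm (v 1) (v 0), ← mul_assoc]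
    ring_nf
  · refine ⟨0, 1, 3, by decide, by decide, by decide, by decide, by decide, by decide, by decide,
      by decide, fun v => ?_⟩
    simp only [awValue, Fin.reduceFinMk, Fin.isValue]
    rw [mul_comm (v 2) (v 0), mul_comm (v 2) (v 1),
      show v 0 * v 2 * (v 1 * v 3) = v 0 * v 1 * v 2 * v 3 by ring]
    ring_nf
  · refine ⟨0, 1, 2, by decide, by decide, by decide, by decide, by decide, by decide, by decide,
      by decide, fun v => ?_⟩
    simp only [awValue, Fin.reduceFinMk, Fin.isValue]
    rw [mul_comm (v 3) (v 0), mul_comm (v 3) (v 1), mul_comm (v 3) (v 2),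
      show v 0 * v 3 * (v 1 * v 2) = v 0 * v 1 * v 2 * v 3 by ring]
    ring_nf

lemma pairPoch_swap (hq0 : 0 < q) (hq1 : q < 1) {a z : ℂ} (ha : a ≠ 0) (hz : z ≠ 0) :
    pairPoch q (a * q) z * pairPoch q a⁻¹ z =
      (a ^ 2)⁻¹ * (pairPoch q a z * pairPoch q (a⁻¹ * q) z) := by
  rw [pairPoch_eq hq0 hq1 a z, pairPoch_eq hq0 hq1 a⁻¹ z]
  field_simp
  ring

/-- The evaluation when only `v_i = a` lies outside the unit circle and `v_j = q / a`: the weight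
is `a⁻²` times the one with `(a, q / a)` replaced by `(aq, 1 / a)`, for which the cycle contains
one pole less, so that the residue at `a` accounts for the difference. -/
lemma awDefect_inverse_pair (hq0 : 0 < q) (hq1 : q < 1) {v : Fin 4 → ℂ} (hv : AWGeneric q v)
    {i j c d : Fin 4} (hji : j ≠ i) (hci : c ≠ i) (hdi : d ≠ i) (hcj : c ≠ j) (hdj : d ≠ j)
    (her : univ.erase i = {j, c, d}) (hjcd : j ∉ ({c, d} : Finset (Fin 4))) (hcd : c ≠ d)
    (hval : ∀ v : Fin 4 → ℂ, awValue q v = 2 * qPochInf q (v i * v j * (v c * v d)) /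
      (qPochInf q q * (qPochInf q (v i * v j) * qPochInf q (v i * v c) * qPochInf q (v i * v d) *
        qPochInf q (v j * v c) * qPochInf q (v j * v d) * qPochInf q (v c * v d))))
    (hlt : ∀ l, l ≠ i → ‖v l‖ < 1) (hi : 1 < ‖v i‖) :
    awDefect q (Function.update v j ((v i)⁻¹ * q)) = (v i ^ 2)⁻¹ *
      awDefect q (Function.update (Function.update v i (v i * q)) j (v i)⁻¹) := by
  set a := v i with ha
  have ha0 : a ≠ 0 := by rintro h; rw [h] at hi; simp at hi; linarith
  set w := Function.update v j (a⁻¹ * q) with hw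
  set u := Function.update (Function.update v i (a * q)) j a⁻¹ with hu
  have wi : w i = a := Function.update_of_ne hji.symm _ _
  have wj : w j = a⁻¹ * q := Function.update_self ..
  have wc : w c = v c := Function.update_of_ne hcj _ _
  have wd : w d = v d := Function.update_of_ne hdj _ _
  have ui : u i = a * q := by rw [hu, Function.update_of_ne hji.symm, Function.update_self]
  have uj : u j = a⁻¹ := Function.update_self ..
  have uc : u c = v c := by rw [hu, Function.update_of_ne hcj, Function.update_of_ne hci]
  have ud : u d = v d := by rw [hu, Function.update_of_ne hdj, Function.update_of_ne hdi]
  have hcases : ∀ l, l ≠ i → l = j ∨ l = c ∨ l = d := fun l hl => by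
    have : l ∈ univ.erase i := mem_erase.2 ⟨hl, mem_univ _⟩
    rw [her] at this; simpa using this
  have hainv : ‖a⁻¹‖ < 1 := by rw [norm_inv]; exact inv_lt_one_of_one_lt₀ hi
  have hqn : ‖(q : ℂ)‖ < 1 := by rwa [Complex.norm_of_nonneg hq0.le]
  have hwlt : ∀ l, l ≠ i → ‖w l‖ < 1 := fun l hl => by
    rcases hcases l hl with rfl | rfl | rfl
    · rw [wj]; exact norm_mul_lt_one hainv hqn.le
    · rw [wc]; exact hlt _ hci
    · rw [wd]; exact hlt _ hdi
  have hult : ∀ l, l ≠ i → ‖u l‖ < 1 := fun l hl => by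
    rcases hcases l hl with rfl | rfl | rfl
    · rw [uj]; exact hainv
    · rw [uc]; exact hlt _ hci
    · rw [ud]; exact hlt _ hdi
  have hprod : ∀ (x : Fin 4 → ℂ) (z : ℂ), ∏ l ∈ univ.erase i, pairPoch q (x l) z =
      pairPoch q (x j) z * (pairPoch q (x c) z * pairPoch q (x d) z) := fun x z => by
    rw [her, prod_insert hjcd, prod_pair hcd]
  have hW : ∀ z : ℂ, z ≠ 0 → awWeight q w z = (a ^ 2)⁻¹ * awWeight q u z := fun z hz => by
    rw [awWeight, awWeight, ← mul_prod_erase univ _ (mem_univ i),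
      ← mul_prod_erase univ _ (mem_univ i), hprod, hprod, wi, wj, wc, wd, ui, uj, uc, ud,
      ← mul_assoc, ← mul_assoc (pairPoch q (a * q) z), pairPoch_swap hq0 hq1 ha0 hz]
    simp only [div_eq_mul_inv, mul_inv, inv_inv]
    field_simp
  have hcof : ∀ k (z : ℂ), z ≠ 0 →
      awCofactor q w i (k + 1) z = (a ^ 2)⁻¹ * awCofactor q u i k z := fun k z hz => by
    rw [awCofactor, awCofactor, hprod, hprod, wi, wj, wc, wd, ui, uj, uc, ud,
      qPochInf_eq_mul hq0 hq1 (a * z), qPoch_succ' (a * z⁻¹), pairPoch_eq hq0 hq1 a⁻¹ z,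
      show a * q * z = a * z * q by ring, show a * q * z⁻¹ = a * z⁻¹ * q by ring,
      show a * z⁻¹ * q * (q : ℂ) ^ (k + 1) = a * z⁻¹ * (q : ℂ) ^ (k + 1 + 1) by ring]
    have e : (1 - a⁻¹ * z) * (1 - a⁻¹ * z⁻¹) = (a ^ 2)⁻¹ * ((1 - a * z) * (1 - a * z⁻¹)) := by
      field_simp; ring
    rw [e]
    simp only [div_eq_mul_inv, mul_inv, inv_inv]
    field_simp
  have hJ : awFunctional q w (fun _ => 1) = (a ^ 2)⁻¹ * awFunctional q u (fun _ => 1) +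
      2 * awCofactor q w i 0 a := by
    rw [awFunctional_of_single hq0 hq1 hwlt, awFunctional_of_single hq0 hq1 hult, wi, ui,
      outCount_mul hq0 hq1]
    obtain ⟨m, hm⟩ : ∃ m, outCount q a = m + 1 :=
      ⟨_, (Nat.succ_pred_eq_of_pos (outCount_pos hq0 hq1 hi)).symm⟩
    have hI : (∮ z in C(0, 1), z⁻¹ * (awWeight q w z * 1)) =
        (a ^ 2)⁻¹ * ∮ z in C(0, 1), z⁻¹ * (awWeight q u z * 1) := by
      rw [← circleIntegral.integral_const_mul]
      refine circleIntegral.integral_congr zero_le_one fun z hz => ?_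
      simp only [hW z (ne_zero_of_mem_unitSphere hz)]
      ring
    have hS : ∑ k ∈ range m, awCofactor q w i (k + 1) (a * (q : ℂ) ^ (k + 1)) * (1 + 1) =
        (a ^ 2)⁻¹ * ∑ k ∈ range m, awCofactor q u i k (a * q * (q : ℂ) ^ k) * (1 + 1) := by
      rw [mul_sum]
      refine sum_congr rfl fun k _ => ?_
      rw [hcof k _ (mul_ne_zero ha0 (pow_ne_zero _ (qC_ne_zero hq0))), pow_succ', ← mul_assoc]
      ring_nf
    rw [hm, sum_range_succ', hS, hI, Nat.add_sub_cancel, pow_zero, mul_one]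
    ring
  have hA : awValue q w = (a ^ 2)⁻¹ * awValue q u + 2 * awCofactor q w i 0 a := by
    have nz : ∀ x : ℂ, ‖x‖ < 1 → qPochInf q x ≠ 0 := fun x => qPochInf_ne_zero_of_norm_lt hq0 hq1
    have nsub : ∀ x : ℂ, x ≠ 1 → 1 - x ≠ 0 := fun x hx => sub_ne_zero.2 hx.symm
    have ne1 : ∀ x : ℂ, ‖x‖ < 1 → x ≠ 1 := fun x hx h => by rw [h, norm_one] at hx; linarith
    have hc1 : ‖v c‖ < 1 := hlt c hci
    have hd1 : ‖v d‖ < 1 := hlt d hdi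
    have hgen : ∀ l (k : ℕ), a * v l * (q : ℂ) ^ k ≠ 1 := hv.mul_mul_pow_ne_one hq0 i
    have hgenq : ∀ l, qPochInf q (a * v l * q) ≠ 0 := fun l =>
      qPochInf_ne_zero hq0 hq1 fun k h => hgen l (k + 1) (by rw [← h]; ring)
    have hca : ‖a⁻¹ * v c‖ < 1 := norm_mul_lt_one hainv hc1.le
    have hda : ‖a⁻¹ * v d‖ < 1 := norm_mul_lt_one hainv hd1.le
    have hcd1 : ‖v c * v d‖ < 1 := norm_mul_lt_one hc1 hd1.le
    have e0 : awCofactor q w i 0 a = (1 - (a ^ 2)⁻¹) / (qPochInf q q ^ 2 *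
        (qPochInf q (a * v c) * qPochInf q (a⁻¹ * v c) * (qPochInf q (a * v d) *
          qPochInf q (a⁻¹ * v d)))) := by
      have n1 : qPochInf q (a ^ 2) ≠ 0 := qPochInf_ne_zero hq0 hq1 fun k => by
        rw [pow_two]; exact hgen i k
      have n2 : qPochInf q ((a ^ 2)⁻¹ * q) ≠ 0 := nz _ (norm_mul_lt_one (by
        rw [← inv_pow, norm_pow]; exact pow_lt_one₀ (norm_nonneg _) hainv two_ne_zero) hqn.le)
      rw [awCofactor, hprod, wi, wj, wc, wd, awNum, qPoch_zero,
        show a ^ (-2 : ℤ) = (a ^ 2)⁻¹ by rw [zpow_neg]; norm_cast,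
        qPochInf_eq_mul hq0 hq1 (a ^ 2)⁻¹, pairPoch, pairPoch, pairPoch,
        show a * a = a ^ 2 by ring, show a⁻¹ * q * a = q by field_simp,
        show a * a⁻¹ * (q : ℂ) ^ (0 + 1) = q by rw [zero_add, pow_one]; field_simp,
        show a⁻¹ * q * a⁻¹ = (a ^ 2)⁻¹ * q by field_simp, mul_comm (v c) a, mul_comm (v d) a,
        mul_comm (v c) a⁻¹, mul_comm (v d) a⁻¹]
      rw [show ∀ A B C D E : ℂ, A * 1 * B * (B * C * (D * E)) = (A * C) * (B ^ 2 * (D * E)) by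
        intros; ring, show ∀ A B C : ℂ, A * (B * C) = (A * C) * B by intros; ring,
        mul_div_mul_left _ _ (mul_ne_zero n1 n2)]
    rw [hval, hval, e0, wi, wj, wc, wd, ui, uj, uc, ud,
      show a * (a⁻¹ * q) = q by field_simp, show a * q * a⁻¹ = q by field_simp,
      show a⁻¹ * q * v c = a⁻¹ * v c * q by ring, show a⁻¹ * q * v d = a⁻¹ * v d * q by ring,
      show a * q * v c = a * v c * q by ring, show a * q * v d = a * v d * q by ring,
      show q * (v c * v d) = v c * v d * q by ring,
      qPochInf_eq_mul hq0 hq1 (v c * v d), qPochInf_eq_mul hq0 hq1 (a * v c),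
      qPochInf_eq_mul hq0 hq1 (a * v d), qPochInf_eq_mul hq0 hq1 (a⁻¹ * v c),
      qPochInf_eq_mul hq0 hq1 (a⁻¹ * v d)]
    have m1 := nsub _ (by simpa using hgen c 0)
    have m2 := nsub _ (by simpa using hgen d 0)
    have m3 := nsub _ (ne1 _ hca)
    have m4 := nsub _ (ne1 _ hda)
    have m5 := nsub _ (ne1 _ hcd1)
    have k1 := hgenq c
    have k2 := hgenq d
    have k3 := nz _ (norm_mul_lt_one hca hqn.le)
    have k4 := nz _ (norm_mul_lt_one hda hqn.le)
    have k5 := nz _ (norm_mul_lt_one hcd1 hqn.le)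
    have k6 := nz _ hqn
    generalize qPochInf q (a * v c * q) = K1 at *
    generalize qPochInf q (a * v d * q) = K2 at *
    generalize qPochInf q (a⁻¹ * v c * q) = K3 at *
    generalize qPochInf q (a⁻¹ * v d * q) = K4 at *
    generalize qPochInf q (v c * v d * q) = K5 at *
    generalize qPochInf q (q : ℂ) = K6 at *
    have m3' : a - v c ≠ 0 := fun h => m3 (by rw [← sub_eq_zero.1 h]; field_simp; simp)
    have m4' : a - v d ≠ 0 := fun h => m4 (by rw [← sub_eq_zero.1 h]; field_simp; simp)
    rw [show 1 - a⁻¹ * v c = (a - v c) / a by field_simp,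
      show 1 - a⁻¹ * v d = (a - v d) / a by field_simp]
    generalize v c = x at *
    generalize v d = y at *
    generalize h1 : 1 - a * x = M1 at *
    generalize h2 : 1 - a * y = M2 at *
    generalize h3 : a - x = M3 at *
    generalize h4 : a - y = M4 at *
    generalize h5 : 1 - x * y = M5 at *
    clear * - m1 m2 m3' m4' m5 k1 k2 k3 k4 k5 k6 ha0 h1 h2 h3 h4 h5
    field_simp
    rw [← h1, ← h2, ← h3, ← h4, ← h5]
    ring
  rw [awDefect, awDefect, hJ, hA]
  ring

end DeformedCycle

section DeformedCycleValue

variable {q : ℝ}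

lemma ne_one_of_norm_lt {x : ℂ} (hx : ‖x‖ < 1) : x ≠ 1 := by
  rintro rfl; simp at hx

/-- If only `v_i = a` lies outside the unit circle and the evaluation is known after the shift
`a ↦ aq`, then the defect, as a function of another parameter `b`, is a constant divided by
`(b/a, ab; q)_∞`. -/
lemma awDefect_mul_eq (hq0 : 0 < q) (hq1 : q < 1) {v : Fin 4 → ℂ} (hv : AWGeneric q v)
    {i j : Fin 4} (hij : i ≠ j) (hlt : ∀ l, l ≠ i → ‖v l‖ < 1) (hi : 1 < ‖v i‖)
    {b : ℂ} (hb : ‖b‖ < 1) (hab : ∀ k : ℕ, v i * b * (q : ℂ) ^ k ≠ 1)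
    (hprod : ‖∏ l, Function.update v j b l‖ < 1)
    (ih : ∀ n : ℕ, awDefect q (Function.update (Function.update v j (b * (q : ℂ) ^ n)) i
      (v i * q)) = 0) :
    qPochInf q ((v i)⁻¹ * b) * qPochInf q (v i * b) * awDefect q (Function.update v j b) =
      awDefect q (Function.update v j 0) := by
  have hi0 : v i ≠ 0 := by rintro h; rw [h] at hi; simp at hi; linarith
  have hqn : ∀ n : ℕ, ‖(q : ℂ) ^ n‖ ≤ 1 := fun n => by
    rw [norm_qpow hq0]; exact pow_le_one₀ hq0.le hq1.le
  have step : ∀ n : ℕ, awDefect q (Function.update v j (b * (q : ℂ) ^ n)) =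
      qPoch q ((v i)⁻¹ * b) n * qPoch q (v i * b) n * awDefect q (Function.update v j b) := by
    intro n
    induction n with
    | zero => simp [qPoch_zero]
    | succ n hn =>
      set w := Function.update v j (b * (q : ℂ) ^ n) with hw
      have wi : w i = v i := Function.update_of_ne hij _ _
      have wj : w j = b * (q : ℂ) ^ n := Function.update_self ..
      have hgw : AWGeneric q w := hv.update_of_norm_lt hq0 hq1 hij hlt
        (norm_mul_lt_one hb (hqn n)) fun k h => hab (n + k) (by rw [← h, pow_add]; ring)
      have hpw : w 0 * w 1 * w 2 * w 3 ≠ 1 := by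
        refine ne_one_of_norm_lt ?_
        have e : w 0 * w 1 * w 2 * w 3 = (∏ l, Function.update v j b l) * (q : ℂ) ^ n := by
          have := prod_update_of_mem (mem_univ j) v
          rw [this, ← Fin.prod_univ_four, hw, this]; ring
        rw [e]
        exact norm_mul_lt_one hprod (hqn n)
      have h := awDefect_two_shifts hq0 hq1 hgw hpw hij
      rw [wi, wj, ih n, mul_zero, zero_sub, hw, Function.update_idem, ← hw, hn] at h
      rw [qPoch_succ, qPoch_succ, pow_succ, ← mul_assoc]
      refine mul_left_cancel₀ hi0 ?_
      linear_combination h + (qPoch q ((v i)⁻¹ * b) n * qPoch q (v i * b) n *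
        awDefect q (Function.update v j b) * (1 - v i * b * (q : ℂ) ^ n) * b * (q : ℂ) ^ n) *
        mul_inv_cancel₀ hi0
  have h1 := tendsto_awDefect_update hq0 hq1 hv hij hlt hb
  simp_rw [step] at h1
  have h2 := ((tendsto_qPoch hq0 hq1 ((v i)⁻¹ * b)).mul
    (tendsto_qPoch hq0 hq1 (v i * b))).mul_const (awDefect q (Function.update v j b))
  exact tendsto_nhds_unique h2 h1

/-- The defect vanishes, by induction on the number `N` of points `v_i q^k` outside the unit circle.
If two parameters lie outside, `awDefect_two_shifts` reduces to smaller `N`. If only `v_i` does, the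
defect depends on a further parameter `b = v_j` through an explicit factor (`awDefect_mul_eq`), and
its constant is found from the value `b = q / v_i` by `awDefect_inverse_pair`. -/
theorem awDefect_eq_zero (hq0 : 0 < q) (hq1 : q < 1) (N : ℕ) : ∀ v : Fin 4 → ℂ,
    AWGeneric q v → ‖∏ l, v l‖ < 1 → ∑ l, outCount q (v l) = N → awDefect q v = 0 := by
  have hqn : ‖(q : ℂ)‖ < 1 := by rwa [Complex.norm_of_nonneg hq0.le]
  induction N using Nat.strong_induction_on with
  | _ N IH =>
  intro v hv hprod hN
  by_cases hall : ∀ l, ‖v l‖ < 1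
  · rw [awDefect, awFunctional_eq_awValue_of_norm_lt hq0 hq1 hall, sub_self]
  push Not at hall
  obtain ⟨i, hi⟩ := hall
  have hi : 1 < ‖v i‖ := lt_of_le_of_ne hi (hv.norm_ne_one i).symm
  have hi0 : v i ≠ 0 := by rintro h; rw [h] at hi; simp at hi; linarith
  -- The evaluation holds after a shift of a parameter outside the unit circle.
  have hshift : ∀ w : Fin 4 → ℂ, AWGeneric q w → ‖∏ l, w l‖ < 1 → ∑ l, outCount q (w l) ≤ N →
      ∀ l, 1 < ‖w l‖ → awDefect q (Function.update w l (w l * q)) = 0 := by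
    intro w hw hwp hwN l hl
    refine IH _ ?_ _ (hw.update hq0 l) ?_ rfl
    · have h1 := outCount_pos hq0 hq1 hl
      rw [← add_sum_erase univ _ (mem_univ l)] at hwN ⊢
      rw [Function.update_self, outCount_mul hq0 hq1]
      have : ∑ x ∈ univ.erase l, outCount q (Function.update w l (w l * q) x) =
          ∑ x ∈ univ.erase l, outCount q (w x) :=
        sum_congr rfl fun x hx => by rw [Function.update_of_ne (ne_of_mem_erase hx)]
      omega
    · have : ∏ x, Function.update w l (w l * q) x = (∏ x, w x) * q := by
        rw [prod_update_of_mem (mem_univ l), ← mul_prod_erase univ w (mem_univ l),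
          sdiff_singleton_eq_erase]
        ring
      rw [this]
      exact norm_mul_lt_one hwp hqn.le
  have h4 : v 0 * v 1 * v 2 * v 3 ≠ 1 := by
    rw [← Fin.prod_univ_four]; exact ne_one_of_norm_lt hprod
  -- If a second parameter lies outside, both shifts in `awDefect_two_shifts` are known to vanish.
  by_cases hex : ∃ j, j ≠ i ∧ 1 < ‖v j‖
  · obtain ⟨j, hji, hj⟩ := hex
    have h := awDefect_two_shifts hq0 hq1 hv h4 hji.symm
    rw [hshift v hv hprod hN.le i hi, hshift v hv hprod hN.le j hj, mul_zero, mul_zero,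
      sub_zero, mul_eq_zero, mul_eq_zero] at h
    rcases h with (h | h) | h
    · exact absurd (hv.2.1 j i 0 0 (by simpa using hj) (by simpa using sub_eq_zero.1 h)) hji
    · exact absurd (sub_eq_zero.1 h).symm (by simpa using hv.mul_mul_pow_ne_one hq0 i j 0)
    · exact h
  push Not at hex
  have hlt : ∀ l, l ≠ i → ‖v l‖ < 1 := fun l hl => lt_of_le_of_ne (hex l hl) (hv.norm_ne_one l)
  obtain ⟨j, c, d, hji, hci, hdi, hcj, hdj, her, hjcd, hcd, hval⟩ := exists_frame (q := q) i
  have hainv : ‖(v i)⁻¹‖ < 1 := by rw [norm_inv]; exact inv_lt_one_of_one_lt₀ hi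
  have hne : ∀ m : ℕ, 0 < m → (q : ℂ) ^ m ≠ 1 := fun m hm => ne_one_of_norm_lt (by
    rw [norm_qpow hq0]; exact pow_lt_one₀ hq0.le hq1 hm.ne')
  have hcd1 : ‖v c * v d‖ < 1 := norm_mul_lt_one (hlt c hci) (hlt d hdi).le
  have hprod_upd : ∀ b : ℂ, ∏ l, Function.update v j b l = b * v i * (v c * v d) := by
    intro b
    rw [← mul_prod_erase univ _ (mem_univ i), her, prod_insert hjcd, prod_pair hcd,
      Function.update_self, Function.update_of_ne hji.symm, Function.update_of_ne hcj,
      Function.update_of_ne hdj]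
    ring
  have hcount : ∀ b : ℂ, ‖b‖ < 1 → ∑ l, outCount q (Function.update v j b l) ≤ N := by
    intro b hb
    rw [← hN]
    refine sum_le_sum fun l _ => ?_
    by_cases h : l = j
    · subst h; rw [Function.update_self, outCount_eq_zero hq0 hq1 hb.le]; exact Nat.zero_le _
    · rw [Function.update_of_ne h]
  have hqn' : ∀ n : ℕ, ‖(q : ℂ) ^ n‖ ≤ 1 := fun n => by
    rw [norm_qpow hq0]; exact pow_le_one₀ hq0.le hq1.le
  -- The dependence of the defect on another parameter `b`.
  have hchain : ∀ b : ℂ, ‖b‖ < 1 → (∀ k : ℕ, v i * b * (q : ℂ) ^ k ≠ 1) →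
      ‖∏ l, Function.update v j b l‖ < 1 →
      qPochInf q ((v i)⁻¹ * b) * qPochInf q (v i * b) * awDefect q (Function.update v j b) =
        awDefect q (Function.update v j 0) := by
    intro b hb hab hp
    refine awDefect_mul_eq hq0 hq1 hv hji.symm hlt hi hb hab hp fun n => ?_
    have hbn : ‖b * (q : ℂ) ^ n‖ < 1 := norm_mul_lt_one hb (hqn' n)
    have := hshift (Function.update v j (b * (q : ℂ) ^ n))
      (hv.update_of_norm_lt hq0 hq1 hji.symm hlt hbn fun k h =>
        hab (n + k) (by rw [← h, pow_add]; ring))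
      (by
        rw [hprod_upd] at hp ⊢
        rw [show b * (q : ℂ) ^ n * v i * (v c * v d) = b * v i * (v c * v d) * (q : ℂ) ^ n by ring]
        exact norm_mul_lt_one hp (hqn' n)) (hcount _ hbn) i
      (by rwa [Function.update_of_ne hji.symm])
    rwa [Function.update_of_ne hji.symm] at this
  -- The special value `b = q / a` shows that the constant vanishes.
  have hzero : awDefect q (Function.update v j 0) = 0 := by
    have hb : ‖(v i)⁻¹ * q‖ < 1 := norm_mul_lt_one hainv hqn.le
    rw [← hchain ((v i)⁻¹ * q) hb (fun k => by
        rw [← mul_assoc, mul_inv_cancel₀ hi0, one_mul, ← pow_succ']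
        exact hne _ k.succ_pos) (by
        rw [hprod_upd, show (v i)⁻¹ * q * v i = (q : ℂ) by field_simp]
        exact norm_mul_lt_one hqn hcd1.le),
      awDefect_inverse_pair hq0 hq1 hv hji hci hdi hcj hdj her hjcd hcd hval hlt hi]
    set v' := Function.update v i (v i * q) with hv'
    have v'i : v' i = v i * q := Function.update_self ..
    have hlt' : ∀ l, l ≠ i → ‖v' l‖ < 1 := fun l hl => by
      rw [hv', Function.update_of_ne hl]; exact hlt l hl
    have : awDefect q (Function.update v' j (v i)⁻¹) = 0 := by
      refine IH _ ?_ _ ((hv.update hq0 i).update_of_norm_lt hq0 hq1 hji.symm hlt' hainv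
        fun k => ?_) ?_ rfl
      · rw [← hN]
        refine sum_lt_sum (fun l _ => ?_) ⟨i, mem_univ _, ?_⟩
        · by_cases h : l = j
          · subst h; rw [Function.update_self, outCount_eq_zero hq0 hq1 hainv.le]
            exact Nat.zero_le _
          · rw [Function.update_of_ne h]
            by_cases h' : l = i
            · subst h'; rw [v'i, outCount_mul hq0 hq1]; omega
            · rw [hv', Function.update_of_ne h']
        · rw [Function.update_of_ne hji.symm, v'i, outCount_mul hq0 hq1]
          have := outCount_pos hq0 hq1 hi
          omega
      · rw [← hv', v'i, show v i * q * (v i)⁻¹ = (q : ℂ) by field_simp, ← pow_succ']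
        exact hne _ k.succ_pos
      · have e : ∏ l, Function.update v' j (v i)⁻¹ l = q * (v c * v d) := by
          rw [← mul_prod_erase univ _ (mem_univ i), her, prod_insert hjcd, prod_pair hcd,
            Function.update_self, Function.update_of_ne hji.symm, Function.update_of_ne hcj,
            Function.update_of_ne hdj, v'i, hv', Function.update_of_ne hci,
            Function.update_of_ne hdi]
          field_simp
        rw [e]
        exact norm_mul_lt_one hqn hcd1.le
    rw [this, mul_zero, mul_zero]
  have hlast := hchain (v j) (hlt j hji) (hv.mul_mul_pow_ne_one hq0 i j)
    (by rw [Function.update_eq_self]; exact hprod)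
  rw [hzero, Function.update_eq_self, mul_eq_zero, mul_eq_zero] at hlast
  rcases hlast with (h | h) | h
  · exact absurd h (qPochInf_ne_zero_of_norm_lt hq0 hq1 (norm_mul_lt_one hainv (hlt j hji).le))
  · exact absurd h (qPochInf_ne_zero hq0 hq1 (hv.mul_mul_pow_ne_one hq0 i j))
  · exact h

/-- The Askey–Wilson integral over the deformed cycle. -/
theorem awFunctional_eq_awValue (hq0 : 0 < q) (hq1 : q < 1) {v : Fin 4 → ℂ}
    (hv : AWGeneric q v) (hprod : ‖∏ l, v l‖ < 1) :
    awFunctional q v (fun _ => 1) = awValue q v :=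
  sub_eq_zero.1 (awDefect_eq_zero hq0 hq1 _ v hv hprod rfl)

end DeformedCycleValue

/-! ### The cycle integral and its action on shifted factorials -/

section Cycle

variable {q : ℝ}

/-- The integral over a small circle around a simple pole is `2πi` times the residue. -/
lemma eventually_circleIntegral_eq {F H : ℂ → ℂ} {p : ℂ}
    (hH : ∀ᶠ z in 𝓝 p, DifferentiableAt ℂ H z)
    (hF : ∀ᶠ z in 𝓝 p, z ≠ p → F z = (z - p)⁻¹ * H z) :
    ∀ᶠ ε in 𝓝[>] (0 : ℝ), (∮ z in C(p, ε), F z) = 2 * (Real.pi : ℂ) * Complex.I * H p := by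
  obtain ⟨δ, hδ, hball⟩ := Metric.eventually_nhds_iff_ball.1 (hH.and hF)
  filter_upwards [Ioo_mem_nhdsGT hδ] with ε hε
  have h1 : (∮ z in C(p, ε), F z) = ∮ z in C(p, ε), (z - p)⁻¹ • H z := by
    refine circleIntegral.integral_congr hε.1.le fun z hz => ?_
    have hd : dist z p = ε := hz
    refine (hball z (by rw [Metric.mem_ball, hd]; exact hε.2)).2 ?_
    rintro rfl
    rw [dist_self] at hd
    exact hε.1.ne hd
  rw [h1, DifferentiableOn.circleIntegral_sub_inv_smul (f := H) (R := ε) (c := p) (w := p)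
    (fun z hz => (hball z (lt_of_le_of_lt hz hε.2)).1.differentiableWithinAt)
    (Metric.mem_ball_self hε.1)]
  simp [smul_eq_mul]

lemma differentiableAt_awNum (hq0 : 0 < q) (hq1 : q < 1) {z : ℂ} (hz : z ≠ 0) :
    DifferentiableAt ℂ (awNum q) z := by
  have hd := differentiable_qPochInf hq0 hq1
  exact ((hd _).comp z (f := fun z : ℂ => z ^ 2) (by fun_prop)).mul
    ((hd _).comp z (f := fun z : ℂ => z ^ (-2 : ℤ)) (differentiableAt_zpow.2 (Or.inl hz)))

/-- The denominator of the cofactor of a pole. -/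
def cofactorDenom (q : ℝ) (v : Fin 4 → ℂ) (i : Fin 4) (k : ℕ) (z : ℂ) : ℂ :=
  qPochInf q (v i * z) * qPoch q (v i * z⁻¹) k *
    qPochInf q (v i * z⁻¹ * (q : ℂ) ^ (k + 1)) * ∏ j ∈ univ.erase i, pairPoch q (v j) z

lemma differentiableAt_cofactorDenom (hq0 : 0 < q) (hq1 : q < 1) (v : Fin 4 → ℂ) (i : Fin 4)
    (k : ℕ) {z : ℂ} (hz : z ≠ 0) : DifferentiableAt ℂ (cofactorDenom q v i k) z := by
  have hd := differentiable_qPochInf hq0 hq1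
  have hp := differentiable_qPoch (q := q) k
  have h1 : ∀ a : ℂ, DifferentiableAt ℂ (fun z => qPochInf q (a * z)) z := fun a =>
    (hd _).comp z (f := fun z => a * z) (by fun_prop)
  have h2 : ∀ a : ℂ, DifferentiableAt ℂ (fun z => a * z⁻¹) z := fun a =>
    (differentiableAt_inv hz).const_mul a
  have h3 : ∀ a : ℂ, DifferentiableAt ℂ (fun z => qPochInf q (a * z⁻¹)) z := fun a =>
    (hd _).comp z (f := fun z => a * z⁻¹) (h2 a)
  refine (((h1 _).mul ((hp _).comp z (f := fun z => v i * z⁻¹) (h2 _))).mul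
    ((hd _).comp z (f := fun z => v i * z⁻¹ * (q : ℂ) ^ (k + 1)) ((h2 _).mul_const _))).mul ?_
  exact DifferentiableAt.fun_finsetProd fun j _ => (h1 _).mul (h3 _)

lemma eventually_differentiableAt_awCofactor (hq0 : 0 < q) (hq1 : q < 1) {v : Fin 4 → ℂ}
    (hv : AWGeneric q v) {i : Fin 4} {k : ℕ} (hk : k < outCount q (v i)) :
    ∀ᶠ z in 𝓝 (v i * (q : ℂ) ^ k), DifferentiableAt ℂ (awCofactor q v i k) z := by
  have hp : v i * (q : ℂ) ^ k ≠ 0 :=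
    mul_ne_zero (ne_zero_of_lt_outCount hq0 hq1 hk) (pow_ne_zero k (qC_ne_zero hq0))
  filter_upwards [eventually_ne_nhds hp,
    (differentiableAt_cofactorDenom hq0 hq1 v i k hp).continuousAt.eventually_ne
      (hv.cofactor_denom_ne_zero hq0 hq1 hk)] with z hz hz'
  exact (differentiableAt_awNum hq0 hq1 hz).div (differentiableAt_cofactorDenom hq0 hq1 v i k hz)
    hz'

/-- The auxiliary circles of the cycle contribute residues: for all sufficiently small radii, the
cycle integral is the functional `awFunctional`. -/
theorem eventually_cycleIntegral_eq (hq0 : 0 < q) (hq1 : q < 1) {v : Fin 4 → ℂ}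
    (hv : AWGeneric q v) {φ : ℂ → ℂ} (hφ : ∀ z, z ≠ 0 → DifferentiableAt ℂ φ z) :
    ∀ᶠ ε in 𝓝[>] (0 : ℝ), (2 * (Real.pi : ℂ) * Complex.I)⁻¹ *
      cycleIntegral q v ε (fun x => x⁻¹ * (awWeight q v x * φ x)) = awFunctional q v φ := by
  have hone : ∀ i, ∀ k ∈ range (outCount q (v i)), ∀ᶠ ε in 𝓝[>] (0 : ℝ),
      (∮ x in C(v i * (q : ℂ) ^ k, ε), x⁻¹ * (awWeight q v x * φ x)) -
        (∮ x in C((v i)⁻¹ * ((q : ℂ) ^ k)⁻¹, ε), x⁻¹ * (awWeight q v x * φ x)) =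
      2 * (Real.pi : ℂ) * Complex.I * (awCofactor q v i k (v i * (q : ℂ) ^ k) *
        (φ (v i * (q : ℂ) ^ k) + φ (v i * (q : ℂ) ^ k)⁻¹)) := by
    intro i k hk
    have hk' := mem_range.1 hk
    set p := v i * (q : ℂ) ^ k with hp
    have hp0 : p ≠ 0 :=
      mul_ne_zero (ne_zero_of_lt_outCount hq0 hq1 hk') (pow_ne_zero k (qC_ne_zero hq0))
    have hinv : (v i)⁻¹ * ((q : ℂ) ^ k)⁻¹ = p⁻¹ := by rw [hp, mul_inv]
    have hK := eventually_differentiableAt_awCofactor hq0 hq1 hv hk'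
    rw [← hp] at hK
    have e1 := eventually_circleIntegral_eq (p := p)
      (F := fun x => x⁻¹ * (awWeight q v x * φ x)) (H := fun z => awCofactor q v i k z * φ z) (by
        filter_upwards [hK, eventually_ne_nhds hp0] with z h1 h2
        exact h1.mul (hφ z h2)) (by
        filter_upwards [eventually_ne_nhds hp0] with z h2 h3
        have h4 : z - p ≠ 0 := sub_ne_zero.2 h3
        rw [awWeight_eq_cofactor hq0 hq1 v i k z, ← hp,
          show 1 - p * z⁻¹ = (z - p) / z by field_simp]
        field_simp)
    -- Near `p⁻¹` the reflection `z ↦ z⁻¹` leads back to the cofactor at `p`.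
    have hpinv : Tendsto (fun z : ℂ => z⁻¹) (𝓝 p⁻¹) (𝓝 p) := by
      have := (continuousAt_inv₀ (inv_ne_zero hp0)).tendsto
      rwa [inv_inv] at this
    have e2 := eventually_circleIntegral_eq (p := p⁻¹)
      (F := fun x => x⁻¹ * (awWeight q v x * φ x))
      (H := fun z => -(awCofactor q v i k z⁻¹ * (p * z)⁻¹ * φ z)) (by
        filter_upwards [hpinv.eventually hK, eventually_ne_nhds (inv_ne_zero hp0)] with z h1 h2
        have h3 : DifferentiableAt ℂ (fun z => awCofactor q v i k z⁻¹) z :=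
          h1.comp z (f := fun z : ℂ => z⁻¹) (differentiableAt_inv h2)
        have h4 : DifferentiableAt ℂ (fun z : ℂ => (p * z)⁻¹) z :=
          DifferentiableAt.inv (by fun_prop) (mul_ne_zero hp0 h2)
        exact ((h3.mul h4).mul (hφ z h2)).neg) (by
        filter_upwards [eventually_ne_nhds (inv_ne_zero hp0)] with z h2 h3
        have h4 : z * p - 1 ≠ 0 := fun h => h3 (eq_inv_of_mul_eq_one_left (sub_eq_zero.1 h))
        rw [← awWeight_inv v z, awWeight_eq_cofactor hq0 hq1 v i k z⁻¹, ← hp, inv_inv,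
          show z - p⁻¹ = (z * p - 1) / p by field_simp,
          show 1 - p * z = -(z * p - 1) by ring]
        field_simp)
    filter_upwards [e1, e2] with ε h1 h2
    rw [h1, hinv, h2, inv_inv, mul_inv_cancel₀ hp0]
    ring
  have hall : ∀ᶠ ε in 𝓝[>] (0 : ℝ), ∀ i, ∀ k ∈ range (outCount q (v i)),
      (∮ x in C(v i * (q : ℂ) ^ k, ε), x⁻¹ * (awWeight q v x * φ x)) -
        (∮ x in C((v i)⁻¹ * ((q : ℂ) ^ k)⁻¹, ε), x⁻¹ * (awWeight q v x * φ x)) =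
      2 * (Real.pi : ℂ) * Complex.I * (awCofactor q v i k (v i * (q : ℂ) ^ k) *
        (φ (v i * (q : ℂ) ^ k) + φ (v i * (q : ℂ) ^ k)⁻¹)) :=
    eventually_all.2 fun i => (eventually_all_finset _).2 (hone i)
  filter_upwards [hall] with ε hε
  have hsum : ∀ i, (∑ᶠ (k : ℕ) (_ : 1 < ‖v i‖ * q ^ k),
      ((∮ x in C(v i * (q : ℂ) ^ k, ε), x⁻¹ * (awWeight q v x * φ x)) -
        (∮ x in C((v i)⁻¹ * ((q : ℂ) ^ k)⁻¹, ε), x⁻¹ * (awWeight q v x * φ x)))) =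
      ∑ k ∈ range (outCount q (v i)), 2 * (Real.pi : ℂ) * Complex.I *
        (awCofactor q v i k (v i * (q : ℂ) ^ k) *
        (φ (v i * (q : ℂ) ^ k) + φ (v i * (q : ℂ) ^ k)⁻¹)) := by
    intro i
    rw [← sum_congr rfl (hε i), ← finsum_mem_coe_finset]
    simp only [← lt_outCount_iff hq0 hq1, coe_range, Set.mem_Iio]
  rw [cycleIntegral, awFunctional]
  simp only [hsum, ← mul_sum]
  rw [mul_add, ← mul_assoc _ _ (∑ i, _), inv_mul_cancel₀ Complex.two_pi_I_ne_zero, one_mul]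

lemma awFunctional_congr (hq0 : 0 < q) (hq1 : q < 1) (v : Fin 4 → ℂ) {φ ψ : ℂ → ℂ}
    (h : ∀ z, z ≠ 0 → φ z = ψ z) : awFunctional q v φ = awFunctional q v ψ := by
  unfold awFunctional
  congr 1
  · congr 1
    refine circleIntegral.integral_congr zero_le_one fun z hz => ?_
    simp only [h z (ne_zero_of_mem_unitSphere hz)]
  · refine sum_congr rfl fun i _ => sum_congr rfl fun k hk => ?_
    have hp := mul_ne_zero (ne_zero_of_lt_outCount hq0 hq1 (mem_range.1 hk))
      (pow_ne_zero k (qC_ne_zero hq0))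
    rw [h _ hp, h _ (inv_ne_zero hp)]

/-- The integral of the shifted factorial `(v_l z, v_l z⁻¹; q)_k` is the integral of `1` with `v_l`
replaced by `v_l q^k`. -/
lemma awFunctional_qPoch (hq0 : 0 < q) (hq1 : q < 1) (l : Fin 4) (k : ℕ) {v : Fin 4 → ℂ}
    (hv : AWGeneric q v) :
    awFunctional q v (fun z => qPoch q (v l * z) k * qPoch q (v l * z⁻¹) k) =
      awFunctional q (Function.update v l (v l * (q : ℂ) ^ k)) (fun _ => 1) := by
  induction k generalizing v with
  | zero => simp [qPoch_zero]
  | succ k ih =>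
    have h := ih (hv.update hq0 l)
    rw [awFunctional_update hq0 hq1 hv, Function.update_idem, Function.update_self] at h
    rw [pow_succ', ← mul_assoc, ← h]
    congr 1
    funext z
    rw [qPoch_succ', qPoch_succ', show v l * z * q = v l * q * z by ring,
      show v l * z⁻¹ * q = v l * q * z⁻¹ by ring]
    ring

/-- The ratio of the values for the parameters `v₂ q^k` and `v₂`. -/
lemma awValue_update_pow (hq0 : 0 < q) (hq1 : q < 1) {v : Fin 4 → ℂ} (hv : AWGeneric q v)
    (hprod : ‖∏ l, v l‖ < 1) (k : ℕ) :
    awValue q (Function.update v 2 (v 2 * (q : ℂ) ^ k)) =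
      awValue q v * (qPoch q (v 2 * v 3) k / qPoch q (v 0 * v 1 * v 2 * v 3) k *
        (qPoch q (v 2 * v 0) k * qPoch q (v 2 * v 1) k)) := by
  have hP : ∀ i j, qPoch q (v i * v j) k ≠ 0 := fun i j =>
    qPoch_ne_zero fun l _ => hv.mul_mul_pow_ne_one hq0 i j l
  have h4 : qPoch q (v 0 * v 1 * v 2 * v 3) k ≠ 0 := qPoch_ne_zero fun l _ =>
    mul_qpow_ne_one hq0 hq1 (by rwa [← Fin.prod_univ_four]) l
  simp only [awValue, Fin.isValue, Function.update_self, ne_eq, Fin.reduceEq, not_false_eq_true,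
    Function.update_of_ne]
  rw [qPochInf_eq_qPoch_mul hq0 hq1 (v 0 * v 1 * v 2 * v 3) k,
    qPochInf_eq_qPoch_mul hq0 hq1 (v 0 * v 2) k, qPochInf_eq_qPoch_mul hq0 hq1 (v 1 * v 2) k,
    qPochInf_eq_qPoch_mul hq0 hq1 (v 2 * v 3) k, mul_comm (v 2) (v 0), mul_comm (v 2) (v 1),
    show v 0 * v 1 * (v 2 * (q : ℂ) ^ k) * v 3 = v 0 * v 1 * v 2 * v 3 * (q : ℂ) ^ k by ring,
    show v 0 * (v 2 * (q : ℂ) ^ k) = v 0 * v 2 * (q : ℂ) ^ k by ring,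
    show v 1 * (v 2 * (q : ℂ) ^ k) = v 1 * v 2 * (q : ℂ) ^ k by ring,
    show v 2 * (q : ℂ) ^ k * v 3 = v 2 * v 3 * (q : ℂ) ^ k by ring]
  have h02 := hP 0 2
  have h12 := hP 1 2
  have h23 := hP 2 3
  simp only [div_eq_mul_inv, mul_inv]
  field_simp

end Cycle

/-! ### The kernel and its action on shifted factorials -/

section Kernel

variable {q : ℝ}

/-- The factor of the kernel `𝓜_{αβ}(r, y | x)` that does not depend on `x`. -/
def kernelConst (q α β : ℝ) (r y : ℂ) : ℂ :=
  (1 - q : ℂ) * qPochInf q (q : ℂ) ^ 2 * qL q ((q ^ ((α + β) / 2) : ℝ) : ℂ) r y / (2 * qBeta q α β)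

/-- As a function of `x`, the kernel is a multiple of the Askey–Wilson weight. -/
lemma kernelM_eq (α β : ℝ) (r y x : ℂ) :
    kernelM q α β r y x = kernelConst q α β r y * awWeight q (awParams q α β r y) x := by
  have h : ∏ i, pairPoch q (awParams q α β r y i) x =
      qL q ((q ^ (α / 2) : ℝ) : ℂ) y x * qL q ((q ^ (β / 2) : ℝ) : ℂ) r x := by
    rw [Fin.prod_univ_four]
    simp only [awParams, Matrix.cons_val, pairPoch, qL]
    rw [mul_comm y, mul_comm y⁻¹, mul_comm r, mul_comm r⁻¹]
    ring
  rw [awWeight, h, kernelM, kernelConst, awNum, div_mul_div_comm]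
  congr 1 <;> ring

lemma rpow_half_mul_rpow_half (hq0 : 0 < q) (α β : ℝ) :
    ((q ^ (α / 2) : ℝ) : ℂ) * ((q ^ (β / 2) : ℝ) : ℂ) = ((q ^ ((α + β) / 2) : ℝ) : ℂ) := by
  rw [← Complex.ofReal_mul, ← Real.rpow_add hq0, add_div]

lemma rpow_half_mul_self (hq0 : 0 < q) (α : ℝ) :
    ((q ^ (α / 2) : ℝ) : ℂ) * ((q ^ (α / 2) : ℝ) : ℂ) = ((q ^ α : ℝ) : ℂ) := by
  rw [rpow_half_mul_rpow_half hq0]; norm_num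

section Params

variable (α β : ℝ) {r y : ℂ}

lemma awParams_mul_zero_one (hq0 : 0 < q) (hy : y ≠ 0) :
    awParams q α β r y 0 * awParams q α β r y 1 = ((q ^ α : ℝ) : ℂ) := by
  rw [← rpow_half_mul_self hq0]
  simp only [awParams, Matrix.cons_val]
  field_simp

lemma awParams_mul_two_three (hq0 : 0 < q) (hr : r ≠ 0) :
    awParams q α β r y 2 * awParams q α β r y 3 = ((q ^ β : ℝ) : ℂ) := by
  rw [← rpow_half_mul_self hq0]
  simp only [awParams, Matrix.cons_val]
  field_simp

lemma awParams_prod (hq0 : 0 < q) (hr : r ≠ 0) (hy : y ≠ 0) :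
    awParams q α β r y 0 * awParams q α β r y 1 * awParams q α β r y 2 * awParams q α β r y 3 =
      ((q ^ (α + β) : ℝ) : ℂ) := by
  rw [awParams_mul_zero_one α β hq0 hy, mul_assoc, awParams_mul_two_three α β hq0 hr,
    ← Complex.ofReal_mul, ← Real.rpow_add hq0]

lemma norm_rpow_lt_one (hq0 : 0 < q) (hq1 : q < 1) {s : ℝ} (hs : 0 < s) :
    ‖((q ^ s : ℝ) : ℂ)‖ < 1 := by
  rw [Complex.norm_real, Real.norm_of_nonneg (Real.rpow_nonneg hq0.le s)]
  exact Real.rpow_lt_one hq0.le hq1 hs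

lemma norm_prod_awParams_lt_one (hq0 : 0 < q) (hq1 : q < 1) (hr : r ≠ 0) (hy : y ≠ 0)
    (hαβ : 0 < α + β) : ‖∏ l, awParams q α β r y l‖ < 1 := by
  rw [Fin.prod_univ_four, awParams_prod α β hq0 hr hy]
  exact norm_rpow_lt_one hq0 hq1 hαβ

end Params

lemma qBeta_eq (hq1 : q < 1) (hQ : qPochInf q (q : ℂ) ≠ 0) (α β : ℝ) :
    qBeta q α β = qPochInf q (q : ℂ) * (1 - q : ℂ) * qPochInf q ((q ^ (α + β) : ℝ) : ℂ) /
      (qPochInf q ((q ^ α : ℝ) : ℂ) * qPochInf q ((q ^ β : ℝ) : ℂ)) := by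
  have h1 : (0 : ℝ) < 1 - q := by linarith
  have h2 : (1 - q) ^ (1 - α) * (1 - q) ^ (1 - β) = (1 - q) * (1 - q) ^ (1 - (α + β)) := by
    nth_rw 3 [← Real.rpow_one (1 - q)]
    rw [← Real.rpow_add h1, ← Real.rpow_add h1]
    congr 1; ring
  have h3 : (((1 - q) ^ (1 - (α + β)) : ℝ) : ℂ) ≠ 0 := by
    exact_mod_cast (Real.rpow_pos_of_pos h1 _).ne'
  have h4 : (((1 - q) ^ (1 - α) : ℝ) : ℂ) * (((1 - q) ^ (1 - β) : ℝ) : ℂ) =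
      (1 - q : ℂ) * (((1 - q) ^ (1 - (α + β)) : ℝ) : ℂ) := by exact_mod_cast h2
  unfold qBeta qGamma
  rw [show ∀ a b c d e f : ℂ, a / b * c * (d / e * f) = a * d / (b * e) * (c * f) by
    intros; simp only [div_eq_mul_inv, mul_inv]; ring, h4]
  simp only [div_eq_mul_inv, mul_inv, inv_inv]
  field_simp

/-- The normalisation of the kernel: it sends the constant function `1` to itself. -/
lemma kernelConst_mul_awValue (hq0 : 0 < q) (hq1 : q < 1) {α β : ℝ} {r y : ℂ}
    (hr : r ≠ 0) (hy : y ≠ 0) (hαβ : 0 < α + β) (hv : AWGeneric q (awParams q α β r y)) :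
    kernelConst q α β r y * awValue q (awParams q α β r y) = 1 := by
  have hQ : qPochInf q (q : ℂ) ≠ 0 :=
    qPochInf_ne_zero_of_norm_lt hq0 hq1 (by simpa [abs_of_pos hq0] using hq1)
  have hS : qPochInf q ((q ^ (α + β) : ℝ) : ℂ) ≠ 0 :=
    qPochInf_ne_zero_of_norm_lt hq0 hq1 (norm_rpow_lt_one hq0 hq1 hαβ)
  have hne : ∀ i j, qPochInf q (awParams q α β r y i * awParams q α β r y j) ≠ 0 := fun i j =>
    qPochInf_ne_zero hq0 hq1 fun k => hv.mul_mul_pow_ne_one hq0 i j k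
  have hA := hne 0 1
  have hB := hne 2 3
  rw [awParams_mul_zero_one α β hq0 hy] at hA
  rw [awParams_mul_two_three α β hq0 hr] at hB
  have hL : qL q ((q ^ ((α + β) / 2) : ℝ) : ℂ) r y =
      qPochInf q (awParams q α β r y 0 * awParams q α β r y 2) *
      qPochInf q (awParams q α β r y 0 * awParams q α β r y 3) *
      qPochInf q (awParams q α β r y 1 * awParams q α β r y 2) *
      qPochInf q (awParams q α β r y 1 * awParams q α β r y 3) := by
    have e : ∀ a b : ℂ, a * ((q ^ (α / 2) : ℝ) : ℂ) * (b * ((q ^ (β / 2) : ℝ) : ℂ)) =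
        ((q ^ ((α + β) / 2) : ℝ) : ℂ) * b * a := fun a b => by
      rw [← rpow_half_mul_rpow_half hq0]; ring
    simp only [awParams, Matrix.cons_val, qL, e]
    ring
  have hLne : qL q ((q ^ ((α + β) / 2) : ℝ) : ℂ) r y ≠ 0 := by
    rw [hL]
    exact mul_ne_zero (mul_ne_zero (mul_ne_zero (hne _ _) (hne _ _)) (hne _ _)) (hne _ _)
  have hq : (1 - q : ℂ) ≠ 0 := by
    have : (1 - q : ℝ) ≠ 0 := by linarith
    exact_mod_cast this
  have hV : awValue q (awParams q α β r y) = 2 * qPochInf q ((q ^ (α + β) : ℝ) : ℂ) /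
      (qPochInf q q * (qPochInf q ((q ^ α : ℝ) : ℂ) * qPochInf q ((q ^ β : ℝ) : ℂ) *
        qL q ((q ^ ((α + β) / 2) : ℝ) : ℂ) r y)) := by
    rw [awValue, awParams_prod α β hq0 hr hy, awParams_mul_zero_one α β hq0 hy,
      awParams_mul_two_three α β hq0 hr, hL]
    congr 2
    ring
  rw [hV, kernelConst, qBeta_eq hq1 hQ]
  field_simp

/-- The integral operator with kernel `𝓜_{αβ}` acts on the shifted factorials
`(cz, c z⁻¹; q)_k`, `c = r q^{β/2}`, by a shift of `c` to `r q^{(α+β)/2}`, up to a factor. -/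
theorem hasMValue_of_expansion (hq0 : 0 < q) (hq1 : q < 1) {α β : ℝ} {r y : ℂ}
    (hr : r ≠ 0) (hy : y ≠ 0) (hαβ : 0 < α + β) (hv : AWGeneric q (awParams q α β r y))
    {ι : Type*} (s : Finset ι) (e : ι → ℂ) (k : ι → ℕ) {φ : ℂ → ℂ} {c c' : ℂ}
    (hc : r * ((q ^ (β / 2) : ℝ) : ℂ) = c) (hc' : r * ((q ^ ((α + β) / 2) : ℝ) : ℂ) = c')
    (hφ : ∀ z, z ≠ 0 → φ z = ∑ i ∈ s, e i * (qPoch q (c * z) (k i) * qPoch q (c * z⁻¹) (k i))) :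
    HasMValue q α β r φ y (∑ i ∈ s, e i *
      (qPoch q ((q ^ β : ℝ) : ℂ) (k i) / qPoch q ((q ^ (α + β) : ℝ) : ℂ) (k i) *
        (qPoch q (c' * y) (k i) * qPoch q (c' * y⁻¹) (k i)))) := by
  set v := awParams q α β r y with hvdef
  have hv2 : v 2 = c := hc
  have hprod : ‖∏ l, v l‖ < 1 := norm_prod_awParams_lt_one α β hq0 hq1 hr hy hαβ
  have hdiff : ∀ (i : ι) (z : ℂ), z ≠ 0 →
      DifferentiableAt ℂ (fun z => qPoch q (c * z) (k i) * qPoch q (c * z⁻¹) (k i)) z := by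
    intro i z hz
    unfold qPoch
    fun_prop (disch := exact hz)
  have hφd : ∀ z, z ≠ 0 → DifferentiableAt ℂ φ z := by
    intro z hz
    have : DifferentiableAt ℂ
        (fun z => ∑ i ∈ s, e i * (qPoch q (c * z) (k i) * qPoch q (c * z⁻¹) (k i))) z :=
      DifferentiableAt.fun_sum fun i _ => (hdiff i z hz).const_mul _
    refine this.congr_of_eventuallyEq ?_
    filter_upwards [isOpen_ne.mem_nhds hz] with w hw using hφ w hw
  have hsum : awFunctional q v φ = ∑ i ∈ s, e i *
      (awValue q v * (qPoch q ((q ^ β : ℝ) : ℂ) (k i) / qPoch q ((q ^ (α + β) : ℝ) : ℂ) (k i) *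
        (qPoch q (c' * y) (k i) * qPoch q (c' * y⁻¹) (k i)))) := by
    rw [awFunctional_congr hq0 hq1 v hφ, awFunctional_sum hq0 hq1 hv.1]
    · refine sum_congr rfl fun i _ => ?_
      congr 1
      have h := awFunctional_qPoch hq0 hq1 2 (k i) hv
      rw [hv2] at h
      rw [h, awFunctional_eq_awValue hq0 hq1, ← hv2, awValue_update_pow hq0 hq1 hv hprod]
      · rw [show v 2 * v 3 = ((q ^ β : ℝ) : ℂ) from awParams_mul_two_three α β hq0 hr,
          show v 0 * v 1 * v 2 * v 3 = ((q ^ (α + β) : ℝ) : ℂ) from awParams_prod α β hq0 hr hy,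
          show v 2 * v 0 = c' * y by
            rw [← hc', ← rpow_half_mul_rpow_half hq0]; simp only [v, awParams, Matrix.cons_val]; ring,
          show v 2 * v 1 = c' * y⁻¹ by
            rw [← hc', ← rpow_half_mul_rpow_half hq0]; simp only [v, awParams, Matrix.cons_val]; ring]
      · refine hv.of_shift hq0 fun j => ?_
        by_cases hj : j = 2
        · subst hj; exact ⟨k i, by simp [hv2]⟩
        · exact ⟨0, by simp [hj]⟩
      · have hp : ∏ l, Function.update v 2 (c * (q : ℂ) ^ k i) l = (∏ l, v l) * (q : ℂ) ^ k i := by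
          rw [Fin.prod_univ_four, Fin.prod_univ_four]
          simp [hv2]; ring
        rw [hp]
        refine norm_mul_lt_one hprod ?_
        rw [norm_qpow hq0]
        exact pow_le_one₀ hq0.le hq1.le
    · intro i _ z hz
      exact (hdiff i z (ne_zero_of_mem_unitSphere hz)).continuousAt.continuousWithinAt
  filter_upwards [eventually_cycleIntegral_eq hq0 hq1 hv
    (φ := fun z => kernelConst q α β r y * φ z) fun z hz => (hφd z hz).const_mul _] with ε hε
  have e1 : (fun x => x⁻¹ * (kernelM q α β r y x * φ x)) =
      fun x => x⁻¹ * (awWeight q v x * (kernelConst q α β r y * φ x)) := by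
    funext x; rw [kernelM_eq]; ring
  rw [e1, hε]
  have hlin := awFunctional_sum hq0 hq1 hv.1 ({()} : Finset Unit)
    (fun _ => kernelConst q α β r y) (fun _ => φ)
    (fun _ _ z hz => (hφd z (ne_zero_of_mem_unitSphere hz)).continuousAt.continuousWithinAt)
  simp only [sum_singleton] at hlin
  rw [hlin, hsum, mul_sum]
  refine sum_congr rfl fun i _ => ?_
  have hK := kernelConst_mul_awValue hq0 hq1 hr hy hαβ hv
  linear_combination (e i * (qPoch q ((q ^ β : ℝ) : ℂ) (k i) /
    qPoch q ((q ^ (α + β) : ℝ) : ℂ) (k i) *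
        (qPoch q (c' * y) (k i) * qPoch q (c' * y⁻¹) (k i)))) * hK

end Kernel

/-! ### Evaluation of Laurent polynomials -/

section Evaluation

/-- The character `(a, b) ↦ x₁ ^ a * x₂ ^ b` of `ℤ × ℤ`. -/
def monomialHom {G : Type*} [CommGroup G] (x₁ x₂ : G) : Multiplicative (ℤ × ℤ) →* G where
  toFun m := x₁ ^ m.toAdd.1 * x₂ ^ m.toAdd.2
  map_one' := by simp
  map_mul' m n := by simp [zpow_add, mul_mul_mul_comm]

/-- Evaluation at a point with nonzero coordinates, as a homomorphism of algebras. -/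
def evalHom (x₁ x₂ : ℂˣ) : Laurent2 →ₐ[ℂ] ℂ :=
  AddMonoidAlgebra.lift ℂ ℂ (ℤ × ℤ) ((Units.coeHom ℂ).comp (monomialHom x₁ x₂))

lemma evalHom_apply (f : Laurent2) (x₁ x₂ : ℂˣ) : evalHom x₁ x₂ f = f.eval x₁ x₂ := by
  rw [evalHom, AddMonoidAlgebra.lift_apply, Laurent2.eval]
  refine Finsupp.sum_congr fun m _ => ?_
  simp [monomialHom, mul_assoc]

lemma eval_eq_evalHom (f : Laurent2) {x₁ x₂ : ℂ} (h₁ : x₁ ≠ 0) (h₂ : x₂ ≠ 0) :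
    f.eval x₁ x₂ = evalHom (Units.mk0 x₁ h₁) (Units.mk0 x₂ h₂) f := by
  rw [evalHom_apply]; rfl

lemma evalHom_single (x₁ x₂ : ℂˣ) (m : ℤ × ℤ) (c : ℂ) :
    evalHom x₁ x₂ (AddMonoidAlgebra.single m c) = c * ((x₁ : ℂ) ^ m.1 * (x₂ : ℂ) ^ m.2) := by
  rw [evalHom, AddMonoidAlgebra.lift_single]
  simp [monomialHom]

/-- The character `(u, v) ↦ u ^ a * v ^ b` of the torus `Circle × Circle`, for `m = (a, b)`. -/
def torusChar (m : ℤ × ℤ) : Circle × Circle →* ℂ where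
  toFun u := (u.1 : ℂ) ^ m.1 * (u.2 : ℂ) ^ m.2
  map_one' := by simp
  map_mul' u v := by simp [mul_zpow, mul_mul_mul_comm]

lemma torusChar_injective : Function.Injective torusChar := by
  have key : ∀ a b : ℤ, (∀ u : Circle, (u : ℂ) ^ a = (u : ℂ) ^ b) → a = b := by
    intro a b h
    have hn : (a - b).natAbs + 1 ≠ 0 := by omega
    have hζ := Complex.isPrimitiveRoot_exp _ hn
    have h2 := h ⟨_, mem_sphere_zero_iff_norm.2 (hζ.norm'_eq_one hn)⟩
    have h3 := (hζ.zpow_eq_one_iff_dvd (a - b)).1 (by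
      rw [zpow_sub₀ (hζ.ne_zero hn)]
      exact div_eq_one_iff_eq (zpow_ne_zero _ (hζ.ne_zero hn)) |>.2 h2)
    have h4 := Int.natAbs_dvd_natAbs.2 h3
    have h5 := Nat.eq_zero_of_dvd_of_lt h4 (by rw [Int.natAbs_natCast]; exact Nat.lt_succ_self _)
    omega
  intro m n h
  have h' : ∀ u v : Circle, (u : ℂ) ^ m.1 * (v : ℂ) ^ m.2 = (u : ℂ) ^ n.1 * (v : ℂ) ^ n.2 :=
    fun u v => DFunLike.congr_fun h (u, v)
  refine Prod.ext (key _ _ fun u => ?_) (key _ _ fun u => ?_)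
  · simpa using h' u 1
  · simpa using h' 1 u

/-- A Laurent polynomial is determined by its values on a torus `|x₁| = |x₂| = ρ`, because
distinct characters of `Circle × Circle` are linearly independent. -/
lemma eq_zero_of_eval_torus {ρ : ℝ} (hρ : 0 < ρ) (f : Laurent2)
    (h : ∀ u v : Circle, f.eval (ρ * u) (ρ * v) = 0) : f = 0 := by
  have hρ' : (ρ : ℂ) ≠ 0 := by exact_mod_cast hρ.ne'
  have hli := (linearIndependent_monoidHom (Circle × Circle) ℂ).comp _ torusChar_injective
  rw [linearIndependent_iff'] at hli
  have hz := hli f.coeff.support (fun m => f.coeff m * (ρ : ℂ) ^ (m.1 + m.2)) (by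
    funext u
    rw [Pi.zero_apply, ← h u.1 u.2, Laurent2.eval, Finsupp.sum, Finset.sum_apply]
    refine sum_congr rfl fun m _ => ?_
    simp [torusChar, mul_zpow, zpow_add₀ hρ']
    ring)
  rw [← AddMonoidAlgebra.coeff_eq_zero]
  ext m
  by_contra hm
  have := hz m (Finsupp.mem_support_iff.2 hm)
  rcases mul_eq_zero.1 this with h1 | h1
  · exact hm h1
  · exact zpow_ne_zero _ hρ' h1

end Evaluation

/-! ### A basis of the symmetric Laurent polynomials -/

section SymBasis

/-- The exchange of the two variables. -/
def swapHom : Laurent2 →ₐ[ℂ] Laurent2 :=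
  AddMonoidAlgebra.lift ℂ Laurent2 (ℤ × ℤ)
    ⟨⟨fun m => AddMonoidAlgebra.single m.toAdd.swap 1, rfl⟩, fun m n => by
      simp [AddMonoidAlgebra.single_mul_single]⟩

lemma swapHom_single (m : ℤ × ℤ) (c : ℂ) :
    swapHom (AddMonoidAlgebra.single m c) = AddMonoidAlgebra.single m.swap c := by
  rw [swapHom, AddMonoidAlgebra.lift_single]
  simp [AddMonoidAlgebra.smul_single]

lemma coeff_swapHom (f : Laurent2) (a b : ℤ) : (swapHom f).coeff (a, b) = f.coeff (b, a) := by
  induction f using AddMonoidAlgebra.induction_linear with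
  | zero => simp
  | add f g hf hg => simp [hf, hg]
  | single m c =>
    rw [swapHom_single]
    simp only [AddMonoidAlgebra.coeff_single, Finsupp.single_apply]
    congr 1
    simp [Prod.ext_iff, and_comm]

lemma mem_symLaurent_iff (f : Laurent2) : f ∈ SymLaurent ↔ swapHom f = f := by
  constructor
  · intro h
    rw [← AddMonoidAlgebra.coeff_inj]
    ext ⟨a, b⟩
    rw [coeff_swapHom]; exact h b a
  · intro h a b
    rw [← coeff_swapHom, h]

variable {q : ℝ}

/-- The factor `(1 - c x₁)(1 - c x₂)`. -/
def pairFactor (c : ℂ) : Laurent2 :=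
  (1 - AddMonoidAlgebra.single (1, 0) c) * (1 - AddMonoidAlgebra.single (0, 1) c)

/-- The product `(c x₁, c x₂; q)_k` as a Laurent polynomial. -/
def pairPoly (q : ℝ) (c : ℂ) (k : ℕ) : Laurent2 := ∏ j ∈ range k, pairFactor (c * (q : ℂ) ^ j)

/-- The element `(x₁ x₂)^m (c x₁, c x₂; q)_k`, for `i = (m, k)`. -/
def symVec (q : ℝ) (c : ℂ) (i : ℤ × ℕ) : Laurent2 :=
  AddMonoidAlgebra.single (i.1, i.1) 1 * pairPoly q c i.2

lemma eval_symVec (c : ℂ) (i : ℤ × ℕ) {x₁ x₂ : ℂ} (h₁ : x₁ ≠ 0) (h₂ : x₂ ≠ 0) :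
    (symVec q c i).eval x₁ x₂ =
      (x₁ * x₂) ^ i.1 * (qPoch q (c * x₁) i.2 * qPoch q (c * x₂) i.2) := by
  rw [eval_eq_evalHom _ h₁ h₂, symVec, map_mul, evalHom_single, pairPoly, map_prod, qPoch, qPoch,
    ← prod_mul_distrib, mul_zpow, one_mul]
  refine congrArg₂ _ rfl (prod_congr rfl fun j _ => ?_)
  rw [pairFactor, map_mul, map_sub, map_sub, evalHom_single, evalHom_single]
  simp
  ring

lemma symVec_mem (c : ℂ) (i : ℤ × ℕ) : symVec q c i ∈ SymLaurent := by
  rw [mem_symLaurent_iff, symVec, map_mul, swapHom_single, pairPoly, map_prod]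
  refine congrArg₂ _ rfl (prod_congr rfl fun j _ => ?_)
  rw [pairFactor, map_mul, map_sub, map_sub, swapHom_single, swapHom_single, mul_comm]
  simp

lemma single_mul_symVec (c : ℂ) (a m : ℤ) (k : ℕ) :
    AddMonoidAlgebra.single (a, a) 1 * symVec q c (m, k) = symVec q c (a + m, k) := by
  rw [symVec, symVec, ← mul_assoc, AddMonoidAlgebra.single_mul_single]
  simp

/-- The elementary symmetric polynomial `x₁ + x₂`. -/
def elemOne : Laurent2 := AddMonoidAlgebra.single (1, 0) 1 + AddMonoidAlgebra.single (0, 1) 1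

lemma pairFactor_eq (c : ℂ) :
    pairFactor c = 1 - c • elemOne + c ^ 2 • AddMonoidAlgebra.single (1, 1) 1 := by
  have h : ∀ m : ℤ × ℤ, (AddMonoidAlgebra.single m c : Laurent2) =
      c • AddMonoidAlgebra.single m 1 := fun m => by simp [AddMonoidAlgebra.smul_single]
  have h2 : (AddMonoidAlgebra.single (1, 1) 1 : Laurent2) =
      AddMonoidAlgebra.single (1, 0) 1 * AddMonoidAlgebra.single (0, 1) 1 := by
    rw [AddMonoidAlgebra.single_mul_single]; simp
  rw [pairFactor, elemOne, h2, h, h]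
  simp only [Algebra.smul_def, map_pow]
  ring

/-- Multiplication by `x₁ + x₂` preserves the span of the vectors `symVec`, because
`(1 - d x₁)(1 - d x₂) = 1 - d (x₁ + x₂) + d² x₁ x₂` with `d = c q^k`. -/
lemma elemOne_mul_symVec (hq0 : 0 < q) {c : ℂ} (hc : c ≠ 0) (m : ℤ) (k : ℕ) :
    elemOne * symVec q c (m, k) = (c * (q : ℂ) ^ k)⁻¹ • (symVec q c (m, k) - symVec q c (m, k + 1) +
      (c * (q : ℂ) ^ k) ^ 2 • symVec q c (1 + m, k)) := by
  have hd : c * (q : ℂ) ^ k ≠ 0 := mul_ne_zero hc (pow_ne_zero _ (qC_ne_zero hq0))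
  have h1 : symVec q c (m, k + 1) = symVec q c (m, k) * pairFactor (c * (q : ℂ) ^ k) := by
    rw [symVec, symVec, pairPoly, prod_range_succ, mul_assoc]; rfl
  rw [eq_inv_smul_iff₀ hd, h1, pairFactor_eq, ← single_mul_symVec]
  simp only [Algebra.smul_def, map_pow]
  ring

/-- The vectors `symVec` span: their span contains `1` and is closed under multiplication by `x₁ + x₂`
and by the powers of `x₁ x₂`. -/
lemma symLaurent_le_span (hq0 : 0 < q) {c : ℂ} (hc : c ≠ 0) :
    SymLaurent ≤ Submodule.span ℂ (Set.range (symVec q c)) := by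
  set S := Submodule.span ℂ (Set.range (symVec q c)) with hS
  have hmem : ∀ i, symVec q c i ∈ S := fun i => Submodule.subset_span ⟨i, rfl⟩
  have hp : ∀ (a : ℤ) (f : Laurent2), f ∈ S → AddMonoidAlgebra.single (a, a) 1 * f ∈ S := by
    intro a f hf
    induction hf using Submodule.span_induction with
    | mem x hx => obtain ⟨⟨m, k⟩, rfl⟩ := hx; rw [single_mul_symVec]; exact hmem _
    | zero => simp
    | add x y _ _ hx hy => rw [mul_add]; exact S.add_mem hx hy
    | smul d x _ hx => rw [mul_smul_comm]; exact S.smul_mem _ hx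
  have he : ∀ f : Laurent2, f ∈ S → elemOne * f ∈ S := by
    intro f hf
    induction hf using Submodule.span_induction with
    | mem x hx =>
      obtain ⟨⟨m, k⟩, rfl⟩ := hx
      rw [elemOne_mul_symVec hq0 hc]
      exact S.smul_mem _ (S.add_mem (S.sub_mem (hmem _) (hmem _)) (S.smul_mem _ (hmem _)))
    | zero => simp
    | add x y _ _ hx hy => rw [mul_add]; exact S.add_mem hx hy
    | smul d x _ hx => rw [mul_smul_comm]; exact S.smul_mem _ hx
  -- Newton's recursion for the power sums
  have hpow : ∀ n : ℕ, (AddMonoidAlgebra.single ((n : ℤ), 0) 1 +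
      AddMonoidAlgebra.single (0, (n : ℤ)) 1 : Laurent2) ∈ S := by
    have h1 : (1 : Laurent2) ∈ S := by
      have := hmem (0, 0)
      rwa [show symVec q c (0, 0) = 1 by
        simp [symVec, pairPoly, AddMonoidAlgebra.one_def, ← Prod.zero_eq_mk]] at this
    intro n
    induction n using Nat.twoStepInduction with
    | zero => simpa [← Prod.zero_eq_mk, ← AddMonoidAlgebra.one_def] using S.add_mem h1 h1
    | one => simpa [elemOne] using he 1 h1
    | more n ih1 ih2 =>
      have := S.sub_mem (he _ ih2) (hp 1 _ ih1)
      convert this using 1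
      simp only [elemOne, mul_add, add_mul, AddMonoidAlgebra.single_mul_single, Prod.mk_add_mk]
      push_cast
      ring_nf
  have hsym : ∀ a b : ℤ, (AddMonoidAlgebra.single (a, b) 1 + AddMonoidAlgebra.single (b, a) 1 :
      Laurent2) ∈ S := by
    have hle : ∀ a b : ℤ, b ≤ a → (AddMonoidAlgebra.single (a, b) 1 +
        AddMonoidAlgebra.single (b, a) 1 : Laurent2) ∈ S := by
      intro a b hab
      obtain ⟨n, rfl⟩ := Int.le.dest hab
      have := hp b _ (hpow n)
      simpa [mul_add, AddMonoidAlgebra.single_mul_single] using this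
    intro a b
    rcases le_total b a with h | h
    · exact hle a b h
    · rw [add_comm]; exact hle b a h
  have hall : ∀ f : Laurent2, f + swapHom f ∈ S := by
    intro f
    induction f using AddMonoidAlgebra.induction_linear with
    | zero => simp
    | add f g hf hg =>
      rw [map_add, add_add_add_comm]; exact S.add_mem hf hg
    | single m d =>
      have := S.smul_mem d (hsym m.1 m.2)
      rw [swapHom_single]
      simpa [AddMonoidAlgebra.smul_single, smul_add, Prod.swap] using this
  intro f hf
  have h2 := S.smul_mem (2⁻¹ : ℂ) (hall f)
  rwa [(mem_symLaurent_iff f).1 hf, ← two_smul ℂ f, smul_smul, inv_mul_cancel₀ two_ne_zero,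
    one_smul] at h2

lemma coeff_mul_pairFactor (f : Laurent2) (c : ℂ) (a b : ℤ) :
    (f * pairFactor c).coeff (a, b) = f.coeff (a, b) - c * (f.coeff (a - 1, b) + f.coeff (a, b - 1))
      + c ^ 2 * f.coeff (a - 1, b - 1) := by
  rw [pairFactor_eq, elemOne]
  simp only [mul_add, mul_sub, mul_one, mul_smul_comm, AddMonoidAlgebra.coeff_add,
    AddMonoidAlgebra.coeff_sub, Finsupp.add_apply, Finsupp.sub_apply,
    AddMonoidAlgebra.coeff_smul_apply, AddMonoidAlgebra.coeff_mul_single_apply, smul_eq_mul]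
  simp [sub_eq_add_neg]

lemma coeff_pairPoly_eq_zero (c : ℂ) (k : ℕ) :
    ∀ a b : ℤ, (a < 0 ∨ b < 0 ∨ (k : ℤ) < a ∨ (k : ℤ) < b) → (pairPoly q c k).coeff (a, b) = 0 := by
  induction k with
  | zero =>
    intro a b h
    have : ((0 : ℤ × ℤ) = (a, b)) = False := by
      rw [eq_iff_iff, iff_false, Prod.ext_iff]
      simp at h ⊢; omega
    simp [pairPoly, AddMonoidAlgebra.one_def, this]
  | succ k ih =>
    intro a b h
    push_cast at h
    rw [pairPoly, prod_range_succ, ← pairPoly, coeff_mul_pairFactor, ih _ _ (by omega),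
      ih _ _ (by omega), ih _ _ (by omega), ih _ _ (by omega)]
    ring

lemma coeff_pairPoly_corner (hq0 : 0 < q) {c : ℂ} (hc : c ≠ 0) (k : ℕ) :
    (pairPoly q c k).coeff ((k : ℤ), 0) ≠ 0 := by
  induction k with
  | zero => simp [pairPoly, AddMonoidAlgebra.one_def, ← Prod.zero_eq_mk]
  | succ k ih =>
    rw [pairPoly, prod_range_succ, ← pairPoly, coeff_mul_pairFactor,
      coeff_pairPoly_eq_zero _ _ _ _ (by push_cast; omega),
      coeff_pairPoly_eq_zero _ _ _ (0 - 1) (by omega),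
      coeff_pairPoly_eq_zero _ _ _ (0 - 1) (by omega)]
    push_cast
    simpa using ⟨⟨hc, fun h => absurd h hq0.ne'⟩, ih⟩

lemma coeff_symVec (c : ℂ) (m : ℤ) (k : ℕ) (a b : ℤ) :
    (symVec q c (m, k)).coeff (a, b) = (pairPoly q c k).coeff (a - m, b - m) := by
  rw [symVec, AddMonoidAlgebra.coeff_single_mul_apply]
  simp [sub_eq_add_neg, add_comm]

lemma linearIndependent_symVec (hq0 : 0 < q) {c : ℂ} (hc : c ≠ 0) :
    LinearIndependent ℂ (symVec q c) := by
  rw [linearIndependent_iff']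
  intro s w hw
  by_contra! hcon
  obtain ⟨i₀, hi₀, hw₀⟩ := hcon
  -- the coefficient of `x₁^(m+k) x₂^m` with `k` maximal comes from a single term
  obtain ⟨⟨m, k⟩, hi, hmax⟩ := exists_max_image (s.filter fun i => w i ≠ 0) (fun i => i.2)
    ⟨i₀, by simp [hi₀, hw₀]⟩
  rw [mem_filter] at hi
  have h := congrArg (fun f : Laurent2 => f.coeff (m + k, m)) hw
  simp only [AddMonoidAlgebra.coeff_sum, Finsupp.finsetSum_apply,
    AddMonoidAlgebra.coeff_smul_apply, AddMonoidAlgebra.coeff_zero, Finsupp.zero_apply,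
    smul_eq_mul] at h
  rw [sum_eq_single_of_mem (m, k) hi.1] at h
  · rw [coeff_symVec] at h
    rcases mul_eq_zero.1 h with h | h
    · exact hi.2 h
    · exact coeff_pairPoly_corner hq0 hc k (by simpa using h)
  · rintro ⟨m', k'⟩ hj hne
    by_cases hwj : w (m', k') = 0
    · rw [hwj, zero_mul]
    have hk := hmax (m', k') (by simp [hj, hwj])
    simp only at hk
    rw [coeff_symVec, coeff_pairPoly_eq_zero, mul_zero]
    by_contra hcon
    push Not at hcon
    apply hne
    ext <;> simp <;> omega

/-- The basis `(x₁ x₂)^m (c x₁, c x₂; q)_k` of the space of symmetric Laurent polynomials. -/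
def symBasis (hq0 : 0 < q) {c : ℂ} (hc : c ≠ 0) : Module.Basis (ℤ × ℕ) ℂ SymLaurent :=
  Module.Basis.mk (v := fun i => (⟨symVec q c i, symVec_mem c i⟩ : SymLaurent))
    (LinearIndependent.of_comp SymLaurent.subtype (linearIndependent_symVec hq0 hc)) (by
      rw [← Submodule.map_le_map_iff_of_injective SymLaurent.injective_subtype,
        Submodule.map_span, ← Set.range_comp]
      simpa [Function.comp_def] using symLaurent_le_span hq0 hc)

lemma symBasis_apply (hq0 : 0 < q) {c : ℂ} (hc : c ≠ 0) (i : ℤ × ℕ) :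
    (symBasis hq0 hc i : Laurent2) = symVec q c i := by
  simp [symBasis]

lemma eval_sum_smul_symBasis (hq0 : 0 < q) {c : ℂ} (hc : c ≠ 0) {ι : Type*} (s : Finset ι)
    (w : ι → ℂ) (i : ι → ℤ × ℕ) {x₁ x₂ : ℂ} (h₁ : x₁ ≠ 0) (h₂ : x₂ ≠ 0) :
    (∑ j ∈ s, w j • symBasis hq0 hc (i j)).1.eval x₁ x₂ = ∑ j ∈ s, w j *
      ((x₁ * x₂) ^ (i j).1 * (qPoch q (c * x₁) (i j).2 * qPoch q (c * x₂) (i j).2)) := by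
  rw [eval_eq_evalHom _ h₁ h₂, Submodule.coe_sum, map_sum]
  refine sum_congr rfl fun j _ => ?_
  rw [Submodule.coe_smul, symBasis_apply, map_smul, ← eval_eq_evalHom, eval_symVec _ _ h₁ h₂,
    smul_eq_mul]

end SymBasis

/-! ### Rogers polynomials -/

section Rogers

variable {q : ℝ}

lemma qPoch_q_ne_zero (hq0 : 0 < q) (hq1 : q < 1) (n : ℕ) : qPoch q (q : ℂ) n ≠ 0 :=
  qPoch_ne_zero fun k _ => mul_qpow_ne_one hq0 hq1 (by simpa [abs_of_pos hq0] using hq1) k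

lemma one_sub_qpow_succ_ne_zero (hq0 : 0 < q) (hq1 : q < 1) (n : ℕ) :
    (1 - (q : ℂ) ^ (n + 1)) ≠ 0 := by
  have := mul_qpow_ne_one hq0 hq1 (a := (q : ℂ)) (by simpa [abs_of_pos hq0] using hq1) n
  rw [pow_succ']
  exact sub_ne_zero.2 this.symm

lemma one_add_mul_ne_zero {T : ℂ} (hT : ‖T‖ < 1) : 1 + T ≠ 0 := by
  intro h
  rw [show T = -1 by linear_combination h] at hT
  simp at hT

lemma norm_mul_qpow_lt_one (hq0 : 0 < q) (hq1 : q < 1) {t : ℂ} (ht : ‖t‖ < 1) (k : ℕ) :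
    ‖t * (q : ℂ) ^ k‖ < 1 :=
  norm_mul_lt_one ht (by rw [norm_qpow hq0]; exact pow_le_one₀ hq0.le hq1.le)

/-- The coefficient `(t;q)_j / (q;q)_j` of the `q`-binomial series. -/
def binCoeff (q : ℝ) (t : ℂ) (j : ℕ) : ℂ := qPoch q t j / qPoch q (q : ℂ) j

lemma binCoeff_zero (t : ℂ) : binCoeff q t 0 = 1 := by simp [binCoeff, qPoch_zero]

lemma binCoeff_succ (hq0 : 0 < q) (hq1 : q < 1) (t : ℂ) (j : ℕ) :
    (1 - (q : ℂ) ^ (j + 1)) * binCoeff q t (j + 1) = (1 - t * (q : ℂ) ^ j) * binCoeff q t j := by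
  have h1 := one_sub_qpow_succ_ne_zero hq0 hq1 j
  have h2 := qPoch_q_ne_zero hq0 hq1 j
  rw [binCoeff, binCoeff, qPoch_succ, qPoch_succ, ← pow_succ' (q : ℂ) j]
  field_simp

lemma binCoeff_succ_shift (hq0 : 0 < q) (hq1 : q < 1) (t : ℂ) (j : ℕ) :
    (1 - (q : ℂ) ^ (j + 1)) * binCoeff q t (j + 1) = (1 - t) * binCoeff q (t * q) j := by
  have h1 := one_sub_qpow_succ_ne_zero hq0 hq1 j
  have h2 := qPoch_q_ne_zero hq0 hq1 j
  rw [binCoeff, binCoeff, qPoch_succ', qPoch_succ (q : ℂ), ← pow_succ' (q : ℂ) j]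
  field_simp

lemma binCoeff_shift (hq0 : 0 < q) (hq1 : q < 1) (t : ℂ) (j : ℕ) :
    (1 - t) * binCoeff q (t * q) j = (1 - t * (q : ℂ) ^ j) * binCoeff q t j := by
  rw [← binCoeff_succ_shift hq0 hq1, binCoeff_succ hq0 hq1]

/-- The dehomogenised Rogers polynomial
`∑_{j ≤ N} (t;q)_j (t;q)_{N-j} / ((q;q)_j (q;q)_{N-j}) u^j`. -/
def rogers (q : ℝ) (t : ℂ) (N : ℕ) (u : ℂ) : ℂ :=
  ∑ j ∈ range (N + 1), binCoeff q t j * binCoeff q t (N - j) * u ^ j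

/-- The polynomial `(1 - t)` times the Rogers polynomial of degree `N - 1` and parameter `tq`,
and `0` for `N = 0`. -/
def rogersLower (q : ℝ) (t : ℂ) (N : ℕ) (u : ℂ) : ℂ :=
  ∑ j ∈ range N, (1 - t) * (binCoeff q (t * q) j * binCoeff q (t * q) (N - 1 - j)) * u ^ j

lemma rogersLower_zero (t u : ℂ) : rogersLower q t 0 u = 0 := by simp [rogersLower]

lemma rogersLower_succ (t u : ℂ) (N : ℕ) :
    rogersLower q t (N + 1) u = (1 - t) * rogers q (t * q) N u := by
  rw [rogersLower, rogers, mul_sum]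
  refine sum_congr rfl fun j _ => ?_
  rw [Nat.add_sub_cancel]; ring

lemma rogersLower_eq (hq0 : 0 < q) (hq1 : q < 1) (t u : ℂ) (N : ℕ) :
    rogersLower q t N u = ∑ j ∈ range (N + 1),
      (1 - (q : ℂ) ^ (N - j)) * binCoeff q (t * q) j * binCoeff q t (N - j) * u ^ j := by
  rw [sum_range_succ, rogersLower]
  simp only [Nat.sub_self, pow_zero, sub_self, zero_mul, add_zero]
  refine sum_congr rfl fun j hj => ?_
  obtain ⟨m, rfl⟩ : ∃ m, N = j + (m + 1) := ⟨N - j - 1, by have := mem_range.1 hj; omega⟩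
  rw [show j + (m + 1) - 1 - j = m by omega, show j + (m + 1) - j = m + 1 by omega]
  linear_combination (-(binCoeff q (t * q) j * u ^ j)) * binCoeff_succ_shift hq0 hq1 t m

lemma mul_rogersLower_eq (hq0 : 0 < q) (hq1 : q < 1) (t u : ℂ) (N : ℕ) :
    u * rogersLower q t N u = ∑ j ∈ range (N + 1),
      (1 - (q : ℂ) ^ j) * binCoeff q t j * binCoeff q (t * q) (N - j) * u ^ j := by
  rw [sum_range_succ', rogersLower, mul_sum]
  simp only [pow_zero, sub_self, zero_mul, add_zero]
  refine sum_congr rfl fun j _ => ?_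
  rw [show N - (j + 1) = N - 1 - j by omega]
  linear_combination (-(binCoeff q (t * q) (N - 1 - j) * u ^ (j + 1))) *
    binCoeff_succ_shift hq0 hq1 t j

/-- Forward contiguous relation. -/
lemma rogersLower_forward (hq0 : 0 < q) (hq1 : q < 1) {t : ℂ} (ht : ‖t‖ < 1) (u : ℂ) (N : ℕ) :
    (u - t) * rogersLower q t N u =
      (1 + t * (q : ℂ) ^ N) * rogers q t N u - (1 + t) * rogers q t N (q * u) := by
  have h1 : 1 - t ≠ 0 := sub_ne_zero.2 (ne_one_of_norm_lt ht).symm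
  rw [sub_mul, mul_rogersLower_eq hq0 hq1, rogersLower_eq hq0 hq1, rogers, rogers, mul_sum, mul_sum,
    mul_sum, ← sum_sub_distrib, ← sum_sub_distrib]
  refine sum_congr rfl fun j hj => ?_
  obtain ⟨m, rfl⟩ : ∃ m, N = j + m := ⟨N - j, by have := mem_range.1 hj; omega⟩
  rw [Nat.add_sub_cancel_left, mul_pow, pow_add]
  apply mul_left_cancel₀ h1
  linear_combination ((1 - (q : ℂ) ^ j) * binCoeff q t j * u ^ j) * binCoeff_shift hq0 hq1 t m -
    (t * (1 - (q : ℂ) ^ m) * binCoeff q t m * u ^ j) * binCoeff_shift hq0 hq1 t j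

/-- Backward contiguous relation. -/
lemma rogersLower_backward (hq0 : 0 < q) (hq1 : q < 1) {t : ℂ} (ht : ‖t‖ < 1) (u : ℂ) (N : ℕ) :
    (1 - t * u) * rogersLower q t N u =
      (1 + t * (q : ℂ) ^ N) * rogers q t N u -
        (q : ℂ) ^ N * (1 + t) * rogers q t N (u / q) := by
  have h1 : 1 - t ≠ 0 := sub_ne_zero.2 (ne_one_of_norm_lt ht).symm
  have hq := qC_ne_zero hq0
  rw [sub_mul, one_mul, mul_assoc, mul_rogersLower_eq hq0 hq1, rogersLower_eq hq0 hq1, rogers,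
    rogers, mul_sum, mul_sum, mul_sum, ← sum_sub_distrib, ← sum_sub_distrib]
  refine sum_congr rfl fun j hj => ?_
  obtain ⟨m, rfl⟩ : ∃ m, N = j + m := ⟨N - j, by have := mem_range.1 hj; omega⟩
  rw [Nat.add_sub_cancel_left, div_pow, pow_add,
    show (q : ℂ) ^ j * (q : ℂ) ^ m * (1 + t) * (binCoeff q t j * binCoeff q t m *
      (u ^ j / (q : ℂ) ^ j)) = (q : ℂ) ^ m * (1 + t) * (binCoeff q t j * binCoeff q t m * u ^ j) by
      field_simp]
  apply mul_left_cancel₀ h1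
  linear_combination ((1 - (q : ℂ) ^ m) * binCoeff q t m * u ^ j) * binCoeff_shift hq0 hq1 t j -
    (t * (1 - (q : ℂ) ^ j) * binCoeff q t j * u ^ j) * binCoeff_shift hq0 hq1 t m

/-- The divided difference of a Rogers polynomial, compare `rogersExp_diff`. -/
lemma rogers_div_sub_mul (hq0 : 0 < q) (hq1 : q < 1) {t : ℂ} (ht : ‖t‖ < 1) (u : ℂ) (N : ℕ) :
    (q : ℂ) ^ N * rogers q t N (u / q) - rogers q t N (q * u) =
      -((1 - u) * rogersLower q t N u) := by
  have h1 := one_add_mul_ne_zero ht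
  apply mul_left_cancel₀ h1
  linear_combination rogersLower_backward hq0 hq1 ht u N - rogersLower_forward hq0 hq1 ht u N

lemma rogers_reverse (t : ℂ) (N : ℕ) {u v : ℂ} (hu : u ≠ 0) (hv : v ≠ 0) :
    u ^ N * rogers q t N (v / u) = v ^ N * rogers q t N (u / v) := by
  rw [rogers, rogers, mul_sum, mul_sum,
    ← sum_range_reflect (fun j => u ^ N * (binCoeff q t j * binCoeff q t (N - j) * (v / u) ^ j))]
  refine sum_congr rfl fun j hj => ?_
  obtain ⟨m, rfl⟩ : ∃ m, N = j + m := ⟨N - j, by have := mem_range.1 hj; omega⟩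
  rw [show j + m + 1 - 1 - j = m by omega, show j + m - m = j by omega,
    show j + m - j = m by omega, div_pow, div_pow, pow_add, pow_add]
  field_simp

/-- The Rogers polynomial at `u = t`, a case of the `q`-Vandermonde sum. -/
lemma rogers_self (hq0 : 0 < q) (hq1 : q < 1) (N : ℕ) {t : ℂ} (ht : ‖t‖ < 1) :
    rogers q t N t = qPoch q (t ^ 2) N / qPoch q (q : ℂ) N := by
  induction N generalizing t with
  | zero => simp [rogers, binCoeff_zero, qPoch_zero]
  | succ N ih =>
    have ht2 : ‖t ^ 2‖ < 1 := by
      rw [norm_pow]; exact pow_lt_one₀ (norm_nonneg t) ht two_ne_zero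
    have h1 := one_add_mul_ne_zero ht
    have h2 := one_sub_qpow_succ_ne_zero hq0 hq1 N
    have h3 : 1 - t ^ 2 * (q : ℂ) ^ (N + 1) ≠ 0 :=
      sub_ne_zero.2 (mul_qpow_ne_one hq0 hq1 ht2 (N + 1)).symm
    have h4 := qPoch_q_ne_zero hq0 hq1 N
    -- Both contiguous relations involve `rogers q t (N + 1) (q * t)`, which is eliminated; the
    -- induction hypothesis is applied with parameter `t q`.
    have hf := rogersLower_forward hq0 hq1 ht t (N + 1)
    have hb := rogersLower_backward hq0 hq1 ht (q * t) (N + 1)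
    rw [rogersLower_succ, mul_comm (q : ℂ) t, ih (by simpa using norm_mul_qpow_lt_one hq0 hq1 ht 1),
      mul_div_assoc, div_self (qC_ne_zero hq0), mul_one] at hb
    rw [mul_comm (q : ℂ) t] at hf
    have hP : qPoch q (t ^ 2) (N + 1) * (1 - t ^ 2 * (q : ℂ) ^ (N + 1)) =
        (1 - t ^ 2) * ((1 - t ^ 2 * q) * qPoch q ((t * q) ^ 2) N) := by
      rw [← qPoch_succ, qPoch_succ', qPoch_succ']
      ring_nf
    rw [qPoch_succ (q : ℂ), ← pow_succ' (q : ℂ) N, eq_div_iff (mul_ne_zero h4 h2)]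
    apply mul_left_cancel₀ h3
    rw [mul_comm _ (qPoch q (t ^ 2) (N + 1)), hP]
    rw [mul_div_assoc', mul_pow] at hb
    rw [mul_pow]
    field_simp at hb
    linear_combination (-(1 + t)) * hb - qPoch q (q : ℂ) N * (1 + t * (q : ℂ) ^ (N + 1)) * hf

end Rogers

/-! ### Two expansions in shifted factorials -/

section Expansions

variable {q : ℝ}

/-- The coefficient `(-1)^k (t;q)_k / (q;q)_k q^{k(k+1)/2 - nk}`. -/
def connCoeff (q : ℝ) (t : ℂ) (n k : ℕ) : ℂ :=
  (-1) ^ k * binCoeff q t k * (q : ℂ) ^ (k + 1).choose 2 / (q : ℂ) ^ (n * k)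

lemma connCoeff_zero (t : ℂ) (n : ℕ) : connCoeff q t n 0 = 1 := by
  simp [connCoeff, binCoeff_zero]

/-- The recurrence of `connCoeff` in `k`. -/
lemma connCoeff_succ (hq0 : 0 < q) (hq1 : q < 1) (t : ℂ) {n k : ℕ} (hk : k < n) :
    connCoeff q t n (k + 1) * (q : ℂ) ^ (n - (k + 1)) * (1 - (q : ℂ) ^ (k + 1)) =
      -((1 - t * (q : ℂ) ^ k) * connCoeff q t n k) := by
  have hq := qC_ne_zero hq0
  obtain ⟨m, rfl⟩ : ∃ m, n = k + 1 + m := ⟨n - (k + 1), by omega⟩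
  have h := binCoeff_succ hq0 hq1 t k
  have hc : (k + 1 + 1).choose 2 = (k + 1) + (k + 1).choose 2 := by
    rw [Nat.choose_succ_succ' (k + 1) 1, Nat.choose_one_right]
  rw [connCoeff, connCoeff, hc, Nat.add_sub_cancel_left, mul_add, mul_one, pow_add _ _ (k + 1 + m),
    pow_add _ (k + 1), pow_succ (-1 : ℂ), pow_add _ (k + 1) m]
  field_simp
  linear_combination (-1 : ℂ) * h

/-- The relation of `connCoeff` for `t` and `tq` that underlies `rogersExp_diff`. -/
lemma connCoeff_succ_succ (hq0 : 0 < q) (hq1 : q < 1) (t : ℂ) (n k : ℕ) :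
    connCoeff q t (n + 1) (k + 1) * (q : ℂ) ^ n * (1 - (q : ℂ) ^ (k + 1)) =
      -((1 - t) * connCoeff q (t * q) n k) := by
  have hq := qC_ne_zero hq0
  have h := binCoeff_succ_shift hq0 hq1 t k
  have hc : (k + 1 + 1).choose 2 = (k + 1) + (k + 1).choose 2 := by
    rw [Nat.choose_succ_succ' (k + 1) 1, Nat.choose_one_right]
  rw [connCoeff, connCoeff, hc, show (n + 1) * (k + 1) = n * k + n + (k + 1) by ring, pow_add,
    pow_add _ (n * k + n), pow_add _ (n * k), pow_succ (-1 : ℂ)]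
  field_simp
  linear_combination (-((q : ℂ) ^ (k + 1) * (q : ℂ) ^ (k + 1).choose 2)) * h

lemma qPoch_one (k : ℕ) : qPoch q 1 (k + 1) = 0 := by
  rw [qPoch_succ']; simp

/-- The right-hand side of the expansion of the Rogers polynomial in shifted factorials. -/
def rogersExp (q : ℝ) (t : ℂ) (n : ℕ) (u v : ℂ) : ℂ :=
  ∑ k ∈ range (n + 1), connCoeff q t n k *
    rogers q (t * (q : ℂ) ^ k) (n - k) ((q : ℂ) ^ k * (u * v)) * (qPoch q u k * qPoch q v k)

lemma rogersExp_comm (t : ℂ) (n : ℕ) (u v : ℂ) : rogersExp q t n u v = rogersExp q t n v u := by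
  unfold rogersExp
  refine sum_congr rfl fun k _ => ?_
  rw [mul_comm u v, mul_comm (qPoch q u k)]

lemma rogersExp_one (t : ℂ) (n : ℕ) (v : ℂ) : rogersExp q t n 1 v = rogers q t n v := by
  rw [rogersExp, sum_range_succ']
  simp [qPoch_one, qPoch_zero, connCoeff_zero]

/-- The divided difference acts on `rogersExp` as on the homogeneous Rogers polynomial
(`rogers_div_sub_mul`): it lowers the degree and replaces `t` by `tq`. -/
lemma rogersExp_diff (hq0 : 0 < q) (hq1 : q < 1) (t : ℂ) (n : ℕ) (u v : ℂ) :
    (q : ℂ) ^ (n + 1) * (rogersExp q t (n + 1) u (v / q) - rogersExp q t (n + 1) (u / q) v) =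
      -((u - v) * ((1 - t) * rogersExp q (t * q) n u v)) := by
  have hq := qC_ne_zero hq0
  unfold rogersExp
  rw [← sum_sub_distrib, sum_range_succ', mul_sum, mul_add]
  simp only [qPoch_zero, pow_zero, one_mul, mul_one]
  rw [show u * (v / q) = u / q * v by ring, sub_self, mul_zero, add_zero, mul_sum]
  simp only [mul_sum]
  rw [← sum_neg_distrib]
  refine sum_congr rfl fun k _ => ?_
  have hu : qPoch q u (k + 1) = qPoch q u k * (1 - u * (q : ℂ) ^ k) := qPoch_succ _ _
  have hv : qPoch q v (k + 1) = qPoch q v k * (1 - v * (q : ℂ) ^ k) := qPoch_succ _ _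
  have hu' : qPoch q (u / q) (k + 1) = (1 - u / q) * qPoch q u k := by
    rw [qPoch_succ', div_mul_cancel₀ _ hq]
  have hv' : qPoch q (v / q) (k + 1) = (1 - v / q) * qPoch q v k := by
    rw [qPoch_succ', div_mul_cancel₀ _ hq]
  rw [hu, hv, hu', hv', show n + 1 - (k + 1) = n - k by omega,
    show t * (q : ℂ) ^ (k + 1) = t * q * (q : ℂ) ^ k by rw [pow_succ']; ring,
    show (q : ℂ) ^ (k + 1) * (u / q * v) = (q : ℂ) ^ k * (u * v) by rw [pow_succ']; field_simp]
  have h := connCoeff_succ_succ hq0 hq1 t n k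
  have e : (1 - u * (q : ℂ) ^ k) * (1 - v / q) - (1 - u / q) * (1 - v * (q : ℂ) ^ k) =
      (u - v) * (1 - (q : ℂ) ^ (k + 1)) / q := by
    rw [pow_succ']; field_simp; ring
  have e2 : (q : ℂ) ^ (n + 1) * ((u - v) * (1 - (q : ℂ) ^ (k + 1)) / q) =
      (q : ℂ) ^ n * (1 - (q : ℂ) ^ (k + 1)) * (u - v) := by
    rw [pow_succ']; field_simp
  set R := rogers q (t * q * (q : ℂ) ^ k) (n - k) ((q : ℂ) ^ k * (u * v))
  linear_combination (connCoeff q t (n + 1) (k + 1) * R * qPoch q u k * qPoch q v k *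
    (q : ℂ) ^ (n + 1)) * e + (connCoeff q t (n + 1) (k + 1) * R * qPoch q u k * qPoch q v k) * e2 +
    ((u - v) * R * qPoch q u k * qPoch q v k) * h

lemma differentiable_rogersExp (t : ℂ) (n : ℕ) (u : ℂ) :
    Differentiable ℂ fun v => rogersExp q t n u v := by
  unfold rogersExp rogers qPoch
  fun_prop

/-- Expansion of the homogeneous Rogers polynomial in the products
`(u, v; q)_k` with coefficients depending on `uv` only. Both sides are compared through the
divided difference `f ↦ f(u, v/q) - f(u/q, v)`, which lowers the degree. -/
theorem rogers_eq_rogersExp (hq0 : 0 < q) (hq1 : q < 1) (n : ℕ) {t : ℂ} (ht : ‖t‖ < 1) {u : ℂ}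
    (hu : u ≠ 0) (v : ℂ) : u ^ n * rogers q t n (v / u) = rogersExp q t n u v := by
  have hq := qC_ne_zero hq0
  induction n generalizing t u v with
  | zero => simp [rogersExp, rogers, binCoeff_zero, connCoeff_zero, qPoch_zero]
  | succ n ih =>
    have ht' : ‖t * q‖ < 1 := by simpa using norm_mul_qpow_lt_one hq0 hq1 ht 1
    have hstep : ∀ u v : ℂ, u ≠ 0 →
        u ^ (n + 1) * rogers q t (n + 1) (v / q / u) - rogersExp q t (n + 1) u (v / q) =
        (u / q) ^ (n + 1) * rogers q t (n + 1) (v / (u / q)) -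
          rogersExp q t (n + 1) (u / q) v := by
      intro u v hu
      have h1 := rogers_div_sub_mul hq0 hq1 ht (v / u) (n + 1)
      have h2 := rogersExp_diff hq0 hq1 t n u v
      have h3 := ih ht' hu v
      rw [rogersLower_succ] at h1
      have h4 : (1 - v / u) * u ^ (n + 1) = (u - v) * u ^ n := by rw [pow_succ]; field_simp
      rw [show v / q / u = v / u / q by field_simp, show v / (u / q) = q * (v / u) by field_simp,
        div_pow]
      apply mul_left_cancel₀ (pow_ne_zero (n + 1) hq)
      have h5 : (q : ℂ) ^ (n + 1) * (u ^ (n + 1) / (q : ℂ) ^ (n + 1)) = u ^ (n + 1) := by field_simp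
      linear_combination u ^ (n + 1) * h1 - h2 - (u - v) * (1 - t) * h3 -
        (1 - t) * rogers q (t * q) n (v / u) * h4 -
        rogers q t (n + 1) (q * (v / u)) * h5
    -- For `u = 1` the factor `(u;q)_k` leaves the term `k = 0` only; `hstep` moves on to `u = q^j`.
    have hpow : ∀ (j : ℕ) (v : ℂ), ((q : ℂ) ^ j) ^ (n + 1) * rogers q t (n + 1) (v / (q : ℂ) ^ j) =
        rogersExp q t (n + 1) ((q : ℂ) ^ j) v := by
      intro j
      induction j with
      | zero => intro v; simp [rogersExp_one]
      | succ j ihj =>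
        intro v
        have h := hstep ((q : ℂ) ^ (j + 1)) (q * v) (pow_ne_zero _ hq)
        rw [mul_div_cancel_left₀ _ hq, show (q : ℂ) ^ (j + 1) / q = (q : ℂ) ^ j by
          rw [pow_succ, mul_div_cancel_right₀ _ hq], ihj] at h
        linear_combination h
    have hdiff : Differentiable ℂ fun v => u ^ (n + 1) * rogers q t (n + 1) (v / u) := by
      unfold rogers; fun_prop
    -- the identity theorem, at the points `v = q^j`
    have hfreq : ∃ᶠ v in 𝓝[≠] (0 : ℂ),
        u ^ (n + 1) * rogers q t (n + 1) (v / u) = rogersExp q t (n + 1) u v := by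
      have ht0 : Tendsto (fun j : ℕ => (q : ℂ) ^ j) atTop (𝓝[≠] 0) :=
        tendsto_nhdsWithin_iff.2 ⟨tendsto_qpow hq0 hq1, Eventually.of_forall fun j =>
          pow_ne_zero j hq⟩
      refine ht0.frequently (Frequently.of_forall fun j => ?_)
      rw [rogers_reverse _ _ hu (pow_ne_zero j hq), hpow, rogersExp_comm]
    exact congrFun (AnalyticOnNhd.eq_of_frequently_eq
      (fun z _ => hdiff.analyticAt z) (fun z _ => (differentiable_rogersExp t (n + 1) u).analyticAt z)
      hfreq) v

end Expansions

/-! ### Factorisation of the transformed expansion -/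

section Factorization

variable {q : ℝ}

/-- The coefficient `connCoeff q t n k` times the factor `(t;q)_k / (t²;q)_k` by which the operator
`M_ξ` acts on products of shifted factorials. -/
def sepCoeff (q : ℝ) (t : ℂ) (n k : ℕ) : ℂ :=
  connCoeff q t n k * (qPoch q t k / qPoch q (t ^ 2) k)

lemma norm_sq_lt_one {t : ℂ} (ht : ‖t‖ < 1) : ‖t ^ 2‖ < 1 := by
  rw [norm_pow]; exact pow_lt_one₀ (norm_nonneg t) ht two_ne_zero

lemma qPoch_ne_zero_of_norm_lt (hq0 : 0 < q) (hq1 : q < 1) {a : ℂ} (ha : ‖a‖ < 1) (n : ℕ) :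
    qPoch q a n ≠ 0 :=
  qPoch_ne_zero fun k _ => mul_qpow_ne_one hq0 hq1 ha k

lemma sepCoeff_succ (hq0 : 0 < q) (hq1 : q < 1) {t : ℂ} (ht : ‖t‖ < 1) {n k : ℕ} (hk : k < n) :
    sepCoeff q t n (k + 1) * (q : ℂ) ^ (n - (k + 1)) *
        ((1 - (q : ℂ) ^ (k + 1)) * (1 - t ^ 2 * (q : ℂ) ^ k)) =
      -((1 - t * (q : ℂ) ^ k) ^ 2 * sepCoeff q t n k) := by
  have h := connCoeff_succ hq0 hq1 t hk
  have h1 : 1 - t ^ 2 * (q : ℂ) ^ k ≠ 0 :=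
    sub_ne_zero.2 (mul_qpow_ne_one hq0 hq1 (norm_sq_lt_one ht) k).symm
  have h2 := qPoch_ne_zero_of_norm_lt hq0 hq1 (norm_sq_lt_one ht) k
  rw [sepCoeff, sepCoeff, qPoch_succ, qPoch_succ]
  field_simp
  linear_combination (qPoch q t k * (1 - t * (q : ℂ) ^ k)) * h

/-- The expansion with coefficients `sepCoeff`, at the point `(y₁, y₂) = (t w, y)`. -/
def sepExp (q : ℝ) (t : ℂ) (n : ℕ) (w y : ℂ) : ℂ :=
  ∑ k ∈ range (n + 1), sepCoeff q t n k *
    rogers q (t * (q : ℂ) ^ k) (n - k) ((q : ℂ) ^ k * (w * y)) *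
    (qPoch q (t * w) k * qPoch q y k)

/-- The second-order `q`-difference operator annihilating the Rogers polynomial. -/
def sepOp (q : ℝ) (t : ℂ) (n : ℕ) (f : ℂ → ℂ) (w : ℂ) : ℂ :=
  (1 - t * w) * f (q * w) - (1 + t * (q : ℂ) ^ n) * (1 - w) * f w +
    (q : ℂ) ^ n * (t - w) * f (w / q)

/-- The difference equation of the Rogers polynomials, obtained by elimination of `rogersLower` from the
two contiguous relations. -/
lemma sepOp_rogers (hq0 : 0 < q) (hq1 : q < 1) {t : ℂ} (ht : ‖t‖ < 1) (n : ℕ) (w : ℂ) :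
    sepOp q t n (rogers q t n) w = 0 := by
  have hf := rogersLower_forward hq0 hq1 ht w n
  have hb := rogersLower_backward hq0 hq1 ht w n
  apply mul_left_cancel₀ (one_add_mul_ne_zero ht)
  rw [sepOp]
  linear_combination (1 - t * w) * hf + (t - w) * hb

/-- The telescoping primitive of the terms of `sepOp` applied to `sepExp`. -/
def sepPrimitive (q : ℝ) (t : ℂ) (n : ℕ) (w y : ℂ) (k : ℕ) : ℂ :=
  w * sepCoeff q t n k * (1 - t * (q : ℂ) ^ k) *
    rogersLower q (t * (q : ℂ) ^ k) (n - k) ((q : ℂ) ^ k * (w * y)) *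
    (qPoch q (t * w) k * qPoch q y (k + 1))

lemma sepOp_term_zero (hq0 : 0 < q) (hq1 : q < 1) {t : ℂ} (ht : ‖t‖ < 1) (n : ℕ) (w y : ℂ) :
    sepOp q t n (fun w => rogers q t n (w * y)) w = w * (1 - t) * rogersLower q t n (w * y) *
      (1 - y) := by
  have hf := rogersLower_forward hq0 hq1 ht (w * y) n
  have hb := rogersLower_backward hq0 hq1 ht (w * y) n
  apply mul_left_cancel₀ (one_add_mul_ne_zero ht)
  rw [sepOp, mul_assoc (q : ℂ), div_mul_eq_mul_div]
  linear_combination (1 - t * w) * hf + (t - w) * hb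

/-- The operator `sepOp` maps each term of `sepExp` to a difference of consecutive values of
`sepPrimitive`. -/
lemma sepOp_term_succ (hq0 : 0 < q) (hq1 : q < 1) {t : ℂ} (ht : ‖t‖ < 1) {n m : ℕ} (hm : m < n)
    (w y : ℂ) :
    sepOp q t n (fun w => sepCoeff q t n (m + 1) *
        rogers q (t * (q : ℂ) ^ (m + 1)) (n - (m + 1)) ((q : ℂ) ^ (m + 1) * (w * y)) *
        (qPoch q (t * w) (m + 1) * qPoch q y (m + 1))) w =
      sepPrimitive q t n w y (m + 1) - sepPrimitive q t n w y m := by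
  have hq := qC_ne_zero hq0
  have hT := norm_mul_qpow_lt_one hq0 hq1 ht (m + 1)
  have hβ := sepCoeff_succ hq0 hq1 ht hm
  obtain ⟨N, rfl⟩ : ∃ N, n = m + 1 + N := ⟨n - (m + 1), by omega⟩
  have hf := rogersLower_forward hq0 hq1 hT ((q : ℂ) ^ (m + 1) * (w * y)) N
  have hb := rogersLower_backward hq0 hq1 hT ((q : ℂ) ^ (m + 1) * (w * y)) N
  simp only [sepOp, sepPrimitive]
  rw [Nat.add_sub_cancel_left] at hβ ⊢
  rw [show m + 1 + N - m = N + 1 by omega, rogersLower_succ,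
    show t * (q : ℂ) ^ m * q = t * (q : ℂ) ^ (m + 1) by rw [pow_succ]; ring,
    show (q : ℂ) ^ (m + 1) * (q * w * y) = q * ((q : ℂ) ^ (m + 1) * (w * y)) by ring,
    show (q : ℂ) ^ (m + 1) * (w / q * y) = (q : ℂ) ^ (m + 1) * (w * y) / q by ring,
    show (q : ℂ) ^ m * (w * y) = (q : ℂ) ^ (m + 1) * (w * y) / q by rw [pow_succ]; field_simp]
  have e1 : (1 - t * w) * qPoch q (t * (q * w)) (m + 1) =
      qPoch q (t * w) m * (1 - t * w * (q : ℂ) ^ m) * (1 - t * w * (q : ℂ) ^ (m + 1)) := by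
    rw [← qPoch_succ, ← qPoch_succ, qPoch_succ' _ (m + 1)]
    ring_nf
  have e2 : qPoch q (t * w) (m + 1) = qPoch q (t * w) m * (1 - t * w * (q : ℂ) ^ m) := qPoch_succ _ _
  have e3 : (q : ℂ) ^ (m + 1 + N) * qPoch q (t * (w / q)) (m + 1) =
      (q : ℂ) ^ m * (q : ℂ) ^ N * (q - t * w) * qPoch q (t * w) m := by
    rw [qPoch_succ', show t * (w / q) * q = t * w by field_simp, pow_add, pow_succ]
    field_simp
  have e4 : qPoch q y (m + 1 + 1) = qPoch q y (m + 1) * (1 - y * (q : ℂ) ^ (m + 1)) := qPoch_succ _ _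
  rw [e2, e4]
  set U := (q : ℂ) ^ (m + 1) * (w * y) with hU
  set T := t * (q : ℂ) ^ (m + 1) with hTdef
  generalize rogersLower q T N U = D at *
  generalize rogers q T N (q * U) = rp at *
  generalize rogers q T N (U / q) = rm at *
  generalize rogers q T N U = r at *
  generalize sepCoeff q t (m + 1 + N) (m + 1) = B at *
  generalize sepCoeff q t (m + 1 + N) m = B₀ at *
  generalize qPoch q y (m + 1) = Y at *
  generalize qPoch q (t * w) m = X at *
  apply mul_left_cancel₀ (one_add_mul_ne_zero hT)
  have hgoal : (1 + T) * (B * Y * (X * (1 - t * w * (q : ℂ) ^ m) * (1 - t * w * (q : ℂ) ^ (m + 1)) * rp -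
      (1 + t * (q : ℂ) ^ (m + 1 + N)) * (1 - w) * r * (X * (1 - t * w * (q : ℂ) ^ m)) +
      (q : ℂ) ^ m * (q : ℂ) ^ N * (q - t * w) * (t - w) * rm * X)) =
      (1 + T) * (w * B * (1 - T) * D * (X * (1 - t * w * (q : ℂ) ^ m)) *
        (Y * (1 - y * (q : ℂ) ^ (m + 1))) -
        w * B₀ * (1 - t * (q : ℂ) ^ m) * ((1 - t * (q : ℂ) ^ m) * rm) * X * Y) := by
    rw [pow_add _ (m + 1) N, hTdef] at *
    rw [hU] at *
    rw [pow_succ] at *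
    generalize (q : ℂ) ^ m = Q at *
    generalize (q : ℂ) ^ N = E at *
    linear_combination (B * X * Y * (1 - t * w * Q) * (1 - t * w * (Q * q))) * hf +
      (B * X * Y * (Q * (q - t * w) * (t - w) - w * (1 - Q * q) * (1 - t ^ 2 * Q))) * hb +
      (w * X * Y * (1 + t * (Q * q)) * rm) * hβ
  linear_combination hgoal + (1 + T) * B * Y * rp * e1 + (1 + T) * B * Y * (t - w) * rm * e3

lemma sepOp_sum (t : ℂ) (n : ℕ) {ι : Type*} (s : Finset ι) (F : ι → ℂ → ℂ) (w : ℂ) :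
    sepOp q t n (fun w => ∑ i ∈ s, F i w) w = ∑ i ∈ s, sepOp q t n (F i) w := by
  simp only [sepOp, mul_sum, sum_add_distrib, sum_sub_distrib]

lemma sepCoeff_zero (t : ℂ) (n : ℕ) : sepCoeff q t n 0 = 1 := by
  simp [sepCoeff, connCoeff_zero, qPoch_zero]

/-- In its first variable, `sepExp` satisfies the difference equation of the Rogers polynomials: the
sum telescopes, and its last term vanishes. -/
lemma sepOp_sepExp (hq0 : 0 < q) (hq1 : q < 1) {t : ℂ} (ht : ‖t‖ < 1) (n : ℕ) (w y : ℂ) :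
    sepOp q t n (fun w => sepExp q t n w y) w = 0 := by
  have hsum : ∀ m ≤ n, ∑ k ∈ range (m + 1), sepOp q t n (fun w => sepCoeff q t n k *
      rogers q (t * (q : ℂ) ^ k) (n - k) ((q : ℂ) ^ k * (w * y)) *
      (qPoch q (t * w) k * qPoch q y k)) w = sepPrimitive q t n w y m := by
    intro m hm
    induction m with
    | zero =>
      have h := sepOp_term_zero hq0 hq1 ht n w y
      simp only [zero_add, range_one, sum_singleton, sepCoeff_zero, pow_zero, mul_one, one_mul,
        Nat.sub_zero, qPoch_zero, sepPrimitive]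
      rw [h, qPoch_succ, qPoch_zero]
      ring
    | succ m ih =>
      rw [sum_range_succ, ih (by omega), sepOp_term_succ hq0 hq1 ht (by omega)]
      ring
  simp only [sepExp]
  rw [sepOp_sum, hsum n le_rfl, sepPrimitive, Nat.sub_self, rogersLower_zero]
  ring

/-- The value of the Rogers polynomial at `u = t⁻¹`. -/
lemma rogers_inv (hq0 : 0 < q) (hq1 : q < 1) (n : ℕ) {t : ℂ} (ht0 : t ≠ 0) (ht : ‖t‖ < 1) :
    t ^ n * rogers q t n t⁻¹ = qPoch q (t ^ 2) n / qPoch q (q : ℂ) n := by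
  have h := rogers_reverse (q := q) t n ht0 one_ne_zero
  rw [one_div, div_one, one_pow, one_mul, rogers_self hq0 hq1 n ht] at h
  exact h

/-- Separation of variables for the Rogers polynomials: the expansion `sepExp` is a product.
As polynomials in `w`, both sides are annihilated by the same second-order operator, and they agree
at `w = t⁻¹`, hence at all `w = t⁻¹ q^{-j}`. -/
theorem sepExp_eq_mul (hq0 : 0 < q) (hq1 : q < 1) (n : ℕ) {t : ℂ} (ht0 : t ≠ 0) (ht : ‖t‖ < 1)
    (w y : ℂ) :
    sepExp q t n w y = t ^ n * (qPoch q (q : ℂ) n / qPoch q (t ^ 2) n) *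
      (rogers q t n w * rogers q t n (y / t)) := by
  have hq := qC_ne_zero hq0
  have ht2 := qPoch_ne_zero_of_norm_lt hq0 hq1 (norm_sq_lt_one ht) n
  have hqn := qPoch_q_ne_zero hq0 hq1 n
  set K := t ^ n * (qPoch q (q : ℂ) n / qPoch q (t ^ 2) n) * rogers q t n (y / t) with hK
  set F : ℂ → ℂ := fun w => sepExp q t n w y - K * rogers q t n w with hF
  have hop : ∀ w, sepOp q t n F w = 0 := by
    intro w
    have h1 := sepOp_sepExp hq0 hq1 ht n w y
    have h2 := sepOp_rogers hq0 hq1 ht n w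
    simp only [sepOp, hF] at h1 h2 ⊢
    linear_combination h1 - K * h2
  have hbase : F t⁻¹ = 0 := by
    have h1 : sepExp q t n t⁻¹ y = rogers q t n (y / t) := by
      rw [sepExp, sum_range_succ', mul_inv_cancel₀ ht0]
      simp [qPoch_one, qPoch_zero, sepCoeff_zero, div_eq_inv_mul]
    have h2 := rogers_inv hq0 hq1 n ht0 ht
    have h3 : t ^ n * (qPoch q (q : ℂ) n / qPoch q (t ^ 2) n) * rogers q t n t⁻¹ = 1 := by
      rw [mul_right_comm, h2, div_mul_div_comm, mul_comm, div_self (mul_ne_zero hqn ht2)]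
    simp only [hF, h1, hK]
    linear_combination (-rogers q t n (y / t)) * h3
  -- At `w = t⁻¹` the coefficient of `F (q w)` in `sepOp` vanishes, which starts the recursion.
  have hzero : ∀ j : ℕ, F (t⁻¹ / (q : ℂ) ^ j) = 0 ∧ F (t⁻¹ / (q : ℂ) ^ (j + 1)) = 0 := by
    have hstep : ∀ j : ℕ, (1 - t * (t⁻¹ / (q : ℂ) ^ j)) * F (q * (t⁻¹ / (q : ℂ) ^ j)) = 0 →
        F (t⁻¹ / (q : ℂ) ^ j) = 0 → F (t⁻¹ / (q : ℂ) ^ (j + 1)) = 0 := by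
      intro j h1 h2
      have h := hop (t⁻¹ / (q : ℂ) ^ j)
      rw [sepOp, h1, h2, mul_zero, sub_zero, zero_add, div_div, ← pow_succ] at h
      refine (mul_eq_zero.1 h).resolve_left (mul_ne_zero (pow_ne_zero _ hq) fun he => ?_)
      refine mul_qpow_ne_one hq0 hq1 (norm_sq_lt_one ht) j ?_
      have hqj := pow_ne_zero j hq
      field_simp at he
      linear_combination he
    intro j
    induction j with
    | zero =>
      have h0 : F (t⁻¹ / (q : ℂ) ^ 0) = 0 := by rw [pow_zero, div_one, hbase]
      exact ⟨h0, hstep 0 (by rw [pow_zero, div_one, mul_inv_cancel₀ ht0, sub_self, zero_mul]) h0⟩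
    | succ j ih =>
      refine ⟨ih.2, hstep (j + 1) ?_ ih.2⟩
      rw [show (q : ℂ) * (t⁻¹ / (q : ℂ) ^ (j + 1)) = t⁻¹ / (q : ℂ) ^ j by rw [pow_succ]; field_simp,
        ih.1, mul_zero]
  obtain ⟨P, hP⟩ : ∃ P : Polynomial ℂ, ∀ w, P.eval w = F w := by
    refine ⟨∑ k ∈ range (n + 1), Polynomial.C (sepCoeff q t n k) *
      (∑ j ∈ range (n - k + 1), Polynomial.C (binCoeff q (t * (q : ℂ) ^ k) j *
        binCoeff q (t * (q : ℂ) ^ k) (n - k - j)) *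
        (Polynomial.C ((q : ℂ) ^ k) * (Polynomial.C y * Polynomial.X)) ^ j) *
      ((∏ i ∈ range k, (1 - Polynomial.C t * Polynomial.X * Polynomial.C (q : ℂ) ^ i)) *
        Polynomial.C (qPoch q y k)) - Polynomial.C K * ∑ j ∈ range (n + 1),
          Polynomial.C (binCoeff q t j * binCoeff q t (n - j)) * Polynomial.X ^ j, fun w => ?_⟩
    simp [Polynomial.eval_finsetSum, Polynomial.eval_prod, hF, sepExp, rogers, qPoch, mul_comm w y]
  have hP0 : P = 0 := by
    refine Polynomial.eq_zero_of_infinite_isRoot P (Set.Infinite.mono (s := Set.range fun j : ℕ =>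
      t⁻¹ / (q : ℂ) ^ j) ?_ (Set.infinite_range_of_injective ?_))
    · rintro _ ⟨j, rfl⟩
      exact (hP _).trans (hzero j).1
    · intro i j hij
      have h1 : (q : ℂ) ^ i = (q : ℂ) ^ j := by
        have hi := pow_ne_zero i hq
        have hj := pow_ne_zero j hq
        have := mul_left_cancel₀ (inv_ne_zero ht0) (by simpa [div_eq_mul_inv] using hij)
        simpa using this
      exact pow_right_injective₀ hq0 hq1.ne (by exact_mod_cast h1)
  have h := hP w
  rw [hP0, Polynomial.eval_zero] at h
  simp only [hF, hK] at h
  linear_combination -h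

end Factorization

/-! ### Macdonald polynomials and separated polynomials -/

section Macdonald

variable {q : ℝ}

lemma chebyshevT_eval (m : ℤ) {x : ℂ} (hx : x ≠ 0) :
    (Polynomial.Chebyshev.T ℂ m).eval ((x + x⁻¹) / 2) = (x ^ m + x ^ (-m)) / 2 := by
  have h := Polynomial.Chebyshev.T_complex_cosh (Complex.log x) m
  rwa [Complex.cosh, Complex.cosh, Complex.exp_neg, Complex.exp_log hx, Complex.exp_neg,
    Complex.exp_int_mul, Complex.exp_log hx, ← zpow_neg] at h

lemma qUltraspherical_eval (t : ℂ) (n : ℕ) {x : ℂ} (hx : x ≠ 0) :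
    (qUltraspherical q t n).eval ((x + x⁻¹) / 2) = x ^ n * rogers q t n (x⁻¹ / x) := by
  have hx' := inv_ne_zero hx
  have h := rogers_reverse (q := q) t n hx hx'
  have h2 : ∀ u : ℂ, u ≠ 0 → u ^ n * rogers q t n (u⁻¹ / u) =
      ∑ j ∈ range (n + 1), binCoeff q t j * binCoeff q t (n - j) * u ^ ((n : ℤ) - 2 * j) := by
    intro u hu
    rw [rogers, mul_sum]
    refine sum_congr rfl fun j _ => ?_
    rw [zpow_sub₀ hu, zpow_natCast, zpow_mul, zpow_natCast, div_pow, inv_pow]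
    rw [show u ^ (2 : ℤ) = u * u by rw [zpow_ofNat, sq], mul_pow]
    field_simp
  have h3 := h2 x hx
  have h4 := h2 x⁻¹ hx'
  rw [inv_inv, ← h] at h4
  rw [qUltraspherical, Polynomial.eval_finsetSum]
  have : ∀ j, Polynomial.eval ((x + x⁻¹) / 2) (Polynomial.C (qPoch q t j * qPoch q t (n - j) /
      (qPoch q (q : ℂ) j * qPoch q (q : ℂ) (n - j))) * Polynomial.Chebyshev.T ℂ ((n : ℤ) - 2 * j)) =
      (binCoeff q t j * binCoeff q t (n - j) * x ^ ((n : ℤ) - 2 * j) +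
        binCoeff q t j * binCoeff q t (n - j) * x⁻¹ ^ ((n : ℤ) - 2 * j)) / 2 := by
    intro j
    rw [Polynomial.eval_mul, Polynomial.eval_C, chebyshevT_eval _ hx, binCoeff, binCoeff, inv_zpow',
      div_mul_div_comm]
    ring
  simp only [this]
  rw [← sum_div, sum_add_distrib, ← h3, ← h4]
  ring

/-- The coefficients of the terminating series `f_λ` are those of a Rogers polynomial. -/
lemma qPoch_neg_div (hq0 : 0 < q) (hq1 : q < 1) {t : ℂ} (ht0 : t ≠ 0) (ht : ‖t‖ < 1) {n k : ℕ}
    (hk : k ≤ n) :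
    qPoch q ((q : ℂ) ^ (-(n : ℤ))) k * (qPoch q (q : ℂ) (n - k) * qPoch q t n) * (q : ℂ) ^ k =
      qPoch q (t⁻¹ * (q : ℂ) ^ (1 - (n : ℤ))) k * (qPoch q (q : ℂ) n * qPoch q t (n - k)) * t ^ k ∧
    qPoch q (t⁻¹ * (q : ℂ) ^ (1 - (n : ℤ))) k ≠ 0 := by
  have hq := qC_ne_zero hq0
  induction k with
  | zero => simp [qPoch_zero]
  | succ k ih =>
    obtain ⟨ih1, ih2⟩ := ih (by omega)
    obtain ⟨m, rfl⟩ : ∃ m, n = k + 1 + m := ⟨n - (k + 1), by omega⟩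
    rw [show k + 1 + m - k = m + 1 by omega, qPoch_succ, qPoch_succ] at ih1
    rw [Nat.add_sub_cancel_left, qPoch_succ, qPoch_succ]
    have hm : (q : ℂ) ^ (-((k + 1 + m : ℕ) : ℤ)) * (q : ℂ) ^ k = ((q : ℂ) ^ (m + 1))⁻¹ := by
      rw [zpow_neg, zpow_natCast, show k + 1 + m = k + (m + 1) by ring, pow_add]
      field_simp
    have hm' : t⁻¹ * (q : ℂ) ^ (1 - ((k + 1 + m : ℕ) : ℤ)) * (q : ℂ) ^ k = (t * (q : ℂ) ^ m)⁻¹ := by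
      rw [zpow_sub₀ hq, zpow_natCast, show k + 1 + m = k + (m + 1) by ring, pow_add, zpow_one,
        pow_succ]
      field_simp
    have h1 : 1 - t * (q : ℂ) ^ m ≠ 0 := sub_ne_zero.2 (mul_qpow_ne_one hq0 hq1 ht m).symm
    rw [hm, hm']
    refine ⟨?_, mul_ne_zero ih2 ?_⟩
    · rw [← pow_succ' (q : ℂ) m] at ih1
      have hqm := pow_ne_zero m hq
      have e1 : (1 - ((q : ℂ) ^ (m + 1))⁻¹) * q = -(1 - (q : ℂ) ^ (m + 1)) / (q : ℂ) ^ m := by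
        rw [pow_succ]; field_simp; ring
      have e2 : (1 - (t * (q : ℂ) ^ m)⁻¹) * t = -(1 - t * (q : ℂ) ^ m) / (q : ℂ) ^ m := by
        field_simp; ring
      rw [pow_succ (q : ℂ) k, pow_succ t k]
      linear_combination (-((q : ℂ) ^ m)⁻¹) * ih1 +
        (qPoch q ((q : ℂ) ^ (-((k + 1 + m : ℕ) : ℤ))) k * (qPoch q (q : ℂ) m *
          qPoch q t (k + 1 + m)) * (q : ℂ) ^ k) * e1 -
        (qPoch q (t⁻¹ * (q : ℂ) ^ (1 - ((k + 1 + m : ℕ) : ℤ))) k * (qPoch q (q : ℂ) (k + 1 + m) *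
          qPoch q t m) * t ^ k) * e2
    · intro h
      rw [sub_eq_zero, eq_comm, inv_eq_one] at h
      exact h1 (sub_eq_zero.2 h.symm)

end Macdonald

/-! ### The operator and its inverse -/

section Operator

variable {q g : ℝ}

lemma tPow_eq (hq0 : 0 < q) (s : ℝ) : tPow q g s = ((q ^ (g * s) : ℝ) : ℂ) := by
  rw [tPow, Real.rpow_mul hq0.le]

lemma tPow_mul_rpow (hq0 : 0 < q) (s x : ℝ) :
    tPow q g s * ((q ^ x : ℝ) : ℂ) = ((q ^ (g * s + x) : ℝ) : ℂ) := by
  rw [tPow_eq hq0, Real.rpow_add hq0, Complex.ofReal_mul]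

lemma tPow_mul_tPow (hq0 : 0 < q) (s s' : ℝ) : tPow q g s * tPow q g s' = tPow q g (s + s') := by
  rw [tPow_eq hq0 s', tPow_mul_rpow hq0, tPow_eq hq0, mul_add]

lemma tPow_zero : tPow q g 0 = 1 := by simp [tPow]

lemma tPow_ne_zero (hq0 : 0 < q) (s : ℝ) : tPow q g s ≠ 0 := by
  rw [tPow_eq hq0]
  exact_mod_cast (Real.rpow_pos_of_pos hq0 _).ne'

lemma tPow_neg (hq0 : 0 < q) (s : ℝ) : tPow q g (-s) = (tPow q g s)⁻¹ := by
  refine eq_inv_of_mul_eq_one_left ?_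
  rw [tPow_mul_tPow hq0, neg_add_cancel, tPow_zero]

lemma tPow_two (hq0 : 0 < q) : tPow q g 2 = tPow q g 1 ^ 2 := by
  rw [sq, tPow_mul_tPow hq0]; norm_num

lemma tPow_half_mul_self (hq0 : 0 < q) : tPow q g (1 / 2) * tPow q g (1 / 2) = tPow q g 1 := by
  rw [tPow_mul_tPow hq0]; norm_num

lemma tPow_neg_half_mul_self (hq0 : 0 < q) :
    tPow q g (-1 / 2) * tPow q g (-1 / 2) = (tPow q g 1)⁻¹ := by
  rw [tPow_mul_tPow hq0, ← tPow_neg hq0]; norm_num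

lemma norm_tPow_one_lt (hq0 : 0 < q) (hq1 : q < 1) (hg : 0 < g) : ‖tPow q g 1‖ < 1 := by
  rw [tPow_eq hq0, mul_one]; exact norm_rpow_lt_one hq0 hq1 hg

/-- The factor `(ξ² / t)^m (t;q)_k / (t²;q)_k` by which `M_ξ` acts on the `(m, k)`-th basis vector. -/
def mxiFactor (q g : ℝ) (ξ : ℂ) (i : ℤ × ℕ) : ℂ :=
  (ξ ^ 2 / tPow q g 1) ^ i.1 * (qPoch q (tPow q g 1) i.2 / qPoch q (tPow q g 1 ^ 2) i.2)

lemma mxiFactor_ne_zero (hq0 : 0 < q) (hq1 : q < 1) (hg : 0 < g) {ξ : ℂ} (hξ : ξ ≠ 0)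
    (i : ℤ × ℕ) : mxiFactor q g ξ i ≠ 0 := by
  have ht := norm_tPow_one_lt hq0 hq1 hg
  exact mul_ne_zero (zpow_ne_zero _ (div_ne_zero (pow_ne_zero 2 hξ) (tPow_ne_zero hq0 1)))
    (div_ne_zero (qPoch_ne_zero_of_norm_lt hq0 hq1 ht _)
      (qPoch_ne_zero_of_norm_lt hq0 hq1 (norm_sq_lt_one ht) _))

/-- The operator `M_ξ`: it multiplies the basis vector with parameter `c = ξ⁻¹` by `mxiFactor` and
replaces `c` by `1`. -/
def mxiEquiv (hq0 : 0 < q) (hq1 : q < 1) (hg : 0 < g) {ξ : ℂ} (hξ : ξ ≠ 0) :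
    SymLaurent ≃ₗ[ℂ] SymLaurent :=
  (symBasis hq0 (inv_ne_zero hξ)).equiv ((symBasis hq0 one_ne_zero).unitsSMul fun i =>
    Units.mk0 _ (mxiFactor_ne_zero hq0 hq1 hg hξ i)) (Equiv.refl _)

variable (hq0 : 0 < q) (hq1 : q < 1) (hg : 0 < g) {ξ : ℂ} (hξ : ξ ≠ 0)

lemma mxiEquiv_symBasis (i : ℤ × ℕ) :
    mxiEquiv hq0 hq1 hg hξ (symBasis hq0 (inv_ne_zero hξ) i) =
      mxiFactor q g ξ i • symBasis hq0 one_ne_zero i := by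
  rw [mxiEquiv, Module.Basis.equiv_apply, Module.Basis.unitsSMul_apply]
  rfl

lemma mxiEquiv_symm_symBasis (i : ℤ × ℕ) :
    (mxiEquiv hq0 hq1 hg hξ).symm (symBasis hq0 one_ne_zero i) =
      (mxiFactor q g ξ i)⁻¹ • symBasis hq0 (inv_ne_zero hξ) i := by
  rw [LinearEquiv.symm_apply_eq, map_smul, mxiEquiv_symBasis, smul_smul,
    inv_mul_cancel₀ (mxiFactor_ne_zero hq0 hq1 hg hξ i), one_smul]

lemma sum_repr_symBasis {c : ℂ} (hc : c ≠ 0) (f : SymLaurent) :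
    f = ∑ i ∈ ((symBasis hq0 hc).repr f).support,
      (symBasis hq0 hc).repr f i • symBasis hq0 hc i := by
  conv_lhs => rw [← (symBasis hq0 hc).linearCombination_repr f]
  rfl

/-- `M_ξ` is the integral operator with kernel `𝓜_{gg}`. -/
theorem hasMxiValue_mxiEquiv (f : SymLaurent) {yp ym : ℂ} (hyp : yp ≠ 0) (hym : ym ≠ 0)
    (hgen : MxiGeneric q g yp ym) :
    HasMxiValue q g ξ f.1.eval yp ym
      ((mxiEquiv hq0 hq1 hg hξ f).1.eval (yp * ym) (yp * ym⁻¹)) := by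
  have ht0 : tPow q g 1 ≠ 0 := tPow_ne_zero hq0 1
  set b := symBasis hq0 (inv_ne_zero hξ)
  set s := (b.repr f).support
  have hf : f = ∑ i ∈ s, b.repr f i • b i := sum_repr_symBasis hq0 (inv_ne_zero hξ) f
  have hval : (mxiEquiv hq0 hq1 hg hξ f).1.eval (yp * ym) (yp * ym⁻¹) =
      ∑ i ∈ s, (b.repr f i * (ξ ^ 2 / tPow q g 1 * yp ^ 2) ^ i.1) *
        (qPoch q ((q ^ g : ℝ) : ℂ) i.2 / qPoch q ((q ^ (g + g) : ℝ) : ℂ) i.2 *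
        (qPoch q (yp * ym) i.2 * qPoch q (yp * ym⁻¹) i.2)) := by
    conv_lhs => rw [hf]
    rw [map_sum]
    simp only [map_smul, b, mxiEquiv_symBasis, smul_smul]
    rw [eval_sum_smul_symBasis hq0 one_ne_zero s _ (fun j => j) (mul_ne_zero hyp hym)
      (mul_ne_zero hyp (inv_ne_zero hym))]
    refine sum_congr rfl fun i _ => ?_
    have e1 : ((q ^ g : ℝ) : ℂ) = tPow q g 1 := by rw [tPow_eq hq0, mul_one]
    have e2 : ((q ^ (g + g) : ℝ) : ℂ) = tPow q g 1 ^ 2 := by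
      rw [← tPow_two hq0, tPow_eq hq0, mul_two]
    rw [e1, e2, mxiFactor, mul_zpow _ (yp ^ 2), one_mul, one_mul,
      show yp * ym * (yp * ym⁻¹) = yp ^ 2 by field_simp]
    ring
  rw [hval]
  refine hasMValue_of_expansion hq0 hq1 (mul_ne_zero (tPow_ne_zero hq0 _) hyp) hym
    (by linarith) hgen s _ (fun i => i.2) (c := tPow q g (-1 / 2) * yp) ?_ ?_ fun z hz => ?_
  · rw [mul_right_comm, tPow_mul_rpow hq0, tPow_eq hq0]
    ring_nf
  · rw [mul_right_comm, tPow_mul_rpow hq0]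
    ring_nf
    simp
  · have h1 : ∀ x : ℂ, x ≠ 0 → tPow q g (-1 / 2) * ξ * yp * x ≠ 0 := fun x hx =>
      mul_ne_zero (mul_ne_zero (mul_ne_zero (tPow_ne_zero hq0 _) hξ) hyp) hx
    conv_lhs => rw [hf]
    simp only [b]
    rw [eval_sum_smul_symBasis hq0 (inv_ne_zero hξ) s _ (fun j => j) (h1 z hz) (h1 _ (inv_ne_zero hz))]
    refine sum_congr rfl fun i _ => ?_
    have e : ∀ x : ℂ, ξ⁻¹ * (tPow q g (-1 / 2) * ξ * yp * x) = tPow q g (-1 / 2) * yp * x :=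
      fun x => by field_simp
    have e2 : tPow q g (-1 / 2) * ξ * yp * z * (tPow q g (-1 / 2) * ξ * yp * z⁻¹) =
        ξ ^ 2 / tPow q g 1 * yp ^ 2 := by
      rw [show tPow q g (-1 / 2) * ξ * yp * z * (tPow q g (-1 / 2) * ξ * yp * z⁻¹) =
        (tPow q g (-1 / 2) * tPow q g (-1 / 2)) * (ξ ^ 2 * yp ^ 2) by field_simp,
        tPow_neg_half_mul_self hq0]
      ring
    rw [e, e, e2]
    ring

/-- The inverse of `M_ξ` is the integral operator with kernel `𝓜_{-g,2g}`. The integral with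
kernel `𝓜_{α,2g}` is an explicit function of `α`, continuous at `α = -g`. -/
theorem inversionFormula_mxiEquiv_symm (F : SymLaurent) {f : ℂ → ℂ → ℂ}
    (hf : ∀ y₁ y₂ : ℂ, y₁ ≠ 0 → y₂ ≠ 0 → f y₁ y₂ = F.1.eval y₁ y₂)
    {xp xm : ℂ} (hxp : xp ≠ 0) (hxm : xm ≠ 0) :
    InversionFormula q g ξ f xp xm
      (((mxiEquiv hq0 hq1 hg hξ).symm F).1.eval (xp * xm) (xp * xm⁻¹)) := by
  have ht0 : tPow q g 1 ≠ 0 := tPow_ne_zero hq0 1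
  have ht := norm_tPow_one_lt hq0 hq1 hg
  set b := symBasis hq0 (one_ne_zero : (1 : ℂ) ≠ 0)
  set s := (b.repr F).support
  have hF : F = ∑ i ∈ s, b.repr F i • b i := sum_repr_symBasis hq0 one_ne_zero F
  set r := tPow q g (-1 / 2) * ξ⁻¹ * xp with hr
  set c' : ℝ → ℂ := fun α => r * ((q ^ ((α + 2 * g) / 2) : ℝ) : ℂ) with hc'
  -- The value of the integral with kernel `𝓜_{α,2g}`.
  set J : ℝ → ℂ := fun α => ∑ i ∈ s, (b.repr F i * (tPow q g 1 / ξ ^ 2 * xp ^ 2) ^ i.1) *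
    (qPoch q ((q ^ (2 * g) : ℝ) : ℂ) i.2 / qPoch q ((q ^ (α + 2 * g) : ℝ) : ℂ) i.2 *
      (qPoch q (c' α * xm) i.2 * qPoch q (c' α * xm⁻¹) i.2)) with hJ
  have e1 : ((q ^ (-g + 2 * g) : ℝ) : ℂ) = tPow q g 1 := by rw [tPow_eq hq0]; ring_nf
  have e2 : ((q ^ (2 * g) : ℝ) : ℂ) = tPow q g 1 ^ 2 := by
    rw [← tPow_two hq0, tPow_eq hq0, mul_comm]
  have e3 : c' (-g) = ξ⁻¹ * xp := by
    simp only [hc', hr]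
    rw [mul_assoc (tPow q g _), mul_right_comm, tPow_mul_rpow hq0]
    ring_nf
    simp
  have hval : ((mxiEquiv hq0 hq1 hg hξ).symm F).1.eval (xp * xm) (xp * xm⁻¹) = J (-g) := by
    conv_lhs => rw [hF]
    rw [map_sum]
    simp only [map_smul, b, mxiEquiv_symm_symBasis, smul_smul]
    rw [eval_sum_smul_symBasis hq0 (inv_ne_zero hξ) s _ (fun j => j) (mul_ne_zero hxp hxm)
      (mul_ne_zero hxp (inv_ne_zero hxm))]
    simp only [hJ, e1, e2, e3]
    refine sum_congr rfl fun i _ => ?_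
    rw [mxiFactor, mul_zpow _ (xp ^ 2), show xp * xm * (xp * xm⁻¹) = xp ^ 2 by field_simp,
      mul_inv, inv_div, ← inv_zpow, inv_div, ← mul_assoc ξ⁻¹ xp xm, ← mul_assoc ξ⁻¹ xp xm⁻¹]
    ring
  have hJα : ∀ α : ℝ, 0 < α + 2 * g → InvGeneric q g ξ α xp xm →
      HasInvValue q g ξ α f xp xm (J α) := by
    intro α hα hgen
    refine hasMValue_of_expansion hq0 hq1
      (mul_ne_zero (mul_ne_zero (tPow_ne_zero hq0 _) (inv_ne_zero hξ)) hxp) hxm hα hgen s _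
      (fun i => i.2) (c := tPow q g (1 / 2) * ξ⁻¹ * xp) ?_ rfl fun z hz => ?_
    · rw [mul_assoc (tPow q g _), mul_right_comm, tPow_mul_rpow hq0, tPow_eq hq0]
      ring_nf
    · have h1 : ∀ x : ℂ, x ≠ 0 → tPow q g (1 / 2) * ξ⁻¹ * xp * x ≠ 0 := fun x hx =>
        mul_ne_zero (mul_ne_zero (mul_ne_zero (tPow_ne_zero hq0 _) (inv_ne_zero hξ)) hxp) hx
      rw [hf _ _ (h1 z hz) (h1 _ (inv_ne_zero hz))]
      conv_lhs => rw [hF]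
      simp only [b]
      rw [eval_sum_smul_symBasis hq0 one_ne_zero s _ (fun j => j) (h1 z hz) (h1 _ (inv_ne_zero hz))]
      refine sum_congr rfl fun i _ => ?_
      have e : tPow q g (1 / 2) * ξ⁻¹ * xp * z * (tPow q g (1 / 2) * ξ⁻¹ * xp * z⁻¹) =
          tPow q g 1 / ξ ^ 2 * xp ^ 2 := by
        rw [← tPow_half_mul_self hq0]
        field_simp
      rw [one_mul, one_mul, e]
      ring
  rw [hval]
  refine ⟨fun hgen => hJα (-g) (by linarith) hgen, fun hgen => ⟨J, ?_, ?_⟩⟩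
  · have hpos : ∀ᶠ α in 𝓝[≠] (-g), 0 < α + 2 * g :=
      nhdsWithin_le_nhds ((lt_mem_nhds (show -(2 * g) < -g by linarith)).mono fun α hα => by
        linarith)
    filter_upwards [hgen, hpos] with α h1 h2 using hJα α h2 h1
  · have hpow : ∀ h : ℝ → ℝ, Continuous h → Continuous fun α => ((q ^ h α : ℝ) : ℂ) := fun h hh =>
      Complex.continuous_ofReal.comp (continuous_const.rpow hh fun _ => Or.inl hq0.ne')
    have hcc : Continuous c' := continuous_const.mul (hpow _ (by fun_prop))
    have hcont : ContinuousAt J (-g) := by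
      refine tendsto_finsetSum _ fun i _ => ?_
      have h1 : Continuous fun α : ℝ => qPoch q ((q ^ (α + 2 * g) : ℝ) : ℂ) i.2 :=
        (differentiable_qPoch i.2).continuous.comp (hpow _ (by fun_prop))
      have h2 : Continuous fun α : ℝ => qPoch q (c' α * xm) i.2 :=
        (differentiable_qPoch i.2).continuous.comp (hcc.mul continuous_const)
      have h3 : Continuous fun α : ℝ => qPoch q (c' α * xm⁻¹) i.2 :=
        (differentiable_qPoch i.2).continuous.comp (hcc.mul continuous_const)
      refine continuousAt_const.mul ((continuousAt_const.div h1.continuousAt ?_).mul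
        (h2.mul h3).continuousAt)
      rw [e1]
      exact qPoch_ne_zero_of_norm_lt hq0 hq1 ht _
    exact hcont.tendsto.mono_left nhdsWithin_le_nhds

/-- The values of the contour integral determine the operator `M_ξ`: for `|y₊| = t` and `|y₋| = 1`
all parameters of the contour lie in the open unit disc, and the corresponding points
`(y₊ y₋, y₊ y₋⁻¹)` fill a torus. -/
theorem eq_mxiEquiv_of_hasMxiValue (N : SymLaurent →ₗ[ℂ] SymLaurent)
    (hN : ∀ (f : SymLaurent) (yp ym : ℂ), yp ≠ 0 → ym ≠ 0 → MxiGeneric q g yp ym →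
      HasMxiValue q g ξ f.1.eval yp ym ((N f).1.eval (yp * ym) (yp * ym⁻¹))) :
    N = (mxiEquiv hq0 hq1 hg hξ).toLinearMap := by
  refine LinearMap.ext fun f => Subtype.ext (sub_eq_zero.1 ?_)
  have hρ : 0 < q ^ g := Real.rpow_pos_of_pos hq0 g
  refine eq_zero_of_eval_torus hρ _ fun u v => ?_
  have hρ' : ((q ^ g : ℝ) : ℂ) ≠ 0 := by exact_mod_cast hρ.ne'
  -- The point `(t u, t v)` of the torus is `(y₊ y₋, y₊ y₋⁻¹)` with `y₋² = u / v`.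
  obtain ⟨m, hm⟩ := IsAlgClosed.exists_pow_nat_eq ((u : ℂ) / v) (n := 2) (by norm_num)
  have hm1 : ‖m‖ = 1 := by
    have := congrArg norm hm
    rw [norm_pow, norm_div, Circle.norm_coe, Circle.norm_coe, div_one] at this
    exact (pow_eq_one_iff_of_nonneg (norm_nonneg m) two_ne_zero).1 this
  have hm0 : m ≠ 0 := by rintro rfl; simp at hm1
  have hyp : ((q ^ g : ℝ) : ℂ) * u / m ≠ 0 := div_ne_zero (mul_ne_zero hρ' u.coe_ne_zero) hm0
  have hgen : MxiGeneric q g (((q ^ g : ℝ) : ℂ) * u / m) m := by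
    refine awGeneric_of_norm_lt hq0 hq1 fun i => ?_
    have h1 : ‖((q ^ (g / 2) : ℝ) : ℂ)‖ < 1 := norm_rpow_lt_one hq0 hq1 (by linarith)
    have h2 : ‖tPow q g (-1) * (((q ^ g : ℝ) : ℂ) * u / m)‖ = 1 := by
      have e : tPow q g (-1) * (((q ^ g : ℝ) : ℂ) * u / m) = u / m := by
        rw [mul_div_assoc, ← mul_assoc, tPow_mul_rpow hq0]
        simp
      rw [e, norm_div, hm1, Circle.norm_coe, div_one]
    fin_cases i
    · simpa [awParams, hm1] using h1
    · simpa [awParams, hm1] using h1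
    · simp only [awParams, Fin.reduceFinMk, Matrix.cons_val]
      rwa [norm_mul, h2, one_mul]
    · simp only [awParams, Fin.reduceFinMk, Matrix.cons_val]
      rwa [norm_mul, norm_inv, h2, inv_one, one_mul]
  have hA := hN f _ m hyp hm0 hgen
  have hB := hasMxiValue_mxiEquiv hq0 hq1 hg hξ f hyp hm0 hgen
  obtain ⟨ε, h1, h2⟩ := (hA.and hB).exists
  have h := h1.symm.trans h2
  have e1 : ((q ^ g : ℝ) : ℂ) * u / m * m = ((q ^ g : ℝ) : ℂ) * u := div_mul_cancel₀ _ hm0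
  have e2 : ((q ^ g : ℝ) : ℂ) * u / m * m⁻¹ = ((q ^ g : ℝ) : ℂ) * v := by
    have hv : (v : ℂ) ≠ 0 := v.coe_ne_zero
    have hu : (u : ℂ) ≠ 0 := u.coe_ne_zero
    rw [eq_div_iff hv] at hm
    field_simp
    linear_combination -hm
  rw [e1, e2] at h
  rw [eval_eq_evalHom _ (mul_ne_zero hρ' u.coe_ne_zero) (mul_ne_zero hρ' v.coe_ne_zero)] at h ⊢
  rw [map_sub, sub_eq_zero]
  rw [eval_eq_evalHom _ (mul_ne_zero hρ' u.coe_ne_zero) (mul_ne_zero hρ' v.coe_ne_zero)] at h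
  exact h

end Operator

/-! ### Macdonald polynomials -/

section Separation

variable {q g : ℝ}

lemma macdonaldA1_eq {l₁ l₂ : ℤ} (hl : l₁ ≤ l₂) {xp xm : ℂ} (hxp : xp ≠ 0) (hxm : xm ≠ 0) :
    macdonaldA1 q g l₁ l₂ xp xm =
      qPoch q (q : ℂ) (gap l₁ l₂) / qPoch q (tPow q g 1) (gap l₁ l₂) *
      ((xp * xm * (xp * xm⁻¹)) ^ l₁ * ((xp * xm) ^ gap l₁ l₂ *
        rogers q (tPow q g 1) (gap l₁ l₂) (xp * xm⁻¹ / (xp * xm)))) := by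
  have hgap : l₁ + l₂ = 2 * l₁ + (gap l₁ l₂ : ℤ) := by rw [gap]; omega
  rw [macdonaldA1, qUltraspherical_eval _ _ hxm, hgap, zpow_add₀ hxp, zpow_natCast, zpow_mul,
    show xp * xm * (xp * xm⁻¹) = xp ^ (2 : ℤ) by rw [zpow_ofNat]; field_simp,
    mul_div_mul_left _ _ hxp, mul_pow]
  ring

lemma sepPoly_eq (hq0 : 0 < q) (hq1 : q < 1) (hg : 0 < g) (l₁ l₂ : ℤ) (y : ℂ) :
    sepPoly q g l₁ l₂ y = y ^ l₁ *
      (qPoch q (q : ℂ) (gap l₁ l₂) / qPoch q (tPow q g 1) (gap l₁ l₂) *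
        rogers q (tPow q g 1) (gap l₁ l₂) (y / tPow q g 1)) := by
  have ht0 : tPow q g 1 ≠ 0 := tPow_ne_zero hq0 1
  have ht := norm_tPow_one_lt hq0 hq1 hg
  have hq := qC_ne_zero hq0
  rw [sepPoly]
  congr 1
  rw [rogers, mul_sum]
  refine sum_congr rfl fun k hk => ?_
  rw [tPow_neg hq0, tPow_neg hq0, tPow_two hq0]
  obtain ⟨h1, h2⟩ := qPoch_neg_div hq0 hq1 ht0 ht (Nat.lt_succ_iff.1 (mem_range.1 hk))
  have h3 := qPoch_q_ne_zero hq0 hq1 k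
  have h4 := qPoch_q_ne_zero hq0 hq1 (gap l₁ l₂ - k)
  have h5 := qPoch_ne_zero_of_norm_lt hq0 hq1 ht (gap l₁ l₂)
  rw [binCoeff, binCoeff, mul_pow, mul_pow, div_pow, inv_pow, ← pow_mul]
  set t := tPow q g 1
  generalize qPoch q ((q : ℂ) ^ (-(gap l₁ l₂ : ℤ))) k = A at *
  generalize qPoch q (t⁻¹ * (q : ℂ) ^ (1 - (gap l₁ l₂ : ℤ))) k = B at *
  rw [show 2 * k = k + k by ring, pow_add]
  field_simp
  linear_combination (qPoch q t k * y ^ k) * h1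

variable (hq0 : 0 < q) {ξ : ℂ} (hξ : ξ ≠ 0)

/-- The coefficient of the Macdonald polynomial at the basis vector `(λ₁ + j, k)` with parameter
`ξ⁻¹`. -/
def macCoeff (q g : ℝ) (ξ : ℂ) (n k j : ℕ) : ℂ :=
  qPoch q (q : ℂ) n / qPoch q (tPow q g 1) n * ξ ^ n * (connCoeff q (tPow q g 1) n k *
    (binCoeff q (tPow q g 1 * (q : ℂ) ^ k) j * binCoeff q (tPow q g 1 * (q : ℂ) ^ k) (n - k - j) *
      ((q : ℂ) ^ k * (ξ ^ 2)⁻¹) ^ j))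

/-- The Macdonald polynomial as a symmetric Laurent polynomial, expanded in the basis on which
`M_ξ` acts diagonally. -/
def macVec (g : ℝ) (l₁ : ℤ) (n : ℕ) : SymLaurent :=
  ∑ p ∈ (range (n + 1)).sigma (fun k => range (n - k + 1)),
    macCoeff q g ξ n p.1 p.2 • symBasis hq0 (inv_ne_zero hξ) (l₁ + p.2, p.1)

lemma eval_macVec (hq1 : q < 1) (hg : 0 < g) (l₁ : ℤ) (n : ℕ)
    {x₁ x₂ : ℂ} (h₁ : x₁ ≠ 0) (h₂ : x₂ ≠ 0) :
    (macVec hq0 hξ g l₁ n).1.eval x₁ x₂ =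
      qPoch q (q : ℂ) n / qPoch q (tPow q g 1) n *
        ((x₁ * x₂) ^ l₁ * (x₁ ^ n * rogers q (tPow q g 1) n (x₂ / x₁))) := by
  have ht := norm_tPow_one_lt hq0 hq1 hg
  have hR := rogers_eq_rogersExp hq0 hq1 n ht (mul_ne_zero (inv_ne_zero hξ) h₁) (ξ⁻¹ * x₂)
  rw [mul_div_mul_left _ _ (inv_ne_zero hξ), mul_pow, inv_pow, mul_assoc,
    inv_mul_eq_iff_eq_mul₀ (pow_ne_zero n hξ)] at hR
  rw [hR, macVec, eval_sum_smul_symBasis hq0 (inv_ne_zero hξ) _ _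
    (fun p : (_ : ℕ) × ℕ => (l₁ + (p.2 : ℤ), p.1)) h₁ h₂, sum_sigma, rogersExp]
  simp only [mul_sum]
  refine sum_congr rfl fun k _ => ?_
  rw [rogers, mul_sum, sum_mul]
  simp only [mul_sum]
  refine sum_congr rfl fun j _ => ?_
  rw [macCoeff, zpow_add₀ (mul_ne_zero h₁ h₂), zpow_natCast,
    show (q : ℂ) ^ k * (ξ⁻¹ * x₁ * (ξ⁻¹ * x₂)) = (q : ℂ) ^ k * (ξ ^ 2)⁻¹ * (x₁ * x₂) by
      field_simp, mul_pow _ (x₁ * x₂)]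
  ring

/-- `M_ξ` factorises the Macdonald polynomial: it turns its expansion `rogersExp` into `sepExp`. -/
lemma eval_mxiEquiv_macVec (hq1 : q < 1) (hg : 0 < g) {l₁ l₂ : ℤ} (hl : l₁ ≤ l₂)
    {y₁ y₂ : ℂ} (h₁ : y₁ ≠ 0) (h₂ : y₂ ≠ 0) :
    (mxiEquiv hq0 hq1 hg hξ (macVec hq0 hξ g l₁ (gap l₁ l₂))).1.eval y₁ y₂ =
      normCoeff q g ξ l₁ l₂ * sepPoly q g l₁ l₂ y₁ * sepPoly q g l₁ l₂ y₂ := by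
  have ht := norm_tPow_one_lt hq0 hq1 hg
  have ht0 : tPow q g 1 ≠ 0 := tPow_ne_zero hq0 1
  have hgap : l₂ = l₁ + (gap l₁ l₂ : ℤ) := by rw [gap]; omega
  rw [sepPoly_eq hq0 hq1 hg, sepPoly_eq hq0 hq1 hg, normCoeff, tPow_two hq0]
  generalize gap l₁ l₂ = n at *
  subst hgap
  set t := tPow q g 1 with htdef
  have hS := sepExp_eq_mul hq0 hq1 n ht0 ht (y₁ / t) y₂
  have hn := qPoch_ne_zero_of_norm_lt hq0 hq1 ht n
  have hn2 := qPoch_ne_zero_of_norm_lt hq0 hq1 (norm_sq_lt_one ht) n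
  have hM : (mxiEquiv hq0 hq1 hg hξ (macVec hq0 hξ g l₁ n)).1.eval y₁ y₂ =
      qPoch q (q : ℂ) n / qPoch q t n * ξ ^ n * (ξ ^ 2 / t * (y₁ * y₂)) ^ l₁ *
        sepExp q t n (y₁ / t) y₂ := by
    rw [macVec, map_sum]
    simp only [map_smul, mxiEquiv_symBasis, smul_smul]
    rw [eval_sum_smul_symBasis hq0 one_ne_zero _ _
      (fun p : (_ : ℕ) × ℕ => (l₁ + (p.2 : ℤ), p.1)) h₁ h₂, sum_sigma, sepExp]
    simp only [mul_sum]
    refine sum_congr rfl fun k _ => ?_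
    rw [rogers, mul_sum, sum_mul]
    simp only [mul_sum]
    refine sum_congr rfl fun j _ => ?_
    rw [macCoeff, mxiFactor, zpow_add₀ (mul_ne_zero h₁ h₂), zpow_natCast,
      zpow_add₀ (div_ne_zero (pow_ne_zero 2 hξ) ht0), zpow_natCast, ← htdef, one_mul, one_mul,
      mul_zpow _ (y₁ * y₂), sepCoeff, mul_div_cancel₀ _ ht0,
      show (q : ℂ) ^ k * (y₁ / t * y₂) =
        (q : ℂ) ^ k * (ξ ^ 2)⁻¹ * (ξ ^ 2 / t) * (y₁ * y₂) by field_simp,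
      mul_pow _ (y₁ * y₂), mul_pow _ (ξ ^ 2 / t)]
    ring
  rw [hM, hS, show -2 * l₁ + (l₁ + (n : ℤ)) = -l₁ + n by ring, zpow_add₀ ht0, zpow_natCast, zpow_neg,
    show l₁ + (l₁ + (n : ℤ)) = 2 * l₁ + n by ring, zpow_add₀ hξ, zpow_natCast, zpow_mul, mul_zpow,
    div_zpow, mul_zpow, show ξ ^ (2 : ℤ) = ξ ^ 2 from zpow_ofNat ξ 2]
  have h6 : t ^ l₁ ≠ 0 := zpow_ne_zero _ ht0
  field_simp

end Separation

end SeparationOfVariables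

end

open SeparationOfVariables in
theorem mainTheorem2 (q g : ℝ) (hq0 : 0 < q) (hq1 : q < 1) (hg : 0 < g) (ξ : ℂ) (hξ : ξ ≠ 0) :
    ∃ M : SymLaurent ≃ₗ[ℂ] SymLaurent,
      -- `M` is the operator `M_ξ` on symmetric Laurent polynomials
      (∀ (f : SymLaurent) (yp ym : ℂ), yp ≠ 0 → ym ≠ 0 → MxiGeneric q g yp ym →
        HasMxiValue q g ξ f.1.eval yp ym ((M f).1.eval (yp * ym) (yp * ym⁻¹))) ∧
      -- and is determined by its contour integral
      (∀ N : SymLaurent →ₗ[ℂ] SymLaurent,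
        (∀ (f : SymLaurent) (yp ym : ℂ), yp ≠ 0 → ym ≠ 0 → MxiGeneric q g yp ym →
          HasMxiValue q g ξ f.1.eval yp ym ((N f).1.eval (yp * ym) (yp * ym⁻¹))) →
        N = M.toLinearMap) ∧
      -- the inverse operator is the contour integral with kernel `𝓜_{-g,2g}`
      (∀ (f : SymLaurent) (xp xm : ℂ), xp ≠ 0 → xm ≠ 0 →
        InversionFormula q g ξ f.1.eval xp xm ((M.symm f).1.eval (xp * xm) (xp * xm⁻¹))) ∧
      -- the inverse operator sends `c_{λ,ξ} f_λ(y_1) f_λ(y_2)` to `P_λ(x_1, x_2)`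
      (∀ l₁ l₂ : ℤ, l₁ ≤ l₂ →
        (∃ F : SymLaurent,
          (∀ y₁ y₂ : ℂ, y₁ ≠ 0 → y₂ ≠ 0 →
            F.1.eval y₁ y₂ = normCoeff q g ξ l₁ l₂ * sepPoly q g l₁ l₂ y₁ * sepPoly q g l₁ l₂ y₂) ∧
          (∀ xp xm : ℂ, xp ≠ 0 → xm ≠ 0 →
            (M.symm F).1.eval (xp * xm) (xp * xm⁻¹) = macdonaldA1 q g l₁ l₂ xp xm)) ∧
        -- so that `P_λ` has an integral representation in terms of `f_λ`
        (∀ xp xm : ℂ, xp ≠ 0 → xm ≠ 0 →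
          InversionFormula q g ξ
            (fun y₁ y₂ => normCoeff q g ξ l₁ l₂ * sepPoly q g l₁ l₂ y₁ * sepPoly q g l₁ l₂ y₂)
            xp xm (macdonaldA1 q g l₁ l₂ xp xm))) := by
  have hF : ∀ l₁ l₂ : ℤ, l₁ ≤ l₂ → ∀ y₁ y₂ : ℂ, y₁ ≠ 0 → y₂ ≠ 0 →
      (mxiEquiv hq0 hq1 hg hξ (macVec hq0 hξ g l₁ (gap l₁ l₂))).1.eval y₁ y₂ =
        normCoeff q g ξ l₁ l₂ * sepPoly q g l₁ l₂ y₁ * sepPoly q g l₁ l₂ y₂ :=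
    fun l₁ l₂ hl y₁ y₂ h₁ h₂ => eval_mxiEquiv_macVec hq0 hξ hq1 hg hl h₁ h₂
  have hP : ∀ l₁ l₂ : ℤ, l₁ ≤ l₂ → ∀ xp xm : ℂ, xp ≠ 0 → xm ≠ 0 →
      ((mxiEquiv hq0 hq1 hg hξ).symm (mxiEquiv hq0 hq1 hg hξ
        (macVec hq0 hξ g l₁ (gap l₁ l₂)))).1.eval (xp * xm) (xp * xm⁻¹) =
        macdonaldA1 q g l₁ l₂ xp xm := fun l₁ l₂ hl xp xm hxp hxm => by
    rw [LinearEquiv.symm_apply_apply, eval_macVec hq0 hξ hq1 hg _ _ (mul_ne_zero hxp hxm)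
      (mul_ne_zero hxp (inv_ne_zero hxm)), macdonaldA1_eq hl hxp hxm]
  refine ⟨mxiEquiv hq0 hq1 hg hξ, ?_, ?_, ?_, ?_⟩
  · exact fun f yp ym => hasMxiValue_mxiEquiv hq0 hq1 hg hξ f
  · exact eq_mxiEquiv_of_hasMxiValue hq0 hq1 hg hξ
  · exact fun f xp xm => inversionFormula_mxiEquiv_symm hq0 hq1 hg hξ f fun _ _ _ _ => rfl
  · refine fun l₁ l₂ hl => ⟨⟨_, hF l₁ l₂ hl, hP l₁ l₂ hl⟩, fun xp xm hxp hxm => ?_⟩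
    rw [← hP l₁ l₂ hl xp xm hxp hxm]
    exact inversionFormula_mxiEquiv_symm hq0 hq1 hg hξ _
      (fun y₁ y₂ h₁ h₂ => (hF l₁ l₂ hl y₁ y₂ h₁ h₂).symm) hxp hxm
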